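/- Work over $\mathbb C$. Let $JP(2)$ be the Jordan superalgebra of block matrices $\begin{pmatrix}A&B\\ C&A^{T}\end{pmatrix}$ with $A,B,C\in M_2(\mathbb C)$, $B^T=B$, $C^T=-C$ (the diagonal blocks form the even part, the off-diagonal blocks the odd part), with product $X\cdot Y=\frac12(XY+(-1)^{|X||Y|}YX)$. Let $JP(2)\text{-mod}_{1/2}$ be the category of special $JP(2)$-modules, that is, of finite-dimensional $\mathbb Z_2$-graded Jordan bimodules on which the identity element acts as $\frac12\mathrm{id}$. Let $P(3)$ be the Lie superalgebra of block matrices $\begin{pmatrix}A&B\\ C&-A^{T}\end{pmatrix}$ with $A,B,C\in M_4(\mathbb C)$, $\operatorname{tr}A=0$, $B^T=B$, $C^T=-C$, with the supercommutator as bracket, and let $\hat{\mathfrak g}=\hat P(3)$ be its universal central extension. Put $X_A=\begin{pmatrix}A&0\\0&-A^T\end{pmatrix}$, $e=X_A$ with $A=E_{13}+E_{24}$, and $f=\frac12X_{A'}$ with $A'=E_{31}+E_{42}$; let $h\in\hat{\mathfrak g}$ be the bracket of any lifts of $e$ and $f$. Let $\hat{\mathfrak g}\text{-mod}_{1/2}$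 be the category of finite-dimensional $\mathbb Z_2$-graded $\hat{\mathfrak g}$-modules $V$ with a very short grading: $V=V[-\frac12]\oplus V[\frac12]$, where $V[\pm\frac12]$ is the eigenspace of $h$ for the eigenvalue $\pm\frac12$. In both categories the morphisms are the parity-preserving module homomorphisms, and $V^{op}$ denotes $V$ with the parity exchanged. A block is the full subcategory of the objects all of whose simple subquotients lie in one class of the equivalence relation on simple objects generated by isomorphism and by the existence of a non-split extension. (a) Every block of $\hat{\mathfrak g}\text{-mod}_{1/2}$, and every block of $JP(2)\text{-mod}_{1/2}$, has a simple object that is unique up to isomorphism. (b) Each of the categories $\hat{\mathfrak g}\text{-mod}_{1/2}$ and $JP(2)\text{-mod}_{1/2}$ is equivalent, as a $\mathbb C$-linear category, to the category of finite-dimensional $\mathbb Z_2$-graded representations of the polynomial ring $\mathbb C[x]$ (with $x$ even, and parity-preserving homomorphisms). (c) For $t\in\mathbb C$ let $W(t)$ be the superspace $\mathbb C^{2|2}$ with the homomorphism of Jordan superalgebras $$\rho_t\colon JP(2)\to \operatorname{End}(\mathbb C^{2|2})^+,\qquad \rho_t\begin{pmatrix}A&B\\ C&A^{T}\end{pmatrix}=\begin{pmatrix}A&B+tC\\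 C&A^{T}\end{pmatrix},$$ regarded as a bimodule in which $X$ acts by $\frac12\rho_t(X)$. Then $W(t)$ and $W(t)^{op}$ are simple objects of $JP(2)\text{-mod}_{1/2}$, and every simple object of $JP(2)\text{-mod}_{1/2}$ is isomorphic to $W(t)$ or to $W(t)^{op}$ for some $t\in\mathbb C$. -/

import Mathlib

open CategoryTheory Matrix TensorProduct Polynomial

set_option linter.unusedSectionVars false

noncomputable section

namespace SuperJP

/-! ### Superspaces, Jordan and Lie superalgebras over `ℂ`

A superspace is a complex vector space with an internal direct sum decomposition
`grading : ZMod 2 → Submodule ℂ V`. -/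

/-- The Koszul sign `(-1)^(i j)`. -/
def ksgn (i j : ZMod 2) : ℂ := (-1) ^ (i.val * j.val)

lemma ksgn_00 : ksgn 0 0 = 1 := by simp [ksgn]
lemma ksgn_01 : ksgn 0 1 = 1 := by simp [ksgn]
lemma ksgn_10 : ksgn 1 0 = 1 := by simp [ksgn]
lemma ksgn_11 : ksgn 1 1 = -1 := by simp [ksgn, ZMod.val_one]

/-- The axioms of a Jordan superalgebra for a bilinear product on a `ZMod 2`-graded space. -/
structure IsJordanSuper {A : Type} [AddCommGroup A] [Module ℂ A]
    (grading : ZMod 2 → Submodule ℂ A) (mul : A →ₗ[ℂ] A →ₗ[ℂ] A) : Prop where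
  mul_mem : ∀ i j : ZMod 2, ∀ a ∈ grading i, ∀ b ∈ grading j, mul a b ∈ grading (i + j)
  comm : ∀ i j : ZMod 2, ∀ a ∈ grading i, ∀ b ∈ grading j, mul a b = ksgn i j • mul b a
  jordan : ∀ i j k l : ZMod 2, ∀ a ∈ grading i, ∀ b ∈ grading j, ∀ c ∈ grading k,
    ∀ d ∈ grading l,
    mul (mul (mul a b) c) d
      + (ksgn j k * ksgn j l * ksgn k l) • mul (mul (mul a d) c) b
      + (ksgn i j * ksgn i k * ksgn i l * ksgn k l) • mul (mul (mul b d) c) a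
    = mul (mul a b) (mul c d)
      + ksgn j k • mul (mul a c) (mul b d)
      + (ksgn l j * ksgn l k) • mul (mul a d) (mul b c)

/-- A Jordan superalgebra over `ℂ`. -/
structure JordanSuperalgebra where
  carrier : Type
  [addCommGroup : AddCommGroup carrier]
  [module : Module ℂ carrier]
  grading : ZMod 2 → Submodule ℂ carrier
  isInternal : DirectSum.IsInternal grading
  mul : carrier →ₗ[ℂ] carrier →ₗ[ℂ] carrier
  isJordan : IsJordanSuper grading mul

attribute [instance] JordanSuperalgebra.addCommGroup JordanSuperalgebra.module

/-- A Lie superalgebra over `ℂ`. -/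
structure LieSuperalgebra where
  carrier : Type
  [addCommGroup : AddCommGroup carrier]
  [module : Module ℂ carrier]
  grading : ZMod 2 → Submodule ℂ carrier
  isInternal : DirectSum.IsInternal grading
  bracket : carrier →ₗ[ℂ] carrier →ₗ[ℂ] carrier
  bracket_mem : ∀ i j : ZMod 2, ∀ x ∈ grading i, ∀ y ∈ grading j, bracket x y ∈ grading (i + j)
  skew : ∀ i j : ZMod 2, ∀ x ∈ grading i, ∀ y ∈ grading j, bracket x y = -(ksgn i j • bracket y x)
  jacobi : ∀ i j k : ZMod 2, ∀ x ∈ grading i, ∀ y ∈ grading j, ∀ z ∈ grading k,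
    bracket x (bracket y z) = bracket (bracket x y) z + ksgn i j • bracket y (bracket x z)

attribute [instance] LieSuperalgebra.addCommGroup LieSuperalgebra.module

/-! ### The associative superalgebra of `(n|n)`-matrices -/

section Mat

variable (n : Type) [Fintype n] [DecidableEq n]

/-- Square matrices of size `n|n`, in four blocks. -/
abbrev SMat : Type := Matrix (n ⊕ n) (n ⊕ n) ℂ

/-- The component of parity `i` of a matrix: the diagonal blocks for `i = 0`, the off-diagonal
blocks for `i = 1`. -/
def matPart (i : ZMod 2) : SMat n →ₗ[ℂ] SMat n where
  toFun X := if i = 0 then fromBlocks X.toBlocks₁₁ 0 0 X.toBlocks₂₂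
    else fromBlocks 0 X.toBlocks₁₂ X.toBlocks₂₁ 0
  map_add' X Y := by
    split_ifs <;> ext (a | a) (b | b) <;> simp [toBlocks₁₁, toBlocks₁₂, toBlocks₂₁, toBlocks₂₂]
  map_smul' c X := by
    split_ifs <;> ext (a | a) (b | b) <;> simp [toBlocks₁₁, toBlocks₁₂, toBlocks₂₁, toBlocks₂₂]

/-- The supercommutator: `[X, Y] = X Y - (-1)^(|X| |Y|) Y X` for homogeneous `X`, `Y`, extended
bilinearly. -/
def superComm : SMat n →ₗ[ℂ] SMat n →ₗ[ℂ] SMat n :=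
  ∑ i : ZMod 2, ∑ j : ZMod 2,
    ((LinearMap.mul ℂ (SMat n)).compl₁₂ (matPart n i) (matPart n j)
      - ksgn i j • (LinearMap.mul ℂ (SMat n)).flip.compl₁₂ (matPart n i) (matPart n j))

/-- The Jordan superproduct: `X · Y = ½ (X Y + (-1)^(|X| |Y|) Y X)` for homogeneous `X`, `Y`,
extended bilinearly. -/
def superJord : SMat n →ₗ[ℂ] SMat n →ₗ[ℂ] SMat n :=
  (1 / 2 : ℂ) • ∑ i : ZMod 2, ∑ j : ZMod 2,
    ((LinearMap.mul ℂ (SMat n)).compl₁₂ (matPart n i) (matPart n j)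
      + ksgn i j • (LinearMap.mul ℂ (SMat n)).flip.compl₁₂ (matPart n i) (matPart n j))

/-- Homogeneous matrices of parity `i`. -/
def matGrading (i : ZMod 2) : Submodule ℂ (SMat n) :=
  LinearMap.eqLocus (matPart n i) LinearMap.id

end Mat

variable {n : Type} [Fintype n] [DecidableEq n]

lemma mem_matGrading {i : ZMod 2} {X : SMat n} : X ∈ matGrading n i ↔ matPart n i X = X := Iff.rfl

lemma zmod2_cases (i : ZMod 2) : i = 0 ∨ i = 1 := by
  revert i; decide

lemma matPart_zero_apply (X : SMat n) :
    matPart n 0 X = fromBlocks X.toBlocks₁₁ 0 0 X.toBlocks₂₂ := by simp [matPart]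

lemma matPart_one_apply (X : SMat n) :
    matPart n 1 X = fromBlocks 0 X.toBlocks₁₂ X.toBlocks₂₁ 0 := by simp [matPart]

lemma matPart_add_matPart (X : SMat n) : matPart n 0 X + matPart n 1 X = X := by
  rw [matPart_zero_apply, matPart_one_apply, fromBlocks_add]
  simp [fromBlocks_toBlocks]

lemma matPart_matPart (i j : ZMod 2) (X : SMat n) :
    matPart n i (matPart n j X) = if i = j then matPart n j X else 0 := by
  rcases zmod2_cases i with rfl | rfl <;> rcases zmod2_cases j with rfl | rfl <;>
    simp [matPart_zero_apply, matPart_one_apply]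

lemma matPart_of_mem {i j : ZMod 2} {X : SMat n} (hX : X ∈ matGrading n i) :
    matPart n j X = if j = i then X else 0 := by
  have h := matPart_matPart j i X
  rwa [mem_matGrading.1 hX] at h

lemma mul_mem_matGrading {i j : ZMod 2} {X Y : SMat n} (hX : X ∈ matGrading n i)
    (hY : Y ∈ matGrading n j) : X * Y ∈ matGrading n (i + j) := by
  rw [mem_matGrading] at *
  rw [← hX, ← hY]
  rcases zmod2_cases i with rfl | rfl <;> rcases zmod2_cases j with rfl | rfl <;>
    simp [matPart_zero_apply, matPart_one_apply, fromBlocks_multiply,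
      show (1 : ZMod 2) + 1 = 0 from rfl]

lemma superComm_of_mem {i j : ZMod 2} {X Y : SMat n} (hX : X ∈ matGrading n i)
    (hY : Y ∈ matGrading n j) : superComm n X Y = X * Y - ksgn i j • (Y * X) := by
  simp only [superComm, LinearMap.sum_apply, LinearMap.sub_apply, LinearMap.smul_apply,
    LinearMap.compl₁₂_apply, LinearMap.flip_apply, LinearMap.mul_apply', matPart_of_mem hX,
    matPart_of_mem hY]
  rw [Finset.sum_eq_single i (by intro b _ hb; simp [hb]) (by simp),
    Finset.sum_eq_single j (by intro b _ hb; simp [hb]) (by simp)]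
  simp

lemma superJord_of_mem {i j : ZMod 2} {X Y : SMat n} (hX : X ∈ matGrading n i)
    (hY : Y ∈ matGrading n j) :
    superJord n X Y = (1 / 2 : ℂ) • (X * Y + ksgn i j • (Y * X)) := by
  simp only [superJord, LinearMap.sum_apply, LinearMap.add_apply, LinearMap.smul_apply,
    LinearMap.compl₁₂_apply, LinearMap.flip_apply, LinearMap.mul_apply', matPart_of_mem hX,
    matPart_of_mem hY]
  rw [Finset.sum_eq_single i (by intro b _ hb; simp [hb]) (by simp),
    Finset.sum_eq_single j (by intro b _ hb; simp [hb]) (by simp)]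
  simp

lemma superComm_mem {i j : ZMod 2} {X Y : SMat n} (hX : X ∈ matGrading n i)
    (hY : Y ∈ matGrading n j) : superComm n X Y ∈ matGrading n (i + j) := by
  rw [superComm_of_mem hX hY]
  exact Submodule.sub_mem _ (mul_mem_matGrading hX hY)
    (Submodule.smul_mem _ _ (add_comm i j ▸ mul_mem_matGrading hY hX))

lemma superJord_mem {i j : ZMod 2} {X Y : SMat n} (hX : X ∈ matGrading n i)
    (hY : Y ∈ matGrading n j) : superJord n X Y ∈ matGrading n (i + j) := by
  rw [superJord_of_mem hX hY]
  exact Submodule.smul_mem _ _ (Submodule.add_mem _ (mul_mem_matGrading hX hY)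
    (Submodule.smul_mem _ _ (add_comm i j ▸ mul_mem_matGrading hY hX)))

/-- A subspace of matrices stable under `matPart` is graded by its homogeneous elements. -/
lemma isInternal_comap (S : Submodule ℂ (SMat n)) (hS : ∀ i, ∀ X ∈ S, matPart n i X ∈ S) :
    DirectSum.IsInternal (fun i : ZMod 2 => (matGrading n i).comap S.subtype) := by
  rw [DirectSum.isInternal_submodule_iff_isCompl (i := (0 : ZMod 2)) (j := 1) _ (by decide)
    (by ext i; simpa using zmod2_cases i)]
  constructor
  · rw [Submodule.disjoint_def]
    rintro ⟨X, hX⟩ h0 h1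
    have h0' : X ∈ matGrading n 0 := h0
    have h1' : X ∈ matGrading n 1 := h1
    have := matPart_of_mem (j := 1) h0'
    rw [mem_matGrading.1 h1'] at this
    simpa using this
  · rw [codisjoint_iff, Submodule.eq_top_iff']
    rintro ⟨X, hX⟩
    refine Submodule.mem_sup.2 ⟨⟨_, hS 0 X hX⟩, ?_, ⟨_, hS 1 X hX⟩, ?_, ?_⟩
    · exact mem_matGrading.2 (by simp [matPart_matPart])
    · exact mem_matGrading.2 (by simp [matPart_matPart])
    · exact Subtype.ext (matPart_add_matPart X)

/-! ### The Jordan superalgebra `JP(n)` and the Lie superalgebra `P(n-1)` -/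

section JP

variable (n)

/-- The underlying space of `JP(n)`: block matrices `[A, B; C, Aᵀ]` with `Bᵀ = B`, `Cᵀ = -C`. -/
def jpSpace : Submodule ℂ (SMat n) where
  carrier := {X | X.toBlocks₂₂ = X.toBlocks₁₁ᵀ ∧ X.toBlocks₁₂ᵀ = X.toBlocks₁₂ ∧
    X.toBlocks₂₁ᵀ = -X.toBlocks₂₁}
  add_mem' := by
    rintro X Y ⟨h1, h2, h3⟩ ⟨k1, k2, k3⟩
    have e1 : (X + Y).toBlocks₁₁ = X.toBlocks₁₁ + Y.toBlocks₁₁ := rfl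
    have e2 : (X + Y).toBlocks₁₂ = X.toBlocks₁₂ + Y.toBlocks₁₂ := rfl
    have e3 : (X + Y).toBlocks₂₁ = X.toBlocks₂₁ + Y.toBlocks₂₁ := rfl
    have e4 : (X + Y).toBlocks₂₂ = X.toBlocks₂₂ + Y.toBlocks₂₂ := rfl
    refine ⟨?_, ?_, ?_⟩
    · rw [e4, e1, h1, k1, transpose_add]
    · rw [e2, transpose_add, h2, k2]
    · rw [e3, transpose_add, h3, k3, neg_add]
  zero_mem' := by
    refine ⟨?_, ?_, ?_⟩ <;> ext <;> simp [toBlocks₁₁, toBlocks₁₂, toBlocks₂₁, toBlocks₂₂]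
  smul_mem' := by
    rintro c X ⟨h1, h2, h3⟩
    have e1 : (c • X).toBlocks₁₁ = c • X.toBlocks₁₁ := rfl
    have e2 : (c • X).toBlocks₁₂ = c • X.toBlocks₁₂ := rfl
    have e3 : (c • X).toBlocks₂₁ = c • X.toBlocks₂₁ := rfl
    have e4 : (c • X).toBlocks₂₂ = c • X.toBlocks₂₂ := rfl
    refine ⟨?_, ?_, ?_⟩
    · rw [e4, e1, h1, transpose_smul]
    · rw [e2, transpose_smul, h2]
    · rw [e3, transpose_smul, h3, smul_neg]

/-- The underlying space of `P(n-1)`: block matrices `[A, B; C, -Aᵀ]` with `tr A = 0`, `Bᵀ = B`,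
`Cᵀ = -C`. -/
def pSpace : Submodule ℂ (SMat n) where
  carrier := {X | X.toBlocks₂₂ = -X.toBlocks₁₁ᵀ ∧ X.toBlocks₁₁.trace = 0 ∧
    X.toBlocks₁₂ᵀ = X.toBlocks₁₂ ∧ X.toBlocks₂₁ᵀ = -X.toBlocks₂₁}
  add_mem' := by
    rintro X Y ⟨h1, h0, h2, h3⟩ ⟨k1, k0, k2, k3⟩
    have e1 : (X + Y).toBlocks₁₁ = X.toBlocks₁₁ + Y.toBlocks₁₁ := rfl
    have e2 : (X + Y).toBlocks₁₂ = X.toBlocks₁₂ + Y.toBlocks₁₂ := rfl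
    have e3 : (X + Y).toBlocks₂₁ = X.toBlocks₂₁ + Y.toBlocks₂₁ := rfl
    have e4 : (X + Y).toBlocks₂₂ = X.toBlocks₂₂ + Y.toBlocks₂₂ := rfl
    refine ⟨?_, ?_, ?_, ?_⟩
    · rw [e4, e1, h1, k1, transpose_add, neg_add]
    · rw [e1, trace_add, h0, k0, add_zero]
    · rw [e2, transpose_add, h2, k2]
    · rw [e3, transpose_add, h3, k3, neg_add]
  zero_mem' := by
    refine ⟨?_, ?_, ?_, ?_⟩
    · ext; simp [toBlocks₁₁, toBlocks₂₂]
    · simp [toBlocks₁₁, trace]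
    · ext; simp [toBlocks₁₂]
    · ext; simp [toBlocks₂₁]
  smul_mem' := by
    rintro c X ⟨h1, h0, h2, h3⟩
    have e1 : (c • X).toBlocks₁₁ = c • X.toBlocks₁₁ := rfl
    have e2 : (c • X).toBlocks₁₂ = c • X.toBlocks₁₂ := rfl
    have e3 : (c • X).toBlocks₂₁ = c • X.toBlocks₂₁ := rfl
    have e4 : (c • X).toBlocks₂₂ = c • X.toBlocks₂₂ := rfl
    refine ⟨?_, ?_, ?_, ?_⟩
    · rw [e4, e1, h1, transpose_smul, smul_neg]
    · rw [e1, trace_smul, h0, smul_zero]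
    · rw [e2, transpose_smul, h2]
    · rw [e3, transpose_smul, h3, smul_neg]

end JP

lemma matPart_mem_jpSpace (i : ZMod 2) (X : SMat n) (hX : X ∈ jpSpace n) :
    matPart n i X ∈ jpSpace n := by
  obtain ⟨h1, h2, h3⟩ := hX
  rcases zmod2_cases i with rfl | rfl
  · rw [matPart_zero_apply]; exact ⟨by simpa using h1, by simp, by simp⟩
  · rw [matPart_one_apply]; exact ⟨by simp, by simpa using h2, by simpa using h3⟩

lemma matPart_mem_pSpace (i : ZMod 2) (X : SMat n) (hX : X ∈ pSpace n) :
    matPart n i X ∈ pSpace n := by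
  obtain ⟨h1, h0, h2, h3⟩ := hX
  rcases zmod2_cases i with rfl | rfl
  · rw [matPart_zero_apply]; exact ⟨by simpa using h1, by simpa using h0, by simp, by simp⟩
  · rw [matPart_one_apply]; exact ⟨by simp, by simp, by simpa using h2, by simpa using h3⟩

/-- To check that a bilinear product preserves a subspace, homogeneous elements suffice. -/
lemma bilin_mem_of_homogeneous (S : Submodule ℂ (SMat n))
    (m : SMat n →ₗ[ℂ] SMat n →ₗ[ℂ] SMat n)
    (hm : ∀ i j : ZMod 2, ∀ X ∈ S, ∀ Y ∈ S, m (matPart n i X) (matPart n j Y) ∈ S) :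
    ∀ X ∈ S, ∀ Y ∈ S, m X Y ∈ S := by
  intro X hX Y hY
  rw [← matPart_add_matPart X, ← matPart_add_matPart Y]
  simp only [map_add, LinearMap.add_apply]
  exact S.add_mem (S.add_mem (hm 0 0 X hX Y hY) (hm 1 0 X hX Y hY))
    (S.add_mem (hm 0 1 X hX Y hY) (hm 1 1 X hX Y hY))

lemma matPart_mem_matGrading (i : ZMod 2) (X : SMat n) : matPart n i X ∈ matGrading n i :=
  mem_matGrading.2 (by simp [matPart_matPart])

lemma superJord_mem_jpSpace : ∀ X ∈ jpSpace n, ∀ Y ∈ jpSpace n, superJord n X Y ∈ jpSpace n := by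
  refine bilin_mem_of_homogeneous _ _ ?_
  rintro i j X ⟨h1, h2, h3⟩ Y ⟨k1, k2, k3⟩
  rw [superJord_of_mem (matPart_mem_matGrading i X) (matPart_mem_matGrading j Y)]
  refine Submodule.smul_mem _ _ ?_
  rcases zmod2_cases i with rfl | rfl <;> rcases zmod2_cases j with rfl | rfl <;>
    simp only [matPart_zero_apply, matPart_one_apply, fromBlocks_multiply, ksgn_00, ksgn_01,
      ksgn_10, ksgn_11, fromBlocks_smul, fromBlocks_add] <;>
    refine ⟨?_, ?_, ?_⟩ <;>
    simp [h1, h2, h3, k1, k2, k3, transpose_mul] <;> abel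

lemma superComm_mem_pSpace : ∀ X ∈ pSpace n, ∀ Y ∈ pSpace n, superComm n X Y ∈ pSpace n := by
  refine bilin_mem_of_homogeneous _ _ ?_
  rintro i j X ⟨h1, h0, h2, h3⟩ Y ⟨k1, k0, k2, k3⟩
  have tr0 : ∀ B C : Matrix n n ℂ, Bᵀ = B → Cᵀ = -C → (B * C).trace = 0 := by
    intro B C hB hC
    have : (B * C).trace = -(B * C).trace := by
      conv_lhs => rw [← trace_transpose, transpose_mul, hB, hC, neg_mul, trace_neg, trace_mul_comm]
    linear_combination (1 / 2 : ℂ) * this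
  have e1 := tr0 _ _ h2 k3
  have e2 := tr0 _ _ k2 h3
  rw [superComm_of_mem (matPart_mem_matGrading i X) (matPart_mem_matGrading j Y)]
  rcases zmod2_cases i with rfl | rfl <;> rcases zmod2_cases j with rfl | rfl <;>
    simp only [matPart_zero_apply, matPart_one_apply, fromBlocks_multiply, ksgn_00, ksgn_01,
      ksgn_10, ksgn_11, fromBlocks_smul, sub_eq_add_neg, fromBlocks_neg, fromBlocks_add] <;>
    refine ⟨?_, ?_, ?_, ?_⟩ <;>
    simp [h1, h2, h3, k1, k2, k3, transpose_mul, trace_mul_comm Y.toBlocks₁₁ X.toBlocks₁₁,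
      e1, e2] <;> abel

lemma superJord_comm {i j : ZMod 2} {X Y : SMat n} (hX : X ∈ matGrading n i)
    (hY : Y ∈ matGrading n j) : superJord n X Y = ksgn i j • superJord n Y X := by
  rw [superJord_of_mem hX hY, superJord_of_mem hY hX]
  rcases zmod2_cases i with rfl | rfl <;> rcases zmod2_cases j with rfl | rfl <;>
    simp [ksgn_00, ksgn_01, ksgn_10, ksgn_11, add_comm]

lemma superComm_skew {i j : ZMod 2} {X Y : SMat n} (hX : X ∈ matGrading n i)
    (hY : Y ∈ matGrading n j) : superComm n X Y = -(ksgn i j • superComm n Y X) := by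
  rw [superComm_of_mem hX hY, superComm_of_mem hY hX]
  rcases zmod2_cases i with rfl | rfl <;> rcases zmod2_cases j with rfl | rfl <;>
    simp [ksgn_00, ksgn_01, ksgn_10, ksgn_11]

lemma superComm_jacobi {i j k : ZMod 2} {X Y Z : SMat n} (hX : X ∈ matGrading n i)
    (hY : Y ∈ matGrading n j) (hZ : Z ∈ matGrading n k) :
    superComm n X (superComm n Y Z)
      = superComm n (superComm n X Y) Z + ksgn i j • superComm n Y (superComm n X Z) := by
  rw [superComm_of_mem hX (superComm_mem hY hZ), superComm_of_mem (superComm_mem hX hY) hZ,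
    superComm_of_mem hY (superComm_mem hX hZ), superComm_of_mem hX hY, superComm_of_mem hY hZ,
    superComm_of_mem hX hZ]
  rcases zmod2_cases i with rfl | rfl <;> rcases zmod2_cases j with rfl | rfl <;>
    rcases zmod2_cases k with rfl | rfl <;>
    simp only [ksgn_00, ksgn_01, ksgn_10, ksgn_11, add_zero, zero_add,
      show (1 : ZMod 2) + 1 = 0 from rfl, one_smul, neg_smul] <;> noncomm_ring

/-- The Jordan superidentity in an associative superalgebra, written out. -/
lemma assoc_jordan {A : Type} [Ring A] [Algebra ℂ A] (i j k l : ZMod 2) (a b c d : A) :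
    let J : ZMod 2 → ZMod 2 → A → A → A := fun p q x y =>
      (1 / 2 : ℂ) • (x * y + ksgn p q • (y * x))
    J (i + j + k) l (J (i + j) k (J i j a b) c) d
      + (ksgn j k * ksgn j l * ksgn k l) • J (i + l + k) j (J (i + l) k (J i l a d) c) b
      + (ksgn i j * ksgn i k * ksgn i l * ksgn k l) •
          J (j + l + k) i (J (j + l) k (J j l b d) c) a
    = J (i + j) (k + l) (J i j a b) (J k l c d)
      + ksgn j k • J (i + k) (j + l) (J i k a c) (J j l b d)
      + (ksgn l j * ksgn l k) • J (i + l) (j + k) (J i l a d) (J j k b c) := by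
  intro J
  simp only [J]
  rcases zmod2_cases i with rfl | rfl <;> rcases zmod2_cases j with rfl | rfl <;>
    rcases zmod2_cases k with rfl | rfl <;> rcases zmod2_cases l with rfl | rfl <;>
    simp only [ksgn_00, ksgn_01, ksgn_10, ksgn_11, add_zero, zero_add, mul_one, mul_neg, neg_neg,
      show (1 : ZMod 2) + 1 = 0 from rfl, one_smul, neg_smul, smul_add, smul_neg, mul_add, add_mul,
      neg_mul, smul_mul_assoc, mul_smul_comm, mul_assoc, neg_add, mul_neg] <;>
    module

lemma superJord_jordan {i j k l : ZMod 2} {a b c d : SMat n} (ha : a ∈ matGrading n i)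
    (hb : b ∈ matGrading n j) (hc : c ∈ matGrading n k) (hd : d ∈ matGrading n l) :
    superJord n (superJord n (superJord n a b) c) d
      + (ksgn j k * ksgn j l * ksgn k l) • superJord n (superJord n (superJord n a d) c) b
      + (ksgn i j * ksgn i k * ksgn i l * ksgn k l) •
          superJord n (superJord n (superJord n b d) c) a
    = superJord n (superJord n a b) (superJord n c d)
      + ksgn j k • superJord n (superJord n a c) (superJord n b d)
      + (ksgn l j * ksgn l k) • superJord n (superJord n a d) (superJord n b c) := by
  rw [superJord_of_mem (superJord_mem (superJord_mem ha hb) hc) hd,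
    superJord_of_mem (superJord_mem (superJord_mem ha hd) hc) hb,
    superJord_of_mem (superJord_mem (superJord_mem hb hd) hc) ha,
    superJord_of_mem (superJord_mem ha hb) (superJord_mem hc hd),
    superJord_of_mem (superJord_mem ha hc) (superJord_mem hb hd),
    superJord_of_mem (superJord_mem ha hd) (superJord_mem hb hc),
    superJord_of_mem (superJord_mem ha hb) hc, superJord_of_mem (superJord_mem ha hd) hc,
    superJord_of_mem (superJord_mem hb hd) hc,
    superJord_of_mem ha hb, superJord_of_mem hc hd, superJord_of_mem ha hc,
    superJord_of_mem hb hd, superJord_of_mem ha hd, superJord_of_mem hb hc]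
  exact assoc_jordan i j k l a b c d

/-- Restriction of a bilinear product to a stable subspace. -/
def restrictBilin (S : Submodule ℂ (SMat n)) (m : SMat n →ₗ[ℂ] SMat n →ₗ[ℂ] SMat n)
    (h : ∀ X ∈ S, ∀ Y ∈ S, m X Y ∈ S) : S →ₗ[ℂ] S →ₗ[ℂ] S :=
  LinearMap.mk₂ ℂ (fun X Y => ⟨m X Y, h X X.2 Y Y.2⟩)
    (fun _ _ _ => Subtype.ext (by simp)) (fun _ _ _ => Subtype.ext (by simp))
    (fun _ _ _ => Subtype.ext (by simp)) (fun _ _ _ => Subtype.ext (by simp))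

variable (n)

/-- The Jordan superalgebra `JP(n)`, a subalgebra of `M_{n,n}^+`. -/
def JP : JordanSuperalgebra where
  carrier := jpSpace n
  grading i := (matGrading n i).comap (jpSpace n).subtype
  isInternal := isInternal_comap _ matPart_mem_jpSpace
  mul := restrictBilin (jpSpace n) (superJord n) superJord_mem_jpSpace
  isJordan :=
    { mul_mem := fun _ _ _ ha _ hb => superJord_mem ha hb
      comm := fun _ _ _ ha _ hb => Subtype.ext (superJord_comm ha hb)
      jordan := fun _ _ _ _ _ ha _ hb _ hc _ hd => Subtype.ext (superJord_jordan ha hb hc hd) }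

/-- The identity element of `JP(n)`. -/
def jpOne : (JP n).carrier :=
  (⟨1, by
    have h : fromBlocks 1 0 0 1 ∈ jpSpace n :=
      ⟨by simp [-fromBlocks_one], by simp [-fromBlocks_one], by simp [-fromBlocks_one]⟩
    rwa [fromBlocks_one] at h⟩ : jpSpace n)

/-- The periplectic Lie superalgebra of `(m|m)`-matrices, `m = |n|`, usually written `P(m-1)`. -/
def PLie : LieSuperalgebra where
  carrier := pSpace n
  grading i := (matGrading n i).comap (pSpace n).subtype
  isInternal := isInternal_comap _ matPart_mem_pSpace
  bracket := restrictBilin (pSpace n) (superComm n) superComm_mem_pSpace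
  bracket_mem := fun _ _ _ hx _ hy => superComm_mem hx hy
  skew := fun _ _ _ hx _ hy => Subtype.ext (superComm_skew hx hy)
  jacobi := fun _ _ _ _ hx _ hy _ hz => Subtype.ext (superComm_jacobi hx hy hz)

variable {n}

/-! ### The universal central extension of a perfect Lie superalgebra -/

section UCE

variable (L : LieSuperalgebra)

/-- The relations `x ⊗ y + (-1)^(|x| |y|) y ⊗ x` and
`x ⊗ [y, z] - [x, y] ⊗ z - (-1)^(|x| |y|) y ⊗ [x, z]`, for homogeneous `x, y, z`. -/
def uceRel : Submodule ℂ (L.carrier ⊗[ℂ] L.carrier) :=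
  Submodule.span ℂ
    ({w | ∃ i j : ZMod 2, ∃ x ∈ L.grading i, ∃ y ∈ L.grading j,
        w = x ⊗ₜ[ℂ] y + ksgn i j • y ⊗ₜ[ℂ] x} ∪
     {w | ∃ i j k : ZMod 2, ∃ x ∈ L.grading i, ∃ y ∈ L.grading j, ∃ z ∈ L.grading k,
        w = x ⊗ₜ[ℂ] L.bracket y z - L.bracket x y ⊗ₜ[ℂ] z
          - ksgn i j • y ⊗ₜ[ℂ] L.bracket x z})

/-- The underlying space of `uce L`. -/
abbrev UceCarrier : Type := (L.carrier ⊗[ℂ] L.carrier) ⧸ uceRel L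

/-- The class `⟨x, y⟩` of `x ⊗ y`. -/
def ucePair (x y : L.carrier) : UceCarrier L := (uceRel L).mkQ (x ⊗ₜ[ℂ] y)

/-- The projection `⟨x, y⟩ ↦ [x, y]` onto `L` (surjective if `L` is perfect). -/
def uceProj : UceCarrier L →ₗ[ℂ] L.carrier :=
  (uceRel L).liftQ (TensorProduct.lift L.bracket) (by
    rw [uceRel, Submodule.span_le]
    rintro w (⟨i, j, x, hx, y, hy, rfl⟩ | ⟨i, j, k, x, hx, y, hy, z, hz, rfl⟩)
    · simp [L.skew i j x hx y hy]
    · simp [L.jacobi i j k x hx y hy z hz])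

lemma uceProj_pair (x y : L.carrier) : uceProj L (ucePair L x y) = L.bracket x y := by
  simp [uceProj, ucePair]

/-- The bracket `[u, v] = ⟨ū, v̄⟩`, where `ū, v̄` are the images in `L`; in particular
`[⟨x, y⟩, ⟨x', y'⟩] = ⟨[x, y], [x', y']⟩`. -/
def uceBracket : UceCarrier L →ₗ[ℂ] UceCarrier L →ₗ[ℂ] UceCarrier L :=
  ((TensorProduct.mk ℂ L.carrier L.carrier).compr₂ (uceRel L).mkQ).compl₁₂ (uceProj L) (uceProj L)

lemma uceBracket_apply (u v : UceCarrier L) :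
    uceBracket L u v = ucePair L (uceProj L u) (uceProj L v) := rfl

lemma uceProj_bracket (u v : UceCarrier L) :
    uceProj L (uceBracket L u v) = L.bracket (uceProj L u) (uceProj L v) := by
  rw [uceBracket_apply, uceProj_pair]

/-- `⟨x, y⟩` has parity `|x| + |y|`. -/
def uceGrading (k : ZMod 2) : Submodule ℂ (UceCarrier L) :=
  Submodule.span ℂ {w | ∃ i j : ZMod 2, i + j = k ∧ ∃ x ∈ L.grading i, ∃ y ∈ L.grading j,
    w = ucePair L x y}

lemma uceProj_mem {k : ZMod 2} {u : UceCarrier L} (hu : u ∈ uceGrading L k) :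
    uceProj L u ∈ L.grading k := by
  have : uceGrading L k ≤ (L.grading k).comap (uceProj L) := by
    rw [uceGrading, Submodule.span_le]
    rintro _ ⟨i, j, rfl, x, hx, y, hy, rfl⟩
    change uceProj L (ucePair L x y) ∈ L.grading (i + j)
    rw [uceProj_pair]
    exact L.bracket_mem i j x hx y hy
  exact this hu

lemma ucePair_skew {i j : ZMod 2} {x y : L.carrier} (hx : x ∈ L.grading i)
    (hy : y ∈ L.grading j) : ucePair L x y = -(ksgn i j • ucePair L y x) := by
  have h : x ⊗ₜ[ℂ] y + ksgn i j • y ⊗ₜ[ℂ] x ∈ uceRel L :=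
    Submodule.subset_span (Or.inl ⟨i, j, x, hx, y, hy, rfl⟩)
  have h' := (Submodule.Quotient.mk_eq_zero _).2 h
  exact eq_neg_of_add_eq_zero_left h'

lemma ucePair_jacobi {i j k : ZMod 2} {x y z : L.carrier} (hx : x ∈ L.grading i)
    (hy : y ∈ L.grading j) (hz : z ∈ L.grading k) :
    ucePair L x (L.bracket y z)
      = ucePair L (L.bracket x y) z + ksgn i j • ucePair L y (L.bracket x z) := by
  have h : x ⊗ₜ[ℂ] L.bracket y z - L.bracket x y ⊗ₜ[ℂ] z
          - ksgn i j • y ⊗ₜ[ℂ] L.bracket x z ∈ uceRel L :=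
    Submodule.subset_span (Or.inr ⟨i, j, k, x, hx, y, hy, z, hz, rfl⟩)
  have h' := (Submodule.Quotient.mk_eq_zero _).2 h
  rw [sub_sub] at h'
  exact sub_eq_zero.1 h'

lemma gradings_sup : L.grading 0 ⊔ L.grading 1 = ⊤ :=
  ((DirectSum.isInternal_submodule_iff_isCompl (A := L.grading) (i := (0 : ZMod 2)) (j := 1)
    (by decide) (by ext i; simpa using zmod2_cases i)).1 L.isInternal).sup_eq_top

/-- The parity operator `x ↦ (-1)^|x| x`. -/
lemma exists_parity : ∃ γ : L.carrier →ₗ[ℂ] L.carrier,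
    ∀ i, ∀ x ∈ L.grading i, γ x = ksgn i 1 • x := by
  have hc : IsCompl (L.grading 0) (L.grading 1) :=
    (DirectSum.isInternal_submodule_iff_isCompl (A := L.grading) (i := (0 : ZMod 2)) (j := 1)
      (by decide) (by ext i; simpa using zmod2_cases i)).1 L.isInternal
  refine ⟨LinearMap.ofIsCompl hc (L.grading 0).subtype (-(L.grading 1).subtype), ?_⟩
  intro i x hx
  rcases zmod2_cases i with rfl | rfl
  · have := LinearMap.ofIsCompl_apply_left (h := hc) (φ := (L.grading 0).subtype)
      (ψ := -(L.grading 1).subtype) ⟨x, hx⟩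
    simpa [ksgn_01] using this
  · have := LinearMap.ofIsCompl_apply_right (h := hc) (φ := (L.grading 0).subtype)
      (ψ := -(L.grading 1).subtype) ⟨x, hx⟩
    simpa [ksgn_11] using this

lemma ksgn_add (i j : ZMod 2) : ksgn (i + j) 1 = ksgn i 1 * ksgn j 1 := by
  rcases zmod2_cases i with rfl | rfl <;> rcases zmod2_cases j with rfl | rfl <;>
    simp [ksgn_01, ksgn_11, show (1 : ZMod 2) + 1 = 0 from rfl]

lemma uce_isInternal : DirectSum.IsInternal (uceGrading L) := by
  rw [DirectSum.isInternal_submodule_iff_isCompl (i := (0 : ZMod 2)) (j := 1) _ (by decide)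
    (by ext i; simpa using zmod2_cases i)]
  constructor
  · obtain ⟨γ, hγ⟩ := exists_parity L
    have hpair : ∀ i j, ∀ x ∈ L.grading i, ∀ y ∈ L.grading j,
        TensorProduct.map γ γ (x ⊗ₜ[ℂ] y) = ksgn (i + j) 1 • x ⊗ₜ[ℂ] y := by
      intro i j x hx y hy
      rw [TensorProduct.map_tmul, hγ i x hx, hγ j y hy, TensorProduct.smul_tmul_smul, ksgn_add]
    have hrel : uceRel L ≤ (uceRel L).comap (TensorProduct.map γ γ) := by
      conv_lhs => rw [uceRel]
      rw [Submodule.span_le]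
      rintro w (⟨i, j, x, hx, y, hy, rfl⟩ | ⟨i, j, k, x, hx, y, hy, z, hz, rfl⟩)
      · have hw : x ⊗ₜ[ℂ] y + ksgn i j • y ⊗ₜ[ℂ] x ∈ uceRel L :=
          Submodule.subset_span (Or.inl ⟨i, j, x, hx, y, hy, rfl⟩)
        change TensorProduct.map γ γ (x ⊗ₜ[ℂ] y + ksgn i j • y ⊗ₜ[ℂ] x) ∈ uceRel L
        rw [map_add, map_smul, hpair i j x hx y hy, hpair j i y hy x hx, add_comm j i,
          smul_comm (ksgn i j), ← smul_add]
        exact Submodule.smul_mem _ _ hw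
      · have hw : x ⊗ₜ[ℂ] L.bracket y z - L.bracket x y ⊗ₜ[ℂ] z
            - ksgn i j • y ⊗ₜ[ℂ] L.bracket x z ∈ uceRel L :=
          Submodule.subset_span (Or.inr ⟨i, j, k, x, hx, y, hy, z, hz, rfl⟩)
        change TensorProduct.map γ γ (x ⊗ₜ[ℂ] L.bracket y z - L.bracket x y ⊗ₜ[ℂ] z
            - ksgn i j • y ⊗ₜ[ℂ] L.bracket x z) ∈ uceRel L
        rw [map_sub, map_sub, map_smul, hpair i (j + k) x hx _ (L.bracket_mem j k y hy z hz),
          hpair (i + j) k _ (L.bracket_mem i j x hx y hy) z hz,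
          hpair j (i + k) y hy _ (L.bracket_mem i k x hx z hz), ← add_assoc, ← add_assoc,
          add_comm j i, smul_comm (ksgn i j), ← smul_sub, ← smul_sub]
        exact Submodule.smul_mem _ _ hw
    let Γ : UceCarrier L →ₗ[ℂ] UceCarrier L :=
      (uceRel L).mapQ (uceRel L) (TensorProduct.map γ γ) hrel
    have hΓ : ∀ k, ∀ u ∈ uceGrading L k, Γ u = ksgn k 1 • u := by
      intro k u hu
      have hle : uceGrading L k ≤ LinearMap.eqLocus Γ (ksgn k 1 • LinearMap.id) := by
        rw [uceGrading, Submodule.span_le]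
        rintro _ ⟨i, j, rfl, x, hx, y, hy, rfl⟩
        change Γ _ = ksgn (i + j) 1 • _
        have : Γ (ucePair L x y) = (uceRel L).mkQ (TensorProduct.map γ γ (x ⊗ₜ[ℂ] y)) := rfl
        rw [this, hpair i j x hx y hy, map_smul]
        rfl
      exact hle hu
    rw [Submodule.disjoint_def]
    intro u h0 h1
    have e0 := hΓ 0 u h0
    have e1 := hΓ 1 u h1
    rw [e0, ksgn_01, ksgn_11, one_smul, neg_smul, one_smul] at e1
    have h2 : (2 : ℂ) • u = 0 := by rw [two_smul]; nth_rewrite 1 [e1]; simp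
    exact (smul_eq_zero.1 h2).resolve_left two_ne_zero
  · rw [codisjoint_iff, Submodule.eq_top_iff']
    intro u
    obtain ⟨w, rfl⟩ := (uceRel L).mkQ_surjective u
    induction w with
    | zero => simp
    | add a b ha hb => rw [map_add]; exact Submodule.add_mem _ ha hb
    | tmul x y =>
      have hx : x ∈ L.grading 0 ⊔ L.grading 1 := by rw [gradings_sup]; trivial
      have hy : y ∈ L.grading 0 ⊔ L.grading 1 := by rw [gradings_sup]; trivial
      obtain ⟨x0, hx0, x1, hx1, rfl⟩ := Submodule.mem_sup.1 hx
      obtain ⟨y0, hy0, y1, hy1, rfl⟩ := Submodule.mem_sup.1 hy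
      have key : ∀ k : ZMod 2, ∀ u ∈ uceGrading L k,
          u ∈ uceGrading L 0 ⊔ uceGrading L 1 := by
        intro k u hu
        rcases zmod2_cases k with rfl | rfl
        · exact Submodule.mem_sup_left hu
        · exact Submodule.mem_sup_right hu
      have hp : ∀ i j, ∀ x ∈ L.grading i, ∀ y ∈ L.grading j,
          (uceRel L).mkQ (x ⊗ₜ[ℂ] y) ∈ uceGrading L 0 ⊔ uceGrading L 1 :=
        fun i j x hx y hy => key (i + j) _
          (Submodule.subset_span ⟨i, j, rfl, x, hx, y, hy, rfl⟩)
      simp only [TensorProduct.add_tmul, TensorProduct.tmul_add, map_add]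
      exact Submodule.add_mem _
        (Submodule.add_mem _ (hp 0 0 _ hx0 _ hy0) (hp 1 0 _ hx1 _ hy0))
        (Submodule.add_mem _ (hp 0 1 _ hx0 _ hy1) (hp 1 1 _ hx1 _ hy1))

/-- The standard model of the universal central extension of a perfect Lie superalgebra `L`:
the quotient of `L ⊗ L` by skew-supersymmetry and the super Jacobi identity. -/
def uce : LieSuperalgebra where
  carrier := UceCarrier L
  grading := uceGrading L
  isInternal := uce_isInternal L
  bracket := uceBracket L
  bracket_mem := fun i j _ hu _ hv =>
    Submodule.subset_span ⟨i, j, rfl, _, uceProj_mem L hu, _, uceProj_mem L hv, rfl⟩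
  skew := fun _ _ _ hu _ hv => ucePair_skew L (uceProj_mem L hu) (uceProj_mem L hv)
  jacobi := fun i j k u hu v hv w hw => by
    simp only [uceBracket_apply, uceProj_pair]
    exact ucePair_jacobi L (uceProj_mem L hu) (uceProj_mem L hv) (uceProj_mem L hw)

end UCE

/-! ### Finite-dimensional superspaces with an action -/

/-- A finite-dimensional superspace with a linear family of operators indexed by a vector
space `𝔸`. No compatibility is imposed here; the module categories below are full subcategories. -/
structure SuperRep (𝔸 : Type) [AddCommGroup 𝔸] [Module ℂ 𝔸] where
  carrier : Type
  [addCommGroup : AddCommGroup carrier]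
  [module : Module ℂ carrier]
  [finite : FiniteDimensional ℂ carrier]
  grading : ZMod 2 → Submodule ℂ carrier
  isInternal : DirectSum.IsInternal grading
  act : 𝔸 →ₗ[ℂ] Module.End ℂ carrier

attribute [instance] SuperRep.addCommGroup SuperRep.module SuperRep.finite

namespace SuperRep

variable {𝔸 : Type} [AddCommGroup 𝔸] [Module ℂ 𝔸]

/-- Morphisms: parity-preserving linear maps commuting with the action. -/
@[ext]
structure Hom (V W : SuperRep 𝔸) where
  toLin : V.carrier →ₗ[ℂ] W.carrier
  map_grading : ∀ i, ∀ v ∈ V.grading i, toLin v ∈ W.grading i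
  map_act : ∀ a v, toLin (V.act a v) = W.act a (toLin v)

instance : Category (SuperRep 𝔸) where
  Hom := Hom
  id V := ⟨LinearMap.id, fun _ _ h => h, fun _ _ => rfl⟩
  comp f g := ⟨g.toLin ∘ₗ f.toLin, fun i v h => g.map_grading i _ (f.map_grading i v h),
    fun a v => by simp [f.map_act, g.map_act]⟩

@[ext]
lemma hom_ext {V W : SuperRep 𝔸} {f g : V ⟶ W} (h : Hom.toLin f = Hom.toLin g) : f = g :=
  Hom.ext h

/-- The subspace of morphisms in the space of linear maps. -/
def homSubmodule (V W : SuperRep 𝔸) : Submodule ℂ (V.carrier →ₗ[ℂ] W.carrier) where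
  carrier := {f | (∀ i, ∀ v ∈ V.grading i, f v ∈ W.grading i) ∧
    ∀ a v, f (V.act a v) = W.act a (f v)}
  add_mem' := fun ⟨h1, h2⟩ ⟨k1, k2⟩ =>
    ⟨fun i v hv => (W.grading i).add_mem (h1 i v hv) (k1 i v hv), fun a v => by simp [h2, k2]⟩
  zero_mem' := ⟨fun i _ _ => (W.grading i).zero_mem, fun a v => by simp⟩
  smul_mem' := fun c _ ⟨h1, h2⟩ =>
    ⟨fun i v hv => (W.grading i).smul_mem c (h1 i v hv), fun a v => by simp [h2]⟩

/-- Morphisms are the elements of `homSubmodule`. -/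
def homEquiv (V W : SuperRep 𝔸) : (V ⟶ W) ≃ homSubmodule V W where
  toFun f := ⟨Hom.toLin f, Hom.map_grading f, Hom.map_act f⟩
  invFun f := Hom.mk f.1 f.2.1 f.2.2

instance (V W : SuperRep 𝔸) : AddCommGroup (V ⟶ W) := (homEquiv V W).addCommGroup

instance (V W : SuperRep 𝔸) : Module ℂ (V ⟶ W) := (homEquiv V W).module ℂ

lemma add_toLin {V W : SuperRep 𝔸} (f g : V ⟶ W) :
    Hom.toLin (f + g) = Hom.toLin f + Hom.toLin g := rfl

lemma smul_toLin {V W : SuperRep 𝔸} (c : ℂ) (f : V ⟶ W) :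
    Hom.toLin (c • f) = c • Hom.toLin f := rfl

lemma comp_toLin {U V W : SuperRep 𝔸} (f : U ⟶ V) (g : V ⟶ W) :
    Hom.toLin (f ≫ g) = Hom.toLin g ∘ₗ Hom.toLin f := rfl

instance : Preadditive (SuperRep 𝔸) where
  add_comp _ _ _ f g h := by
    ext1; simp only [add_toLin, comp_toLin, LinearMap.comp_add]
  comp_add _ _ _ f g h := by
    ext1; simp only [add_toLin, comp_toLin, LinearMap.add_comp]

instance : Linear ℂ (SuperRep 𝔸) where
  smul_comp _ _ _ c f g := by
    ext1; simp only [smul_toLin, comp_toLin, LinearMap.comp_smul]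
  comp_smul _ _ _ f c g := by
    ext1; simp only [smul_toLin, comp_toLin, LinearMap.smul_comp]

/-- The opposite module `V^op`: the same space and action with the parity exchanged. -/
def op (V : SuperRep 𝔸) : SuperRep 𝔸 where
  carrier := V.carrier
  grading i := V.grading (i + 1)
  isInternal := by
    have h := (DirectSum.isInternal_submodule_iff_isCompl (A := V.grading) (i := (0 : ZMod 2))
      (j := 1) (by decide) (by ext i; simpa using zmod2_cases i)).1 V.isInternal
    rw [DirectSum.isInternal_submodule_iff_isCompl (i := (0 : ZMod 2)) (j := 1) _ (by decide)
      (by ext i; simpa using zmod2_cases i)]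
    simpa [show (1 : ZMod 2) + 1 = 0 from rfl] using h.symm
  act := V.act

end SuperRep

/-! ### The module categories -/

/-- `V` is a bimodule over the Jordan superalgebra `J`: the null split extension `J ⊕ V`, with
`V · V = 0` and `a · v` given by the action (hence `v · a = (-1)^(|a| |v|) a · v` by
supercommutativity), is a Jordan superalgebra. -/
def IsJordanBimodule (J : JordanSuperalgebra) (V : SuperRep J.carrier) : Prop :=
  ∃ mul : (J.carrier × V.carrier) →ₗ[ℂ] (J.carrier × V.carrier) →ₗ[ℂ] (J.carrier × V.carrier),
    (∀ a b : J.carrier, mul (a, 0) (b, 0) = (J.mul a b, 0)) ∧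
    (∀ (a : J.carrier) (v : V.carrier), mul (a, 0) (0, v) = (0, V.act a v)) ∧
    (∀ v w : V.carrier, mul (0, v) (0, w) = 0) ∧
    IsJordanSuper (fun i => (J.grading i).prod (V.grading i)) mul

/-- Special `JP(2)`-modules: finite-dimensional `JP(2)`-bimodules on which the identity element
acts as `½ id`. -/
def IsSpecialJP2 : ObjectProperty (SuperRep (JP (Fin 2)).carrier) := fun V =>
  IsJordanBimodule (JP (Fin 2)) V ∧ V.act (jpOne (Fin 2)) = (1 / 2 : ℂ) • LinearMap.id

/-- The category `JP(2)-mod_{1/2}`. -/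
abbrev JP2ModHalf : Type 1 := IsSpecialJP2.FullSubcategory

/-- Modules over a Lie superalgebra. -/
def IsLieModule (L : LieSuperalgebra) (V : SuperRep L.carrier) : Prop :=
  (∀ i j : ZMod 2, ∀ x ∈ L.grading i, ∀ v ∈ V.grading j, V.act x v ∈ V.grading (i + j)) ∧
  (∀ i j : ZMod 2, ∀ x ∈ L.grading i, ∀ y ∈ L.grading j, ∀ v,
    V.act (L.bracket x y) v = V.act x (V.act y v) - ksgn i j • V.act y (V.act x v))

/-- The Lie superalgebra `P(3)`; the index set of size `4` is split into two halves of size `2`. -/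
abbrev P3 : LieSuperalgebra := PLie (Fin 2 ⊕ Fin 2)

/-- The element `[A, 0; 0, -Aᵀ]` of `P(3)`, for `tr A = 0`. -/
def p3Diag (A : Matrix (Fin 2 ⊕ Fin 2) (Fin 2 ⊕ Fin 2) ℂ) (hA : A.trace = 0) : P3.carrier :=
  (⟨fromBlocks A 0 0 (-Aᵀ), by simp, by simpa using hA, by simp, by simp⟩ :
    pSpace (Fin 2 ⊕ Fin 2))

/-- The raising element `e` of the short `𝔰𝔩₂`. -/
def p3E : P3.carrier := p3Diag (fromBlocks 0 1 0 0) (by simp [trace])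

/-- The lowering element `2 f`: with `h = [e, f]` one has `[h, e] = e`, `[h, f] = -f`. -/
def p3F2 : P3.carrier := p3Diag (fromBlocks 0 0 1 0) (by simp [trace])

/-- The universal central extension of `P(3)`. -/
abbrev P3hat : LieSuperalgebra := uce P3

/-- The element `h` of the short `𝔰𝔩₂` in the universal central extension of `P(3)`: the bracket
of (arbitrary lifts of) `e` and `f`. -/
def hHat : P3hat.carrier := (1 / 2 : ℂ) • ucePair P3 p3E p3F2

/-- Finite-dimensional modules over the universal central extension of `P(3)` with a very short
grading: `V` is the sum of the eigenspaces of `h` for the eigenvalues `½` and `-½`. -/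
def IsVeryShortP3hat : ObjectProperty (SuperRep P3hat.carrier) := fun V =>
  IsLieModule P3hat V ∧
  Module.End.eigenspace (V.act hHat) (1 / 2 : ℂ) ⊔ Module.End.eigenspace (V.act hHat) (-1 / 2 : ℂ)
    = ⊤

/-- The category of very short graded modules over the universal central extension of `P(3)`. -/
abbrev P3hatModHalf : Type 1 := IsVeryShortP3hat.FullSubcategory

/-- Finite-dimensional `ℤ/2`-graded modules over `ℂ[x]` (a purely even algebra). -/
def IsGradedPolyModule : ObjectProperty (SuperRep ℂ[X]) := fun V =>
  V.act 1 = LinearMap.id ∧ (∀ p q, V.act (p * q) = V.act p ∘ₗ V.act q) ∧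
  (∀ p i, ∀ v ∈ V.grading i, V.act p v ∈ V.grading i)

/-- The category of finite-dimensional `ℤ/2`-graded `ℂ[x]`-modules. -/
abbrev PolyModGr : Type 1 := IsGradedPolyModule.FullSubcategory

/-! ### The modules `W(t)` -/

/-- The representation `[A, B; C, Aᵀ] ↦ [A, B + t C; C, Aᵀ]` of `JP(2)` by matrices. -/
def wRho (t : ℂ) : (JP (Fin 2)).carrier →ₗ[ℂ] SMat (Fin 2) :=
  (LinearMap.id + t • ({ toFun := fun X => fromBlocks 0 X.toBlocks₂₁ 0 0
                         map_add' := fun X Y => by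
                           ext (a | a) (b | b) <;> simp [toBlocks₂₁]
                         map_smul' := fun c X => by
                           ext (a | a) (b | b) <;> simp [toBlocks₂₁] } :
    SMat (Fin 2) →ₗ[ℂ] SMat (Fin 2))) ∘ₗ (jpSpace (Fin 2)).subtype

/-- The standard grading of `ℂ^{2|2}`. -/
def wGrading (i : ZMod 2) : Submodule ℂ ((Fin 2 ⊕ Fin 2) → ℂ) where
  carrier := {v | if i = 0 then ∀ k, v (Sum.inr k) = 0 else ∀ k, v (Sum.inl k) = 0}
  add_mem' := by
    intro v w hv hw
    rcases zmod2_cases i with rfl | rfl <;> simp_all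
  zero_mem' := by simp
  smul_mem' := by
    intro c v hv
    rcases zmod2_cases i with rfl | rfl <;> simp_all

lemma wGrading_isInternal : DirectSum.IsInternal wGrading := by
  rw [DirectSum.isInternal_submodule_iff_isCompl (i := (0 : ZMod 2)) (j := 1) _ (by decide)
    (by ext i; simpa using zmod2_cases i)]
  constructor
  · rw [Submodule.disjoint_def]
    intro v h0 h1
    have h0' : ∀ k, v (Sum.inr k) = 0 := h0
    have h1' : ∀ k, v (Sum.inl k) = 0 := h1
    ext (k | k)
    · exact h1' k
    · exact h0' k
  · rw [codisjoint_iff, Submodule.eq_top_iff']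
    intro v
    refine Submodule.mem_sup.2 ⟨Sum.elim (fun k => v (Sum.inl k)) 0, ?_,
      Sum.elim 0 (fun k => v (Sum.inr k)), ?_, ?_⟩
    · change ∀ k : Fin 2, _ = (0 : ℂ)
      simp
    · change ∀ k : Fin 2, _ = (0 : ℂ)
      simp
    · ext (k | k) <;> simp

/-- `W(t)`: the superspace `ℂ^{2|2}` on which `X ∈ JP(2)` acts by `½ ρ_t(X)`. The factor `½`
turns the homomorphism `ρ_t : JP(2) → End(ℂ^{2|2})^+` into a bimodule action, for which the
identity element acts as `½ id`. -/
def W (t : ℂ) : SuperRep (JP (Fin 2)).carrier where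
  carrier := (Fin 2 ⊕ Fin 2) → ℂ
  grading := wGrading
  isInternal := wGrading_isInternal
  act := (1 / 2 : ℂ) • (Matrix.toLin' : SMat (Fin 2) ≃ₗ[ℂ] _).toLinearMap ∘ₗ wRho t

/-! ### Blocks -/

section Blocks

variable {C : Type 1} [Category.{0} C] [Preadditive C]

/-- There is a nonsplit short exact sequence `0 ⟶ S ⟶ E ⟶ T ⟶ 0`, i.e. `Ext¹(T, S) ≠ 0`. -/
def HasNonsplitExt (S T : C) : Prop :=
  ∃ E : ShortComplex C, E.ShortExact ∧ Nonempty (E.X₁ ≅ S) ∧ Nonempty (E.X₃ ≅ T) ∧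
    ¬ Nonempty E.Splitting

/-- The equivalence relation on simple objects generated by isomorphism and by having a nonsplit
extension. -/
def Linked : C → C → Prop :=
  Relation.EqvGen fun S T =>
    Simple S ∧ Simple T ∧ (Nonempty (S ≅ T) ∨ HasNonsplitExt S T)

/-- `T` is a subquotient of `X`. -/
def IsSubquotient (T X : C) : Prop :=
  ∃ (Y : C) (m : Y ⟶ X) (q : Y ⟶ T), Mono m ∧ Epi q

/-- The block of a simple object `S` (in a category whose objects have finite length): the full
subcategory of objects all of whose simple subquotients are linked to `S`. -/
def blockOf (S : C) : ObjectProperty C := fun X =>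
  ∀ T, Simple T → IsSubquotient T X → Linked S T

/-- A block is the block of some simple object. -/
def IsBlock (B : ObjectProperty C) : Prop := ∃ S, Simple S ∧ B = blockOf S

variable (C) in
/-- Every block of `C` has a simple object which is unique up to isomorphism. -/
def BlocksHaveUniqueSimple : Prop :=
  ∀ B : ObjectProperty C, IsBlock B →
    ∃ S, B S ∧ Simple S ∧ ∀ T, B T → Simple T → Nonempty (T ≅ S)

end Blocks

end SuperJP
end

noncomputable section

namespace SuperJP

/-! ### Parity projections -/

section Projections

variable {V : Type} [AddCommGroup V] [Module ℂ V] {𝒢 : ZMod 2 → Submodule ℂ V}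

/-- The decomposition of a graded space as a linear equivalence. -/
def decompEquiv (h : DirectSum.IsInternal 𝒢) : DirectSum (ZMod 2) (fun i => 𝒢 i) ≃ₗ[ℂ] V :=
  LinearEquiv.ofBijective (DirectSum.coeLinearMap 𝒢)
    (show Function.Bijective (DirectSum.coeLinearMap 𝒢) from h)

lemma decompEquiv_apply (h : DirectSum.IsInternal 𝒢) (w : DirectSum (ZMod 2) (fun i => 𝒢 i)) :
    decompEquiv h w = DirectSum.coeLinearMap 𝒢 w := rfl

/-- The projection onto the component of parity `i`. -/
def parityProj (h : DirectSum.IsInternal 𝒢) (i : ZMod 2) : V →ₗ[ℂ] V :=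
  (𝒢 i).subtype ∘ₗ DirectSum.component ℂ (ZMod 2) (fun i => 𝒢 i) i ∘ₗ
    (decompEquiv h).symm.toLinearMap

variable (h : DirectSum.IsInternal 𝒢)

lemma parityProj_mem (i : ZMod 2) (v : V) : parityProj h i v ∈ 𝒢 i := by
  simp [parityProj]

lemma parityProj_of_mem {i j : ZMod 2} {v : V} (hv : v ∈ 𝒢 j) :
    parityProj h i v = if i = j then v else 0 := by
  have e : (decompEquiv h).symm v
      = DirectSum.lof ℂ (ZMod 2) (fun i => 𝒢 i) j ⟨v, hv⟩ := by
    rw [LinearEquiv.symm_apply_eq, decompEquiv_apply, DirectSum.coeLinearMap_lof]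
  simp only [parityProj, LinearMap.comp_apply, LinearEquiv.coe_coe, e]
  split_ifs with hij
  · subst hij
    simp [DirectSum.component.lof_self]
  · simp [DirectSum.component.of, Ne.symm hij]

lemma parityProj_add (v : V) : parityProj h 0 v + parityProj h 1 v = v := by
  have hc := (DirectSum.isInternal_submodule_iff_isCompl (A := 𝒢) (i := (0 : ZMod 2)) (j := 1)
    (by decide) (by ext i; simpa using zmod2_cases i)).1 h
  have hv : v ∈ 𝒢 0 ⊔ 𝒢 1 := by rw [hc.sup_eq_top]; trivial
  obtain ⟨a, ha, b, hb, rfl⟩ := Submodule.mem_sup.1 hv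
  simp [parityProj_of_mem h ha, parityProj_of_mem h hb]

lemma mem_of_parityProj_eq {i : ZMod 2} {v : V} (hv : parityProj h i v = v) : v ∈ 𝒢 i :=
  hv ▸ parityProj_mem h i v

/-- Two linear maps that agree on homogeneous vectors are equal. -/
lemma linearMap_ext_of_homogeneous (h : DirectSum.IsInternal 𝒢) {W : Type*} [AddCommMonoid W]
    [Module ℂ W] {f g : V →ₗ[ℂ] W} (hfg : ∀ i, ∀ v ∈ 𝒢 i, f v = g v) : f = g := by
  ext v
  rw [← parityProj_add h v, map_add, map_add, hfg 0 _ (parityProj_mem h 0 v),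
    hfg 1 _ (parityProj_mem h 1 v)]

/-- A decomposition into two complementary parts, in terms of projections. -/
lemma isInternal_of_proj (π : ZMod 2 → V → V) (hmem : ∀ i v, π i v ∈ 𝒢 i)
    (hadd : ∀ v, π 0 v + π 1 v = v) (hdisj : ∀ v, v ∈ 𝒢 0 → v ∈ 𝒢 1 → v = 0) :
    DirectSum.IsInternal 𝒢 := by
  rw [DirectSum.isInternal_submodule_iff_isCompl (i := (0 : ZMod 2)) (j := 1) _ (by decide)
    (by ext i; simpa using zmod2_cases i)]
  refine ⟨Submodule.disjoint_def.2 hdisj, ?_⟩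
  rw [codisjoint_iff, Submodule.eq_top_iff']
  exact fun v => Submodule.mem_sup.2 ⟨_, hmem 0 v, _, hmem 1 v, hadd v⟩

lemma eq_zero_of_mem_of_mem (h : DirectSum.IsInternal 𝒢) {v : V} (h0 : v ∈ 𝒢 0) (h1 : v ∈ 𝒢 1) :
    v = 0 := by
  have := parityProj_of_mem h (i := 0) h1
  rw [parityProj_of_mem h (i := 0) h0] at this
  simpa using this

/-- Linear maps of parity `d` commute with the projections, up to the shift. -/
lemma parityProj_map (h : DirectSum.IsInternal 𝒢) {W : Type} [AddCommGroup W] [Module ℂ W]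
    {ℋ : ZMod 2 → Submodule ℂ W}
    (k : DirectSum.IsInternal ℋ) {f : V →ₗ[ℂ] W} {d : ZMod 2}
    (hf : ∀ i, ∀ v ∈ 𝒢 i, f v ∈ ℋ (d + i)) (i : ZMod 2) (v : V) :
    parityProj k (d + i) (f v) = f (parityProj h i v) := by
  have : parityProj k (d + i) ∘ₗ f = f ∘ₗ parityProj h i := by
    refine linearMap_ext_of_homogeneous h fun j w hw => ?_
    simp only [LinearMap.comp_apply]
    rw [parityProj_of_mem k (hf j w hw), parityProj_of_mem h hw]
    by_cases hij : i = j
    · simp [hij]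
    · simp [hij]
  exact LinearMap.congr_fun this v

/-- A subspace stable under the parity projections inherits the grading. -/
lemma isInternal_comap_of_stable (S : Submodule ℂ V) (hS : ∀ i, ∀ v ∈ S, parityProj h i v ∈ S) :
    DirectSum.IsInternal (fun i => (𝒢 i).comap S.subtype) :=
  isInternal_of_proj (fun i v => ⟨_, hS i _ v.2⟩) (fun i _ => parityProj_mem h i _)
    (fun _ => Subtype.ext (parityProj_add h _))
    (fun _ h0 h1 => Subtype.ext (eq_zero_of_mem_of_mem h h0 h1))

end Projections

namespace SuperRep

variable {𝔸 : Type} [AddCommGroup 𝔸] [Module ℂ 𝔸]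

lemma Hom.parityProj {V W : SuperRep 𝔸} (f : V ⟶ W) (i : ZMod 2) (v : V.carrier) :
    SuperJP.parityProj W.isInternal i (Hom.toLin f v)
      = Hom.toLin f (SuperJP.parityProj V.isInternal i v) := by
  simpa using parityProj_map V.isInternal W.isInternal (d := 0) (f := Hom.toLin f)
    (fun i v hv => by simpa using Hom.map_grading f i v hv) i v

/-- A parity-preserving linear isomorphism which commutes with the action. -/
def isoOfEquiv {V W : SuperRep 𝔸} (f : V.carrier ≃ₗ[ℂ] W.carrier)
    (hgr : ∀ i, ∀ v ∈ V.grading i, f v ∈ W.grading i)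
    (hact : ∀ a v, f (V.act a v) = W.act a (f v)) : V ≅ W where
  hom := Hom.mk f.toLinearMap hgr hact
  inv := Hom.mk f.symm.toLinearMap
    (fun i w hw => by
      have h := Hom.parityProj (V := V) (W := W) (Hom.mk f.toLinearMap hgr hact) i (f.symm w)
      apply mem_of_parityProj_eq V.isInternal
      apply f.injective
      change SuperJP.parityProj W.isInternal i (f (f.symm w)) = _ at h
      rw [f.apply_symm_apply, parityProj_of_mem _ hw, if_pos rfl] at h
      exact h.symm.trans (f.apply_symm_apply w).symm)
    (fun a w => by
      apply f.injective
      simp [hact])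
  hom_inv_id := by ext v; exact f.symm_apply_apply v
  inv_hom_id := by ext v; exact f.apply_symm_apply v

lemma isIso_of_bijective {V W : SuperRep 𝔸} (f : V ⟶ W)
    (hf : Function.Bijective (Hom.toLin f)) : IsIso f :=
  (isoOfEquiv (LinearEquiv.ofBijective (Hom.toLin f) hf) (Hom.map_grading f)
    (Hom.map_act f)).isIso_hom

lemma iso_apply {V W : SuperRep 𝔸} (e : V ≅ W) (v : V.carrier) :
    Hom.toLin e.inv (Hom.toLin e.hom v) = v :=
  LinearMap.congr_fun (congrArg Hom.toLin e.hom_inv_id) v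

lemma iso_apply' {V W : SuperRep 𝔸} (e : V ≅ W) (w : W.carrier) :
    Hom.toLin e.hom (Hom.toLin e.inv w) = w :=
  LinearMap.congr_fun (congrArg Hom.toLin e.inv_hom_id) w

lemma bijective_of_isIso {V W : SuperRep 𝔸} (f : V ⟶ W) [IsIso f] :
    Function.Bijective (Hom.toLin f) :=
  ⟨Function.LeftInverse.injective (iso_apply (asIso f)),
    Function.RightInverse.surjective (iso_apply' (asIso f))⟩

/-- A subspace, stable under the parity projections, with operators induced by `act`. -/
def restrict (V : SuperRep 𝔸) (S : Submodule ℂ V.carrier)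
    (hS : ∀ i, ∀ v ∈ S, SuperJP.parityProj V.isInternal i v ∈ S)
    (hact : ∀ a, ∀ v ∈ S, V.act a v ∈ S) : SuperRep 𝔸 where
  carrier := S
  grading i := (V.grading i).comap S.subtype
  isInternal := isInternal_comap_of_stable V.isInternal S hS
  act := LinearMap.mk₂ ℂ (fun a v => (⟨V.act a v, hact a v v.2⟩ : S))
    (fun _ _ _ => Subtype.ext (by simp)) (fun _ _ _ => Subtype.ext (by simp))
    (fun _ _ _ => Subtype.ext (by simp)) (fun _ _ _ => Subtype.ext (by simp))

variable (V : SuperRep 𝔸) (S : Submodule ℂ V.carrier)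
    (hS : ∀ i, ∀ v ∈ S, SuperJP.parityProj V.isInternal i v ∈ S)
    (hact : ∀ a, ∀ v ∈ S, V.act a v ∈ S)

/-- The inclusion of a subspace. -/
def restrictι : V.restrict S hS hact ⟶ V := Hom.mk S.subtype (fun _ _ h => h) (fun _ _ => rfl)

end SuperRep

/-! ### Graded modules over the polynomial ring -/

section FullSub

variable {𝔸 : Type} [AddCommGroup 𝔸] [Module ℂ 𝔸] {P : ObjectProperty (SuperRep 𝔸)}

lemma isIso_of_bijective {V W : P.FullSubcategory} (f : V ⟶ W)
    (hf : Function.Bijective (SuperRep.Hom.toLin f.hom)) : IsIso f :=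
  (P.isIso_hom_iff f).1 (SuperRep.isIso_of_bijective f.hom hf)

lemma bijective_of_isIso {V W : P.FullSubcategory} (f : V ⟶ W) [IsIso f] :
    Function.Bijective (SuperRep.Hom.toLin f.hom) :=
  SuperRep.bijective_of_isIso f.hom

lemma mono_of_injective {V W : P.FullSubcategory} (f : V ⟶ W)
    (hf : Function.Injective (SuperRep.Hom.toLin f.hom)) : Mono f where
  right_cancellation g h e := by
    ext v
    exact hf (LinearMap.congr_fun (congrArg (fun k => SuperRep.Hom.toLin k.hom) e) v)

end FullSub

namespace PolyModGr

lemma act_mul (N : PolyModGr) (p q : ℂ[X]) (v : N.obj.carrier) :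
    N.obj.act (p * q) v = N.obj.act p (N.obj.act q v) := by
  rw [N.property.2.1]; rfl

lemma act_mem (N : PolyModGr) (p : ℂ[X]) {i : ZMod 2} {v : N.obj.carrier}
    (hv : v ∈ N.obj.grading i) : N.obj.act p v ∈ N.obj.grading i := N.property.2.2 p i v hv

lemma act_parityProj (N : PolyModGr) (p : ℂ[X]) (i : ZMod 2) (v : N.obj.carrier) :
    parityProj N.obj.isInternal i (N.obj.act p v)
      = N.obj.act p (parityProj N.obj.isInternal i v) := by
  simpa using parityProj_map N.obj.isInternal N.obj.isInternal (d := 0) (f := N.obj.act p)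
    (fun i v hv => by simpa using act_mem N p hv) i v

/-- The graded module structure on a finite-dimensional superspace given by an even operator. -/
def ofEnd {N : Type} [AddCommGroup N] [Module ℂ N] [FiniteDimensional ℂ N]
    (𝒢 : ZMod 2 → Submodule ℂ N) (h : DirectSum.IsInternal 𝒢) (x : Module.End ℂ N)
    (hx : ∀ i, ∀ v ∈ 𝒢 i, x v ∈ 𝒢 i) : PolyModGr where
  obj :=
    { carrier := N
      grading := 𝒢
      isInternal := h
      act := (aeval x).toLinearMap }
  property := by
    refine ⟨map_one (aeval x), map_mul (aeval x), ?_⟩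
    intro p i v hv
    change aeval x p v ∈ 𝒢 i
    induction p using Polynomial.induction_on' with
    | add p q hp hq => rw [map_add]; exact (𝒢 i).add_mem hp hq
    | monomial n a =>
      rw [aeval_monomial, ← Algebra.smul_def]
      refine (𝒢 i).smul_mem a ?_
      induction n with
      | zero => simpa using hv
      | succ n ih => rw [pow_succ']; exact hx i _ ih

lemma ofEnd_act_X {N : Type} [AddCommGroup N] [Module ℂ N] [FiniteDimensional ℂ N]
    (𝒢 : ZMod 2 → Submodule ℂ N) (h : DirectSum.IsInternal 𝒢) (x : Module.End ℂ N)
    (hx : ∀ i, ∀ v ∈ 𝒢 i, x v ∈ 𝒢 i) : (ofEnd 𝒢 h x hx).obj.act X = x := aeval_X x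

/-- A linear map commuting with `x` commutes with all polynomials. -/
lemma comm_act {N N' : PolyModGr} (f : N.obj.carrier →ₗ[ℂ] N'.obj.carrier)
    (hf : ∀ v, f (N.obj.act X v) = N'.obj.act X (f v)) (p : ℂ[X]) (v : N.obj.carrier) :
    f (N.obj.act p v) = N'.obj.act p (f v) := by
  induction p using Polynomial.induction_on' with
  | add p q hp hq => simp [hp, hq]
  | monomial n a =>
    rw [← C_mul_X_pow_eq_monomial, ← smul_eq_C_mul, map_smul, map_smul, LinearMap.smul_apply,
      LinearMap.smul_apply, map_smul]
    congr 1
    induction n generalizing v with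
    | zero => rw [pow_zero, N.property.1, N'.property.1]; rfl
    | succ n ih => rw [pow_succ, act_mul, act_mul, ih, hf]

/-- The one-dimensional graded module of parity `d` on which `x` acts by `t`. -/
def line (t : ℂ) (d : ZMod 2) : PolyModGr :=
  ofEnd (N := ℂ) (fun i => if i = d then ⊤ else ⊥)
    (isInternal_of_proj (fun i v => if i = d then v else 0)
      (fun i v => by split_ifs <;> simp)
      (fun v => by rcases zmod2_cases d with rfl | rfl <;> simp)
      (fun v => by rcases zmod2_cases d with rfl | rfl <;> simp)) (t • LinearMap.id)
    (fun i v hv => Submodule.smul_mem _ t hv)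

lemma line_act_X (t : ℂ) (d : ZMod 2) (z : (line t d).obj.carrier) :
    (line t d).obj.act X z = t • z :=
  LinearMap.congr_fun (ofEnd_act_X _ _ _ _) z

/-- A homogeneous eigenvector of `x` gives a morphism from a one-dimensional module. -/
def lineHom (N : PolyModGr) {t : ℂ} {d : ZMod 2} (v : N.obj.carrier) (hv : v ∈ N.obj.grading d)
    (ht : N.obj.act X v = t • v) : line t d ⟶ N :=
  let f : (line t d).obj.carrier →ₗ[ℂ] N.obj.carrier := LinearMap.toSpanSingleton ℂ N.obj.carrier v
  ObjectProperty.homMk (SuperRep.Hom.mk f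
    (fun i z hz => by
      change z ∈ (if i = d then (⊤ : Submodule ℂ ℂ) else ⊥) at hz
      split_ifs at hz with h
      · subst h; exact Submodule.smul_mem _ _ hv
      · have hz0 : z = 0 := (Submodule.mem_bot ℂ).1 hz
        rw [hz0, map_zero]; exact Submodule.zero_mem _)
    (fun p z => comm_act (N := line t d) (N' := N) f (fun z => by
      rw [line_act_X, map_smul]
      change t • ((show ℂ from z) • v) = N.obj.act X ((show ℂ from z) • v)
      rw [map_smul, ht, smul_comm]) p z))

/-- The quotient of a graded module by the range of a morphism. -/
def coker {V W : PolyModGr} (f : V ⟶ W) : PolyModGr :=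
  ofEnd (N := W.obj.carrier ⧸ LinearMap.range (SuperRep.Hom.toLin f.hom))
    (fun i => (W.obj.grading i).map (Submodule.mkQ _))
    (by
      set R := LinearMap.range (SuperRep.Hom.toLin f.hom)
      refine isInternal_of_proj
        (fun i => R.mapQ R (parityProj W.obj.isInternal i) ?_) ?_ ?_ ?_
      · rintro _ ⟨v, rfl⟩
        exact ⟨_, (SuperRep.Hom.parityProj f.hom i v).symm⟩
      · intro i w
        obtain ⟨w, rfl⟩ := R.mkQ_surjective w
        exact ⟨_, parityProj_mem _ i w, rfl⟩
      · intro w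
        obtain ⟨w, rfl⟩ := R.mkQ_surjective w
        simp only [Submodule.mkQ_apply, Submodule.mapQ_apply]
        rw [← Submodule.Quotient.mk_add, parityProj_add]
      · rintro _ ⟨a, ha, rfl⟩ ⟨b, hb, hab⟩
        rw [Submodule.mkQ_apply, Submodule.mkQ_apply, Submodule.Quotient.eq] at hab
        obtain ⟨v, hv⟩ := hab
        rw [Submodule.mkQ_apply, Submodule.Quotient.mk_eq_zero]
        have := SuperRep.Hom.parityProj f.hom 0 v
        rw [hv, map_sub, parityProj_of_mem _ ha, parityProj_of_mem _ hb] at this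
        refine ⟨-_, (map_neg _ _).trans (congrArg Neg.neg this.symm |>.trans ?_)⟩
        simp)
    (Submodule.mapQ _ _ (W.obj.act X) (by
      rintro _ ⟨v, rfl⟩
      exact ⟨_, SuperRep.Hom.map_act f.hom X v⟩))
    (by
      rintro i _ ⟨w, hw, rfl⟩
      exact ⟨_, act_mem W X hw, rfl⟩)

/-- The projection onto the quotient. -/
def cokerπ {V W : PolyModGr} (f : V ⟶ W) : W ⟶ coker f :=
  ObjectProperty.homMk (SuperRep.Hom.mk (Submodule.mkQ _)
    (fun i w hw => ⟨w, hw, rfl⟩)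
    (fun p w => comm_act (N := W) (N' := coker f) _
      (fun w => by
        unfold coker
        rw [ofEnd_act_X]
        rfl) p w))

lemma surjective_of_epi {V W : PolyModGr} (f : V ⟶ W) [Epi f] :
    Function.Surjective (SuperRep.Hom.toLin f.hom) := by
  have h : f ≫ cokerπ f = f ≫ 0 := by
    ext v
    exact (Submodule.Quotient.mk_eq_zero _).2 ⟨v, rfl⟩
  have h0 := (cancel_epi f).1 h
  intro w
  have hw := LinearMap.congr_fun (congrArg (fun k => SuperRep.Hom.toLin k.hom) h0) w
  exact (Submodule.Quotient.mk_eq_zero (LinearMap.range (SuperRep.Hom.toLin f.hom))).1 hw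

lemma injective_of_mono {V W : PolyModGr} (f : V ⟶ W) [Mono f] :
    Function.Injective (SuperRep.Hom.toLin f.hom) := by
  have hS : ∀ i, ∀ v ∈ LinearMap.ker (SuperRep.Hom.toLin f.hom),
      parityProj V.obj.isInternal i v ∈ LinearMap.ker (SuperRep.Hom.toLin f.hom) := by
    intro i v hv
    rw [LinearMap.mem_ker] at hv ⊢
    rw [← SuperRep.Hom.parityProj, hv, map_zero]
  have hact : ∀ a, ∀ v ∈ LinearMap.ker (SuperRep.Hom.toLin f.hom),
      V.obj.act a v ∈ LinearMap.ker (SuperRep.Hom.toLin f.hom) := by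
    intro a v hv
    rw [LinearMap.mem_ker] at hv ⊢
    rw [SuperRep.Hom.map_act, hv, map_zero]
  let K : PolyModGr := ⟨V.obj.restrict _ hS hact,
    LinearMap.ext fun v => Subtype.ext (LinearMap.congr_fun V.property.1 v.1),
    fun p q => LinearMap.ext fun v => Subtype.ext (act_mul V p q v.1),
    fun p i v hv => act_mem V p hv⟩
  let ι : K ⟶ V := ObjectProperty.homMk (V.obj.restrictι _ hS hact)
  have h : ι ≫ f = 0 ≫ f := by
    ext v
    change SuperRep.Hom.toLin f.hom v.1 = SuperRep.Hom.toLin f.hom 0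
    rw [map_zero]
    exact v.2
  have h0 := (cancel_mono f).1 h
  rw [injective_iff_map_eq_zero]
  intro v hv
  exact LinearMap.congr_fun (congrArg (fun k => SuperRep.Hom.toLin k.hom) h0)
    (⟨v, hv⟩ : LinearMap.ker (SuperRep.Hom.toLin f.hom))

instance : Balanced PolyModGr where
  isIso_of_mono_of_epi f _ _ := isIso_of_bijective f ⟨injective_of_mono f, surjective_of_epi f⟩

lemma exists_iso_line (N : PolyModGr) [Simple N] : ∃ t d, Nonempty (line t d ≅ N) := by
  obtain ⟨v, hv⟩ : ∃ v : N.obj.carrier, v ≠ 0 := by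
    by_contra! h
    exact id_nonzero N (by ext v; exact h v)
  obtain ⟨d, hd⟩ : ∃ d, parityProj N.obj.isInternal d v ≠ 0 := by
    by_contra! h
    exact hv (by rw [← parityProj_add N.obj.isInternal v, h, h, add_zero])
  have : Nontrivial (N.obj.grading d) :=
    ⟨⟨⟨_, parityProj_mem _ d v⟩, 0, fun h => hd (congrArg Subtype.val h)⟩⟩
  obtain ⟨t, ht⟩ := Module.End.exists_eigenvalue
    ((N.obj.act X).restrict (p := N.obj.grading d) (q := N.obj.grading d)
      fun v hv => act_mem N X hv)
  obtain ⟨u, hu⟩ := ht.exists_hasEigenvector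
  have hu0 : (u : N.obj.carrier) ≠ 0 := fun h => hu.2 (Subtype.ext h)
  have hut : N.obj.act X u = t • (u : N.obj.carrier) := congrArg Subtype.val hu.apply_eq_smul
  let f := lineHom N (u : N.obj.carrier) u.2 hut
  have hinj : Function.Injective (SuperRep.Hom.toLin f.hom) :=
    smul_left_injective ℂ hu0
  have := mono_of_injective f hinj
  have hf : f ≠ 0 := by
    intro h
    have := LinearMap.congr_fun (congrArg (fun k => SuperRep.Hom.toLin k.hom) h) (1 : ℂ)
    exact hu0 ((one_smul ℂ _).symm.trans this)
  have := isIso_of_mono_of_nonzero hf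
  exact ⟨t, d, ⟨asIso f⟩⟩

lemma surjective_to_line {N : PolyModGr} {t : ℂ} {d : ZMod 2} {f : N ⟶ line t d} (hf : f ≠ 0) :
    Function.Surjective (SuperRep.Hom.toLin f.hom) := by
  let g : N.obj.carrier →ₗ[ℂ] ℂ := SuperRep.Hom.toLin f.hom
  exact LinearMap.surjective (f := g) fun h => hf (by ext v; exact LinearMap.congr_fun h v)

instance simple_line (t : ℂ) (d : ZMod 2) : Simple (line t d) where
  mono_isIso_iff_nonzero {Y} f _ := by
    constructor
    · rintro h rfl
      obtain ⟨v, hv⟩ := (bijective_of_isIso (0 : Y ⟶ line t d)).2 (1 : ℂ)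
      exact one_ne_zero (α := ℂ) hv.symm
    · intro hf
      exact isIso_of_bijective f ⟨injective_of_mono f, surjective_to_line hf⟩

/-- Schur's lemma. -/
lemma isIso_of_simple {S T : PolyModGr} [Simple S] [Simple T] {f : S ⟶ T} (hf : f ≠ 0) :
    IsIso f := by
  obtain ⟨t, d, ⟨e⟩⟩ := exists_iso_line S
  obtain ⟨t', d', ⟨e'⟩⟩ := exists_iso_line T
  have hg : e.hom ≫ f ≫ e'.inv ≠ 0 := by
    intro h
    apply hf
    have := congrArg (fun k => e.inv ≫ k ≫ e'.hom) h
    simpa using this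
  have hsurj := surjective_to_line hg
  have hinj : Function.Injective (SuperRep.Hom.toLin (e.hom ≫ f ≫ e'.inv).hom) :=
    let g : ℂ →ₗ[ℂ] ℂ := SuperRep.Hom.toLin (e.hom ≫ f ≫ e'.inv).hom
    LinearMap.injective_iff_surjective (f := g) |>.2 hsurj
  have : IsIso (e.hom ≫ f ≫ e'.inv) := isIso_of_bijective _ ⟨hinj, hsurj⟩
  have h2 : f = e.inv ≫ (e.hom ≫ f ≫ e'.inv) ≫ e'.hom := by simp
  rw [h2]
  infer_instance

/-- The parity operator, as an endomorphism of the identity functor. -/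
def parityNat : 𝟭 PolyModGr ⟶ 𝟭 PolyModGr where
  app N := ObjectProperty.homMk (SuperRep.Hom.mk
    (parityProj N.obj.isInternal 0 - parityProj N.obj.isInternal 1)
    (fun i v hv => by
      rw [LinearMap.sub_apply, parityProj_of_mem _ hv, parityProj_of_mem _ hv]
      refine Submodule.sub_mem _ ?_ ?_ <;> split_ifs <;>
        first | exact hv | exact Submodule.zero_mem _)
    (fun p v => by simp [act_parityProj]))
  naturality V W f := by
    ext v
    change parityProj W.obj.isInternal 0 (SuperRep.Hom.toLin f.hom v)
        - parityProj W.obj.isInternal 1 (SuperRep.Hom.toLin f.hom v)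
      = SuperRep.Hom.toLin f.hom
        (parityProj V.obj.isInternal 0 v - parityProj V.obj.isInternal 1 v)
    rw [SuperRep.Hom.parityProj, SuperRep.Hom.parityProj, map_sub]

/-- Multiplication by `x`, as an endomorphism of the identity functor. -/
def xNat : 𝟭 PolyModGr ⟶ 𝟭 PolyModGr where
  app N := ObjectProperty.homMk (SuperRep.Hom.mk (N.obj.act X)
    (fun i v hv => act_mem N X hv)
    (fun p v => by
      change N.obj.act X (N.obj.act p v) = N.obj.act p (N.obj.act X v)
      rw [← act_mul, ← act_mul, mul_comm]))
  naturality V W f := by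
    ext v
    exact (SuperRep.Hom.map_act f.hom X v).symm

lemma parityNat_line (t : ℂ) (d : ZMod 2) : parityNat.app (line t d) = ksgn d 1 • 𝟙 _ := by
  refine ObjectProperty.hom_ext _ (SuperRep.hom_ext (LinearMap.ext fun v => ?_))
  have hv : v ∈ (line t d).obj.grading d := by
    change v ∈ (if d = d then (⊤ : Submodule ℂ ℂ) else ⊥)
    rw [if_pos rfl]
    trivial
  change parityProj _ 0 v - parityProj _ 1 v = ksgn d 1 • v
  rw [parityProj_of_mem _ hv, parityProj_of_mem _ hv]
  rcases zmod2_cases d with rfl | rfl <;> simp [ksgn_01, ksgn_11]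

lemma xNat_line (t : ℂ) (d : ZMod 2) : xNat.app (line t d) = t • 𝟙 _ := by
  refine ObjectProperty.hom_ext _ (SuperRep.hom_ext (LinearMap.ext fun v => ?_))
  exact line_act_X t d v

end PolyModGr

/-! ### Blocks in categories where simple objects are separated by the centre -/

section Blocks

variable {C : Type 1} [Category.{0} C]

/-- The component of an endomorphism of the identity functor. -/
def centerApp (τ : 𝟭 C ⟶ 𝟭 C) (S : C) : S ⟶ S := τ.app S

lemma centerApp_naturality (τ : 𝟭 C ⟶ 𝟭 C) {S T : C} (f : S ⟶ T) :
    f ≫ centerApp τ T = centerApp τ S ≫ f := τ.naturality f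

variable [Preadditive C] [Linear ℂ C]

/-- An endomorphism of the identity functor which acts by different scalars on the outer terms
splits a short exact sequence. -/
lemma nonempty_splitting_of_center [Balanced C] (τ : 𝟭 C ⟶ 𝟭 C) {E : ShortComplex C}
    (hE : E.ShortExact) {a b : ℂ} (hab : a ≠ b) (h₁ : centerApp τ E.X₁ = a • 𝟙 _)
    (h₃ : centerApp τ E.X₃ = b • 𝟙 _) : Nonempty E.Splitting := by
  have := hE.mono_f
  have := hE.epi_g
  have hn₁ : E.f ≫ centerApp τ E.X₂ = a • E.f := by
    rw [centerApp_naturality, h₁, Linear.smul_comp, Category.id_comp]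
  have hn₃ : centerApp τ E.X₂ ≫ E.g = b • E.g := by
    rw [← centerApp_naturality, h₃, Linear.comp_smul, Category.comp_id]
  have hz : (centerApp τ E.X₂ - b • 𝟙 E.X₂) ≫ E.g = 0 := by
    rw [Preadditive.sub_comp, hn₃, Linear.smul_comp, Category.id_comp, sub_self]
  have hr := hE.exact.lift_f _ hz
  refine ⟨ShortComplex.Splitting.ofExactOfRetraction E hE.exact
    ((a - b)⁻¹ • hE.exact.lift _ hz) ?_ hE.epi_g⟩
  rw [← cancel_mono E.f, Linear.comp_smul, Linear.smul_comp, Category.assoc, hr,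
    Preadditive.comp_sub, hn₁, Linear.comp_smul, Category.comp_id, ← sub_smul, smul_smul,
    inv_mul_cancel₀ (sub_ne_zero.2 hab), one_smul, Category.id_comp]

lemma centerApp_of_iso (τ : 𝟭 C ⟶ 𝟭 C) {S T : C} (e : S ≅ T) {a : ℂ}
    (h : centerApp τ S = a • 𝟙 _) : centerApp τ T = a • 𝟙 _ := by
  rw [← cancel_epi e.hom, centerApp_naturality, h, Linear.smul_comp, Category.id_comp,
    Linear.comp_smul, Category.comp_id]

variable (C) in
/-- Any two non-isomorphic simple objects are separated by an endomorphism of the identity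
functor. -/
def SimplesSeparated : Prop :=
  ∀ S T : C, Simple S → Simple T → ¬ Nonempty (S ≅ T) →
    ∃ (τ : 𝟭 C ⟶ 𝟭 C) (a b : ℂ), a ≠ b ∧ centerApp τ S = a • 𝟙 _ ∧ centerApp τ T = b • 𝟙 _

lemma nonempty_iso_of_linked [Balanced C] (hsep : SimplesSeparated C) {S T : C}
    (h : Linked S T) : Nonempty (S ≅ T) := by
  induction h with
  | refl => exact ⟨Iso.refl _⟩
  | symm _ _ _ ih => exact ⟨ih.some.symm⟩
  | trans _ _ _ _ _ ih ih' => exact ⟨ih.some ≪≫ ih'.some⟩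
  | rel S T h =>
    obtain ⟨hS, hT, h | ⟨E, hE, ⟨e₁⟩, ⟨e₃⟩, hns⟩⟩ := h
    · exact h
    · by_contra hST
      obtain ⟨τ, a, b, hab, ha, hb⟩ := hsep S T hS hT hST
      exact hns (nonempty_splitting_of_center τ hE hab (centerApp_of_iso τ e₁.symm ha)
        (centerApp_of_iso τ e₃.symm hb))

lemma blocksHaveUniqueSimple_of_separated [Balanced C] (hsep : SimplesSeparated C)
    (schur : ∀ (S T : C) (f : S ⟶ T), Simple S → Simple T → f ≠ 0 → IsIso f) :
    BlocksHaveUniqueSimple C := by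
  rintro B ⟨S, hS, rfl⟩
  refine ⟨S, ?_, hS, fun T hT hTs => ?_⟩
  · rintro T hT ⟨Y, m, q, hm, hq⟩
    have hm0 : m ≠ 0 := by
      rintro rfl
      have hY : 𝟙 Y = 0 := by rw [← cancel_mono (0 : Y ⟶ S)]; simp
      have hq0 : q = 0 := by rw [← Category.id_comp q, hY, Limits.zero_comp]
      subst hq0
      exact id_nonzero T (by rw [← cancel_epi (0 : Y ⟶ T)]; simp)
    have := isIso_of_mono_of_nonzero hm0
    have hq0 : inv m ≫ q ≠ 0 := by
      intro h
      refine id_nonzero T ?_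
      rw [← cancel_epi (inv m ≫ q), h]
      simp
    have := schur S T (inv m ≫ q) hS hT hq0
    exact Relation.EqvGen.rel _ _ ⟨hS, hT, Or.inl ⟨asIso (inv m ≫ q)⟩⟩
  · obtain ⟨e⟩ := nonempty_iso_of_linked hsep
      (hT T hTs ⟨T, 𝟙 T, 𝟙 T, inferInstance, inferInstance⟩)
    exact ⟨e.symm⟩

/-- Transport of an endomorphism of the identity functor along an equivalence. -/
def centerTransport {C : Type 1} [Category.{0} C] {D : Type 1} [Category.{0} D] (F : C ⥤ D) [F.Full] [F.Faithful]
    (τ : 𝟭 D ⟶ 𝟭 D) : 𝟭 C ⟶ 𝟭 C where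
  app X := F.preimage (τ.app (F.obj X))
  naturality X Y f := by
    apply F.map_injective
    have := τ.naturality (F.map f)
    simpa using this

lemma centerApp_transport {C : Type 1} [Category.{0} C] {D : Type 1} [Category.{0} D] (F : C ⥤ D) [F.Full] [F.Faithful]
    (τ : 𝟭 D ⟶ 𝟭 D) (X : C) :
    F.map (centerApp (centerTransport F τ) X) = centerApp τ (F.obj X) :=
  F.map_preimage _

variable {D : Type 1} [Category.{0} D] [Preadditive D] [Linear ℂ D]

lemma simplesSeparated_of_equivalence (F : C ⥤ D) [F.IsEquivalence] [F.Additive] [F.Linear ℂ]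
    (h : SimplesSeparated D) : SimplesSeparated C := by
  intro S T hS hT hST
  obtain ⟨τ, a, b, hab, ha, hb⟩ := h (F.obj S) (F.obj T) (simple_obj F S) (simple_obj F T)
    fun ⟨e⟩ => hST ⟨F.preimageIso e⟩
  refine ⟨centerTransport F τ, a, b, hab, ?_, ?_⟩
  · apply F.map_injective
    rw [centerApp_transport, ha, F.map_smul, F.map_id]
  · apply F.map_injective
    rw [centerApp_transport, hb, F.map_smul, F.map_id]

end Blocks

lemma PolyModGr.simplesSeparated : SimplesSeparated PolyModGr := by
  intro S T hS hT hST
  obtain ⟨t, d, ⟨e⟩⟩ := PolyModGr.exists_iso_line S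
  obtain ⟨t', d', ⟨e'⟩⟩ := PolyModGr.exists_iso_line T
  by_cases ht : t = t'
  · have hd : d ≠ d' := by
      rintro rfl
      subst ht
      exact hST ⟨e.symm ≪≫ e'⟩
    refine ⟨PolyModGr.parityNat, ksgn d 1, ksgn d' 1, ?_,
      centerApp_of_iso _ e (PolyModGr.parityNat_line t d),
      centerApp_of_iso _ e' (PolyModGr.parityNat_line t' d')⟩
    rcases zmod2_cases d with rfl | rfl <;> rcases zmod2_cases d' with rfl | rfl <;>
      first
        | exact absurd rfl hd
        | (rw [ksgn_01, ksgn_11]; norm_num)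
  · exact ⟨PolyModGr.xNat, t, t', ht, centerApp_of_iso _ e (PolyModGr.xNat_line t d),
      centerApp_of_iso _ e' (PolyModGr.xNat_line t' d')⟩

/-- A linear category equivalent to graded `ℂ[x]`-modules has blocks with a unique simple
object. -/
lemma blocksHaveUniqueSimple_of_equivalence {C : Type 1} [Category.{0} C] [Preadditive C]
    [Linear ℂ C] (F : C ⥤ PolyModGr) [F.IsEquivalence] [F.Additive] [F.Linear ℂ] :
    BlocksHaveUniqueSimple C := by
  have : Balanced C :=
    { isIso_of_mono_of_epi := fun f _ _ => by
        have : IsIso (F.map f) := isIso_of_mono_of_epi _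
        exact isIso_of_reflects_iso f F }
  refine blocksHaveUniqueSimple_of_separated
    (simplesSeparated_of_equivalence F PolyModGr.simplesSeparated) fun S T f hS hT hf => ?_
  have := simple_obj F S
  have := simple_obj F T
  have : IsIso (F.map f) := PolyModGr.isIso_of_simple
    (fun h => hf (F.map_injective (h.trans (F.map_zero _ _).symm)))
  exact isIso_of_reflects_iso f F

/-! ### Special Jordan bimodules -/

section Bimodule

variable {J : JordanSuperalgebra} (V : SuperRep J.carrier)

/-- The operators of `V` are, up to the factor `2`, a homomorphism of Jordan superalgebras from `J`
to the endomorphisms of `V`. -/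
def IsSpecialAction : Prop :=
  (∀ i j, ∀ a ∈ J.grading i, ∀ v ∈ V.grading j, V.act a v ∈ V.grading (i + j)) ∧
  ∀ i j, ∀ a ∈ J.grading i, ∀ b ∈ J.grading j, ∀ v,
    V.act (J.mul a b) v = V.act a (V.act b v) + ksgn i j • V.act b (V.act a v)

/-- The right action `v · a = (-1)^(|v| |a|) a · v`. -/
def rightAct : V.carrier →ₗ[ℂ] J.carrier →ₗ[ℂ] V.carrier :=
  ∑ i : ZMod 2, ∑ j : ZMod 2, ksgn i j •
    ((show J.carrier →ₗ[ℂ] V.carrier →ₗ[ℂ] V.carrier from V.act).flip.compl₁₂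
      (parityProj V.isInternal i) (parityProj J.isInternal j))

lemma rightAct_of_mem {i j : ZMod 2} {v : V.carrier} {a : J.carrier} (hv : v ∈ V.grading i)
    (ha : a ∈ J.grading j) : rightAct V v a = ksgn i j • V.act a v := by
  simp only [rightAct, LinearMap.sum_apply, LinearMap.smul_apply, LinearMap.compl₁₂_apply,
    parityProj_of_mem V.isInternal hv, parityProj_of_mem J.isInternal ha]
  rw [Finset.sum_eq_single i (by intro b _ hb; simp [hb]) (by simp),
    Finset.sum_eq_single j (by intro b _ hb; simp [hb]) (by simp)]
  simp only [if_true]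
  rfl

/-- The product of the null split extension `J ⊕ V`. -/
def nullExtMul :
    (J.carrier × V.carrier) →ₗ[ℂ] (J.carrier × V.carrier) →ₗ[ℂ] (J.carrier × V.carrier) :=
  (J.mul.compl₁₂ (LinearMap.fst ℂ _ _) (LinearMap.fst ℂ _ _)).compr₂ (LinearMap.inl ℂ _ _)
  + ((show J.carrier →ₗ[ℂ] V.carrier →ₗ[ℂ] V.carrier from V.act).compl₁₂
      (LinearMap.fst ℂ _ _) (LinearMap.snd ℂ _ _)).compr₂ (LinearMap.inr ℂ _ _)
  + ((rightAct V).compl₁₂ (LinearMap.snd ℂ _ _) (LinearMap.fst ℂ _ _)).compr₂ (LinearMap.inr ℂ _ _)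

lemma nullExtMul_apply (p q : J.carrier × V.carrier) :
    nullExtMul V p q = (J.mul p.1 q.1, V.act p.1 q.2 + rightAct V p.2 q.1) := by
  ext
  · simp [nullExtMul]
  · simp [nullExtMul]

/-- The embedding of the null split extension into an associative algebra, modulo its part `J`. -/
def nullExtEmb : (J.carrier × V.carrier) →ₗ[ℂ] Module.End ℂ (ℂ × V.carrier) where
  toFun p := LinearMap.inr ℂ ℂ V.carrier ∘ₗ
    ((LinearMap.fst ℂ ℂ V.carrier).smulRight p.2
      + (2 : ℂ) • (V.act p.1) ∘ₗ LinearMap.snd ℂ ℂ V.carrier)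
  map_add' p q := by
    ext <;> simp
  map_smul' c p := by
    ext <;> simp [smul_comm c (2 : ℂ)]

lemma nullExtEmb_apply (p : J.carrier × V.carrier) (z : ℂ × V.carrier) :
    nullExtEmb V p z = (0, z.1 • p.2 + (2 : ℂ) • V.act p.1 z.2) := rfl

variable {V}

lemma nullExtEmb_mul (h : IsSpecialAction V) {i j : ZMod 2} {p q : J.carrier × V.carrier}
    (hp : p ∈ (J.grading i).prod (V.grading i)) (hq : q ∈ (J.grading j).prod (V.grading j)) :
    nullExtEmb V (nullExtMul V p q)
      = (1 / 2 : ℂ) • (nullExtEmb V p * nullExtEmb V q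
          + ksgn i j • (nullExtEmb V q * nullExtEmb V p)) := by
  refine LinearMap.ext fun z => ?_
  simp only [LinearMap.smul_apply, LinearMap.add_apply, Module.End.mul_apply, nullExtEmb_apply,
    nullExtMul_apply, rightAct_of_mem V hp.2 hq.1, h.2 i j _ hp.1 _ hq.1, map_add, map_smul]
  ext
  · simp
  · simp only [Prod.smul_mk, Prod.mk_add_mk, zero_smul, zero_add]
    module

lemma nullExtMul_mem (h : IsSpecialAction V) {i j : ZMod 2} {p q : J.carrier × V.carrier}
    (hp : p ∈ (J.grading i).prod (V.grading i)) (hq : q ∈ (J.grading j).prod (V.grading j)) :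
    nullExtMul V p q ∈ (J.grading (i + j)).prod (V.grading (i + j)) := by
  rw [nullExtMul_apply, rightAct_of_mem V hp.2 hq.1]
  exact ⟨J.isJordan.mul_mem i j _ hp.1 _ hq.1, Submodule.add_mem _ (h.1 i j _ hp.1 _ hq.2)
    (Submodule.smul_mem _ _ (add_comm i j ▸ h.1 j i _ hq.1 _ hp.2))⟩

lemma ksgn_comm (i j : ZMod 2) : ksgn i j = ksgn j i := by
  simp [ksgn, mul_comm]

lemma ksgn_mul_self (i j : ZMod 2) : ksgn i j * ksgn i j = 1 := by
  rcases zmod2_cases i with rfl | rfl <;> rcases zmod2_cases j with rfl | rfl <;>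
    simp [ksgn_00, ksgn_01, ksgn_10, ksgn_11]

lemma isJordanBimodule_of_isSpecialAction (h : IsSpecialAction V) : IsJordanBimodule J V := by
  refine ⟨nullExtMul V, fun a b => ?_, fun a v => ?_, fun v w => ?_, ?_, ?_, ?_⟩
  · simp [nullExtMul_apply]
  · simp [nullExtMul_apply]
  · simp [nullExtMul_apply]
  · exact fun i j p hp q hq => nullExtMul_mem h hp hq
  · intro i j p hp q hq
    rw [nullExtMul_apply, nullExtMul_apply, rightAct_of_mem V hp.2 hq.1,
      rightAct_of_mem V hq.2 hp.1, J.isJordan.comm i j _ hp.1 _ hq.1]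
    ext
    · simp
    · simp [smul_smul, ksgn_comm j i, ksgn_mul_self, add_comm]
  · intro i j k l a ha b hb c hc d hd
    have hab := nullExtMul_mem h ha hb
    have had := nullExtMul_mem h ha hd
    have hbd := nullExtMul_mem h hb hd
    have hac := nullExtMul_mem h ha hc
    have hcd := nullExtMul_mem h hc hd
    have hbc := nullExtMul_mem h hb hc
    have key := assoc_jordan i j k l (nullExtEmb V a) (nullExtEmb V b) (nullExtEmb V c)
      (nullExtEmb V d)
    dsimp only at key
    rw [← nullExtEmb_mul h ha hb, ← nullExtEmb_mul h ha hd, ← nullExtEmb_mul h hb hd,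
      ← nullExtEmb_mul h ha hc, ← nullExtEmb_mul h hc hd, ← nullExtEmb_mul h hb hc,
      ← nullExtEmb_mul h hab hc, ← nullExtEmb_mul h had hc, ← nullExtEmb_mul h hbd hc,
      ← nullExtEmb_mul h hab hcd, ← nullExtEmb_mul h hac hbd, ← nullExtEmb_mul h had hbc,
      ← nullExtEmb_mul h (nullExtMul_mem h hab hc) hd,
      ← nullExtEmb_mul h (nullExtMul_mem h had hc) hb,
      ← nullExtEmb_mul h (nullExtMul_mem h hbd hc) ha] at key
    simp only [← (nullExtEmb V).map_smul, ← (nullExtEmb V).map_add] at key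
    ext
    · have := J.isJordan.jordan i j k l _ ha.1 _ hb.1 _ hc.1 _ hd.1
      simpa [nullExtMul_apply] using this
    · have := congrArg Prod.snd (LinearMap.congr_fun key (1, 0))
      simpa only [nullExtEmb_apply, one_smul, map_zero, smul_zero, add_zero] using this

/-- For a bimodule on which an even unit acts by `½`, the action is special. -/
lemma isSpecialAction_of_isJordanBimodule (h : IsJordanBimodule J V) {e : J.carrier}
    (he : e ∈ J.grading 0) (hone' : ∀ a, J.mul a e = a)
    (hact : V.act e = (1 / 2 : ℂ) • LinearMap.id) : IsSpecialAction V := by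
  obtain ⟨mul, hJ, hV, -, hj⟩ := h
  have inJ : ∀ i, ∀ a ∈ J.grading i, ((a, 0) : J.carrier × V.carrier)
      ∈ (J.grading i).prod (V.grading i) := fun i a ha => ⟨ha, Submodule.zero_mem _⟩
  have inV : ∀ i, ∀ v ∈ V.grading i, ((0, v) : J.carrier × V.carrier)
      ∈ (J.grading i).prod (V.grading i) := fun i a ha => ⟨Submodule.zero_mem _, ha⟩
  have hmem : ∀ i j, ∀ a ∈ J.grading i, ∀ v ∈ V.grading j, V.act a v ∈ V.grading (i + j) := by
    intro i j a ha v hv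
    have := hj.mul_mem i j _ (inJ i a ha) _ (inV j v hv)
    rw [hV] at this
    exact this.2
  have hR : ∀ i j, ∀ a ∈ J.grading i, ∀ v ∈ V.grading j,
      mul (0, v) (a, 0) = ksgn j i • (0, V.act a v) := by
    intro i j a ha v hv
    rw [hj.comm j i _ (inV j v hv) _ (inJ i a ha), hV]
  refine ⟨hmem, fun i j a ha b hb v => ?_⟩
  suffices hh : V.act (J.mul a b) = V.act a ∘ₗ V.act b + ksgn i j • V.act b ∘ₗ V.act a from
    LinearMap.congr_fun hh v
  refine linearMap_ext_of_homogeneous V.isInternal fun l v hv => ?_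
  have key := hj.jordan i j 0 l _ (inJ i a ha) _ (inJ j b hb) _ (inJ 0 e he) _ (inV l v hv)
  have e2 : ∀ v, V.act e v = (1 / 2 : ℂ) • v := fun v => by rw [hact]; rfl
  have hav := hmem i l a ha v hv
  have hbv := hmem j l b hb v hv
  simp only [hJ, hV, hone', e2] at key
  rw [hR 0 (i + l) e he _ hav, hR 0 (j + l) e he _ hbv, map_smul, map_smul, LinearMap.smul_apply,
    LinearMap.smul_apply, e2, e2] at key
  have sm : ∀ (c : ℂ) (v : V.carrier), ((0, c • v) : J.carrier × V.carrier) = c • (0, v) :=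
    fun c v => by simp
  simp only [sm, map_smul, LinearMap.smul_apply] at key
  rw [hR j (i + l) b hb _ hav, hR i (j + l) a ha _ hbv] at key
  have key2 := congrArg Prod.snd key
  simp only [Prod.snd_add, Prod.smul_snd] at key2
  simp only [LinearMap.add_apply, LinearMap.comp_apply, LinearMap.smul_apply]
  clear key hR inV inJ hmem hav hbv hv hJ hV hj
  generalize V.act a (V.act b v) = P at *
  generalize V.act b (V.act a v) = Q at *
  generalize V.act (J.mul a b) v = R at *
  rcases zmod2_cases i with rfl | rfl <;> rcases zmod2_cases j with rfl | rfl <;>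
    rcases zmod2_cases l with rfl | rfl <;>
    simp only [ksgn_00, ksgn_01, ksgn_10, ksgn_11, add_zero, zero_add, one_smul, mul_one, mul_neg,
      neg_neg, neg_smul, smul_neg, show (1 : ZMod 2) + 1 = 0 from rfl] at key2 ⊢ <;>
    linear_combination (norm := module) (2 : ℂ) • key2

end Bimodule

lemma jpOne_mem : jpOne (Fin 2) ∈ (JP (Fin 2)).grading 0 := by
  change matPart (Fin 2) 0 1 = 1
  rw [matPart_zero_apply, ← fromBlocks_one]
  simp [-fromBlocks_one]

lemma one_mem_matGrading : (1 : SMat (Fin 2)) ∈ matGrading (Fin 2) 0 := jpOne_mem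

lemma superJord_one_right (X : SMat (Fin 2)) : superJord (Fin 2) X 1 = X := by
  conv_lhs => rw [← matPart_add_matPart X]
  rw [map_add, LinearMap.add_apply,
    superJord_of_mem (matPart_mem_matGrading 0 X) one_mem_matGrading,
    superJord_of_mem (matPart_mem_matGrading 1 X) one_mem_matGrading, ksgn_00, ksgn_10]
  conv_rhs => rw [← matPart_add_matPart X]
  simp only [one_mul, mul_one]
  module

/-- Special `JP(2)`-modules are the superspaces with a homomorphism of unital Jordan
superalgebras to their endomorphisms. -/
lemma isSpecialJP2_iff (V : SuperRep (JP (Fin 2)).carrier) :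
    IsSpecialJP2 V ↔
      IsSpecialAction V ∧ V.act (jpOne (Fin 2)) = (1 / 2 : ℂ) • LinearMap.id := by
  refine ⟨fun ⟨h, h1⟩ => ⟨?_, h1⟩, fun ⟨h, h1⟩ => ⟨isJordanBimodule_of_isSpecialAction h, h1⟩⟩
  exact isSpecialAction_of_isJordanBimodule h jpOne_mem
    (fun a => Subtype.ext (superJord_one_right a.1)) h1

/-! ### Superspaces of column vectors over a graded `ℂ[x]`-module -/

section MatRep

variable {n : Type} [Fintype n] [DecidableEq n]

/-- The action of matrices over `ℂ[x]` on column vectors with entries in `N`. -/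
def polyMatAct (n : Type) [Fintype n] [DecidableEq n] (N : PolyModGr) :
    Matrix (n ⊕ n) (n ⊕ n) ℂ[X] →ₗ[ℂ] Module.End ℂ (n ⊕ n → N.obj.carrier) where
  toFun M := LinearMap.pi fun k => ∑ l, N.obj.act (M k l) ∘ₗ LinearMap.proj l
  map_add' M M' := by
    ext l v k
    simp only [LinearMap.comp_apply, LinearMap.pi_apply, LinearMap.sum_apply, Matrix.add_apply,
      map_add, LinearMap.add_apply, Finset.sum_add_distrib, Pi.add_apply]
  map_smul' c M := by
    ext l v k
    simp [Finset.smul_sum]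

lemma polyMatAct_apply (N : PolyModGr) (M : Matrix (n ⊕ n) (n ⊕ n) ℂ[X])
    (v : n ⊕ n → N.obj.carrier) (k : n ⊕ n) :
    polyMatAct n N M v k = ∑ l, N.obj.act (M k l) (v l) := by
  simp [polyMatAct]

lemma polyMatAct_mul (N : PolyModGr) (M M' : Matrix (n ⊕ n) (n ⊕ n) ℂ[X])
    (v : n ⊕ n → N.obj.carrier) :
    polyMatAct n N (M * M') v = polyMatAct n N M (polyMatAct n N M' v) := by
  ext k
  simp only [polyMatAct_apply, Matrix.mul_apply, map_sum, LinearMap.sum_apply,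
    PolyModGr.act_mul]
  exact Finset.sum_comm

lemma polyMatAct_one (N : PolyModGr) : polyMatAct n N 1 = 1 := by
  refine LinearMap.ext fun v => funext fun k => ?_
  rw [polyMatAct_apply, Finset.sum_eq_single k]
  · rw [Matrix.one_apply_eq, N.property.1]; rfl
  · intro l _ hl
    rw [Matrix.one_apply_ne (Ne.symm hl), map_zero]; rfl
  · simp

/-- The grading on column vectors: the second half has shifted parity. -/
def columnGrading (n : Type) [Fintype n] [DecidableEq n] (N : PolyModGr) (i : ZMod 2) :
    Submodule ℂ (n ⊕ n → N.obj.carrier) where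
  carrier := {v | (∀ k, v (Sum.inl k) ∈ N.obj.grading i) ∧
    ∀ k, v (Sum.inr k) ∈ N.obj.grading (i + 1)}
  add_mem' h h' := ⟨fun k => Submodule.add_mem _ (h.1 k) (h'.1 k),
    fun k => Submodule.add_mem _ (h.2 k) (h'.2 k)⟩
  zero_mem' := ⟨fun _ => Submodule.zero_mem _, fun _ => Submodule.zero_mem _⟩
  smul_mem' c _ h := ⟨fun k => Submodule.smul_mem _ c (h.1 k),
    fun k => Submodule.smul_mem _ c (h.2 k)⟩

lemma columnGrading_isInternal (N : PolyModGr) : DirectSum.IsInternal (columnGrading n N) := by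
  refine isInternal_of_proj
    (fun i v => Sum.elim (fun k => parityProj N.obj.isInternal i (v (Sum.inl k)))
      (fun k => parityProj N.obj.isInternal (i + 1) (v (Sum.inr k)))) ?_ ?_ ?_
  · exact fun i v => ⟨fun k => parityProj_mem _ _ _, fun k => parityProj_mem _ _ _⟩
  · intro v
    ext (k | k)
    · exact parityProj_add _ _
    · exact (add_comm _ _).trans (parityProj_add N.obj.isInternal (v (Sum.inr k)))
  · intro v h0 h1
    ext (k | k)
    · exact eq_zero_of_mem_of_mem N.obj.isInternal (h0.1 k) (h1.1 k)
    · exact eq_zero_of_mem_of_mem N.obj.isInternal (h1.2 k) (h0.2 k)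

variable {𝔸 : Type} [AddCommGroup 𝔸] [Module ℂ 𝔸]

/-- Column vectors over `N`, with the action of `𝔸` by matrices over `ℂ[x]`. -/
def matRep (θ : 𝔸 →ₗ[ℂ] Matrix (n ⊕ n) (n ⊕ n) ℂ[X]) (N : PolyModGr) : SuperRep 𝔸 where
  carrier := n ⊕ n → N.obj.carrier
  grading := columnGrading n N
  isInternal := columnGrading_isInternal N
  act := polyMatAct n N ∘ₗ θ

/-- The action of `matRep` on morphisms. -/
def matRepMap (θ : 𝔸 →ₗ[ℂ] Matrix (n ⊕ n) (n ⊕ n) ℂ[X]) {N N' : PolyModGr} (f : N ⟶ N') :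
    matRep θ N ⟶ matRep θ N' :=
  SuperRep.Hom.mk ((SuperRep.Hom.toLin f.hom).compLeft (n ⊕ n))
    (fun i _ hv => ⟨fun k => SuperRep.Hom.map_grading f.hom i _ (hv.1 k),
      fun k => SuperRep.Hom.map_grading f.hom (i + 1) _ (hv.2 k)⟩)
    (fun a v => funext fun k => by
      refine (congrArg (SuperRep.Hom.toLin f.hom) (polyMatAct_apply N (θ a) v k)).trans
        (Eq.trans ?_ (polyMatAct_apply N' (θ a) (SuperRep.Hom.toLin f.hom ∘ v) k).symm)
      rw [map_sum]
      exact Finset.sum_congr rfl fun l _ => SuperRep.Hom.map_act f.hom _ _)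

/-- If `θ` generates the matrix algebra, all morphisms come from morphisms of `ℂ[x]`-modules. -/
lemma exists_matRepMap_eq [Nonempty n] {θ : 𝔸 →ₗ[ℂ] Matrix (n ⊕ n) (n ⊕ n) ℂ[X]}
    (hθ : Algebra.adjoin ℂ (Set.range θ) = ⊤) {N N' : PolyModGr}
    (g : matRep θ N ⟶ matRep θ N') : ∃ f : N ⟶ N', matRepMap θ f = g := by
  let G : (n ⊕ n → N.obj.carrier) →ₗ[ℂ] (n ⊕ n → N'.obj.carrier) := SuperRep.Hom.toLin g
  have hG : ∀ M v, G (polyMatAct n N M v) = polyMatAct n N' M (G v) := by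
    intro M
    have hM : M ∈ Algebra.adjoin ℂ (Set.range θ) := by rw [hθ]; trivial
    induction hM using Algebra.adjoin_induction with
    | mem M hM =>
      obtain ⟨a, rfl⟩ := hM
      exact SuperRep.Hom.map_act g a
    | algebraMap r =>
      intro v
      rw [Algebra.algebraMap_eq_smul_one, map_smul, map_smul, polyMatAct_one, polyMatAct_one]
      exact map_smul G r v
    | add M M' _ _ h h' => intro v; simp [h, h']
    | mul M M' _ _ h h' => intro v; rw [polyMatAct_mul, polyMatAct_mul, h, h']
  obtain ⟨k₀⟩ := ‹Nonempty n›
  let F : N.obj.carrier →ₗ[ℂ] N'.obj.carrier :=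
    LinearMap.proj (Sum.inl k₀) ∘ₗ G ∘ₗ LinearMap.single ℂ (fun _ : n ⊕ n => N.obj.carrier) (Sum.inl k₀)
  have hF : ∀ m, F m = G (Pi.single (Sum.inl k₀) m) (Sum.inl k₀) := fun m => rfl
  have hs : ∀ (N : PolyModGr) (k l : n ⊕ n) (p : ℂ[X]) (v : n ⊕ n → N.obj.carrier),
      polyMatAct n N (Matrix.single k l p) v = Pi.single k (N.obj.act p (v l)) := by
    intro N k l p v
    ext j
    rw [polyMatAct_apply, Finset.sum_eq_single l]
    · by_cases hj : j = k
      · subst hj; simp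
      · rw [Matrix.single_apply_of_ne _ _ _ _ _ (fun h => hj h.1.symm), map_zero,
          Pi.single_eq_of_ne hj]; rfl
    · intro l' _ hl
      rw [Matrix.single_apply_of_ne _ _ _ _ _ (fun h => hl h.2.symm), map_zero]; rfl
    · simp
  have hFact : ∀ p m, F (N.obj.act p m) = N'.obj.act p (F m) := by
    intro p m
    have := hG (Matrix.single (Sum.inl k₀) (Sum.inl k₀) p) (Pi.single (Sum.inl k₀) m)
    rw [hs, hs, Pi.single_eq_same] at this
    rw [hF, hF, this, Pi.single_eq_same]
  refine ⟨ObjectProperty.homMk (SuperRep.Hom.mk F ?_ hFact), ?_⟩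
  · intro i m hm
    refine (SuperRep.Hom.map_grading g i (Pi.single (Sum.inl k₀) m) ⟨fun k => ?_, fun k => ?_⟩).1 k₀
    · by_cases hk : k = k₀
      · subst hk; simpa using hm
      · rw [Pi.single_eq_of_ne (fun h => hk (Sum.inl.inj h))]; exact Submodule.zero_mem _
    · rw [Pi.single_eq_of_ne (by simp)]; exact Submodule.zero_mem _
  · refine SuperRep.hom_ext (LinearMap.pi_ext fun l m => ?_)
    have h1 : (Pi.single l m : n ⊕ n → N.obj.carrier)
        = polyMatAct n N (Matrix.single l (Sum.inl k₀) 1) (Pi.single (Sum.inl k₀) m) := by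
      rw [hs, N.property.1, Pi.single_eq_same]; rfl
    change (fun k => F ((Pi.single l m : n ⊕ n → N.obj.carrier) k)) = G (Pi.single l m)
    have h2 : G (Pi.single l m) = Pi.single l (F m) := by
      rw [h1, hG, hs, N'.property.1]; rfl
    rw [h2]
    ext k
    by_cases hk : k = l
    · subst hk; simp
    · rw [Pi.single_eq_of_ne hk, Pi.single_eq_of_ne hk, map_zero]

end MatRep

/-! ### The family of representations of `JP(2)` by `(2|2)`-matrices -/

section Coordinates

variable {R : Type*} [CommRing R]

/-- The even element `[A, 0; 0, Aᵀ]` with `A = [a, b; c, d]`. -/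
def evenMat (a b c d : R) : Matrix (Fin 2 ⊕ Fin 2) (Fin 2 ⊕ Fin 2) R :=
  fromBlocks !![a, b; c, d] 0 0 !![a, c; b, d]

/-- The odd element `[0, B + τ C; C, 0]` with `B = [x, y; y, z]` and `C = [0, t; -t, 0]`. -/
def oddMat (τ x y z t : R) : Matrix (Fin 2 ⊕ Fin 2) (Fin 2 ⊕ Fin 2) R :=
  fromBlocks 0 !![x, y + τ * t; y - τ * t, z] !![0, t; -t, 0] 0

lemma evenMat_mul_evenMat (a b c d a' b' c' d' : R) :
    evenMat a b c d * evenMat a' b' c' d' + evenMat a' b' c' d' * evenMat a b c d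
      = evenMat (2 * (a * a') + b * c' + b' * c) (a * b' + b * d' + a' * b + b' * d)
        (c * a' + d * c' + c' * a + d' * c) (c * b' + c' * b + 2 * (d * d')) := by
  simp only [evenMat, fromBlocks_multiply, fromBlocks_add, Matrix.mul_fin_two, mul_zero, zero_mul,
    add_zero, zero_add]
  congr 1 <;> ext i j <;> fin_cases i <;> fin_cases j <;> simp <;> ring

lemma evenMat_mul_oddMat (τ a b c d x y z t : R) :
    evenMat a b c d * oddMat τ x y z t + oddMat τ x y z t * evenMat a b c d
      = oddMat τ (2 * (a * x + b * y)) (a * y + b * z + c * x + d * y) (2 * (c * y + d * z))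
        ((a + d) * t) := by
  simp only [evenMat, oddMat, fromBlocks_multiply, fromBlocks_add, Matrix.mul_fin_two, mul_zero,
    zero_mul, add_zero, zero_add]
  congr 1 <;> ext i j <;> fin_cases i <;> fin_cases j <;> simp <;> ring

lemma oddMat_mul_oddMat (τ x y z t x' y' z' t' : R) :
    oddMat τ x y z t * oddMat τ x' y' z' t' - oddMat τ x' y' z' t' * oddMat τ x y z t
      = evenMat (y' * t - y * t') (x * t' - x' * t) (z' * t - z * t') (y * t' - y' * t) := by
  simp only [evenMat, oddMat, fromBlocks_multiply, sub_eq_add_neg, fromBlocks_add, fromBlocks_neg,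
    Matrix.mul_fin_two, mul_zero, zero_mul, add_zero, zero_add]
  congr 1 <;> ext i j <;> fin_cases i <;> fin_cases j <;> simp <;> ring

end Coordinates

/-- The linear extension of `[A, B; C, Aᵀ] ↦ [A, B + x C; C, Aᵀ]` to all matrices. -/
def wMat : SMat (Fin 2) →ₗ[ℂ] Matrix (Fin 2 ⊕ Fin 2) (Fin 2 ⊕ Fin 2) ℂ[X] where
  toFun M := M.map C + fromBlocks 0 (of fun i j => X * C (M (Sum.inr i) (Sum.inl j))) 0 0
  map_add' M M' := by
    apply Matrix.ext
    rintro (i | i) (j | j) <;> simp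
    ring
  map_smul' c M := by
    apply Matrix.ext
    rintro (i | i) (j | j) <;> simp [Polynomial.smul_eq_C_mul]
    ring

lemma wMat_apply (M : SMat (Fin 2)) : wMat M
    = M.map C + fromBlocks 0 (of fun i j => X * C (M (Sum.inr i) (Sum.inl j))) 0 0 := rfl

lemma wMat_evenMat (a b c d : ℂ) : wMat (evenMat a b c d) = evenMat (C a) (C b) (C c) (C d) := by
  rw [wMat_apply]
  apply Matrix.ext
  rintro (i | i) (j | j) <;> fin_cases i <;> fin_cases j <;> simp [evenMat]

lemma wMat_oddMat (x y z t : ℂ) :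
    wMat (oddMat 0 x y z t) = oddMat X (C x) (C y) (C z) (C t) := by
  rw [wMat_apply]
  apply Matrix.ext
  rintro (i | i) (j | j) <;> fin_cases i <;> fin_cases j <;> simp [oddMat, sub_eq_add_neg]

lemma evenMat_mem_jpSpace (a b c d : ℂ) : evenMat a b c d ∈ jpSpace (Fin 2) := by
  refine ⟨?_, ?_, ?_⟩ <;> ext i j <;> fin_cases i <;> fin_cases j <;> simp [evenMat]

lemma oddMat_mem_jpSpace (x y z t : ℂ) : oddMat 0 x y z t ∈ jpSpace (Fin 2) := by
  refine ⟨?_, ?_, ?_⟩ <;> ext i j <;> fin_cases i <;> fin_cases j <;> simp [oddMat]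

/-- The even element `[A, 0; 0, Aᵀ]` of `JP(2)`, with `A = [a, b; c, d]`. -/
def jpEven (a b c d : ℂ) : (JP (Fin 2)).carrier :=
  (⟨evenMat a b c d, evenMat_mem_jpSpace a b c d⟩ : jpSpace (Fin 2))

/-- The odd element `[0, B; C, 0]` of `JP(2)`, with `B = [x, y; y, z]` and `C = [0, t; -t, 0]`. -/
def jpOdd (x y z t : ℂ) : (JP (Fin 2)).carrier :=
  (⟨oddMat 0 x y z t, oddMat_mem_jpSpace x y z t⟩ : jpSpace (Fin 2))

lemma jpEven_mem (a b c d : ℂ) : jpEven a b c d ∈ (JP (Fin 2)).grading 0 := by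
  change matPart (Fin 2) 0 (evenMat a b c d) = evenMat a b c d
  rw [matPart_zero_apply]
  simp [evenMat]

lemma jpOdd_mem (x y z t : ℂ) : jpOdd x y z t ∈ (JP (Fin 2)).grading 1 := by
  change matPart (Fin 2) 1 (oddMat 0 x y z t) = oddMat 0 x y z t
  rw [matPart_one_apply]
  simp [oddMat]

lemma exists_eq_jpEven {Y : (JP (Fin 2)).carrier} (hY : Y ∈ (JP (Fin 2)).grading 0) :
    ∃ a b c d, Y = jpEven a b c d := by
  obtain ⟨Y, h1, h2, h3⟩ := Y
  have hY' : matPart (Fin 2) 0 Y = Y := hY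
  refine ⟨Y (Sum.inl 0) (Sum.inl 0), Y (Sum.inl 0) (Sum.inl 1), Y (Sum.inl 1) (Sum.inl 0),
    Y (Sum.inl 1) (Sum.inl 1), Subtype.ext ?_⟩
  rw [matPart_zero_apply, h1] at hY'
  change Y = evenMat _ _ _ _
  conv_lhs => rw [← hY']
  rw [evenMat]
  congr 1 <;> ext i j <;> fin_cases i <;> fin_cases j <;> rfl

lemma exists_eq_jpOdd {Y : (JP (Fin 2)).carrier} (hY : Y ∈ (JP (Fin 2)).grading 1) :
    ∃ x y z t, Y = jpOdd x y z t := by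
  obtain ⟨Y, h1, h2, h3⟩ := Y
  have hY' : matPart (Fin 2) 1 Y = Y := hY
  refine ⟨Y (Sum.inl 0) (Sum.inr 0), Y (Sum.inl 0) (Sum.inr 1), Y (Sum.inl 1) (Sum.inr 1),
    Y (Sum.inr 0) (Sum.inl 1), Subtype.ext ?_⟩
  rw [matPart_one_apply] at hY'
  change Y = oddMat _ _ _ _ _
  have k2 : Y (Sum.inl 0) (Sum.inr 1) = Y (Sum.inl 1) (Sum.inr 0) := congrFun (congrFun h2 1) 0
  have k3 : ∀ i j, Y (Sum.inr j) (Sum.inl i) = -Y (Sum.inr i) (Sum.inl j) :=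
    fun i j => congrFun (congrFun h3 i) j
  have k00 := self_eq_neg.1 (k3 0 0)
  have k11 := self_eq_neg.1 (k3 1 1)
  have k01 := k3 0 1
  conv_lhs => rw [← hY']
  rw [oddMat]
  congr 1 <;> ext i j <;> fin_cases i <;> fin_cases j <;>
    simp [toBlocks₂₁, toBlocks₁₂, k2, k00, k11, k01]

lemma jpEven_mul_jpEven (a b c d a' b' c' d' : ℂ) :
    (JP (Fin 2)).mul (jpEven a b c d) (jpEven a' b' c' d') = (1 / 2 : ℂ) •
      jpEven (2 * (a * a') + b * c' + b' * c) (a * b' + b * d' + a' * b + b' * d)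
        (c * a' + d * c' + c' * a + d' * c) (c * b' + c' * b + 2 * (d * d')) := by
  refine Subtype.ext ((superJord_of_mem (jpEven_mem a b c d) (jpEven_mem a' b' c' d')).trans ?_)
  rw [ksgn_00, one_smul]
  exact congrArg _ (evenMat_mul_evenMat a b c d a' b' c' d')

lemma jpEven_mul_jpOdd (a b c d x y z t : ℂ) :
    (JP (Fin 2)).mul (jpEven a b c d) (jpOdd x y z t) = (1 / 2 : ℂ) •
      jpOdd (2 * (a * x + b * y)) (a * y + b * z + c * x + d * y) (2 * (c * y + d * z))
        ((a + d) * t) := by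
  refine Subtype.ext ((superJord_of_mem (jpEven_mem a b c d) (jpOdd_mem x y z t)).trans ?_)
  rw [ksgn_01, one_smul]
  exact congrArg _ (evenMat_mul_oddMat 0 a b c d x y z t)

lemma jpOdd_mul_jpOdd (x y z t x' y' z' t' : ℂ) :
    (JP (Fin 2)).mul (jpOdd x y z t) (jpOdd x' y' z' t') = (1 / 2 : ℂ) •
      jpEven (y' * t - y * t') (x * t' - x' * t) (z' * t - z * t') (y * t' - y' * t) := by
  refine Subtype.ext ((superJord_of_mem (jpOdd_mem x y z t) (jpOdd_mem x' y' z' t')).trans ?_)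
  rw [ksgn_11, neg_one_smul, ← sub_eq_add_neg]
  exact congrArg _ (oddMat_mul_oddMat 0 x y z t x' y' z' t')

/-- The action of `JP(2)` by matrices over `ℂ[x]`. -/
def jpTheta : (JP (Fin 2)).carrier →ₗ[ℂ] Matrix (Fin 2 ⊕ Fin 2) (Fin 2 ⊕ Fin 2) ℂ[X] :=
  (1 / 2 : ℂ) • wMat ∘ₗ (jpSpace (Fin 2)).subtype

lemma jpTheta_jpEven (a b c d : ℂ) :
    jpTheta (jpEven a b c d) = (1 / 2 : ℂ) • evenMat (C a) (C b) (C c) (C d) :=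
  congrArg (fun M => (1 / 2 : ℂ) • M) (wMat_evenMat a b c d)

lemma jpTheta_jpOdd (x y z t : ℂ) :
    jpTheta (jpOdd x y z t) = (1 / 2 : ℂ) • oddMat X (C x) (C y) (C z) (C t) :=
  congrArg (fun M => (1 / 2 : ℂ) • M) (wMat_oddMat x y z t)

lemma jpTheta_even_mul_even (a b c d a' b' c' d' : ℂ) :
    jpTheta ((JP (Fin 2)).mul (jpEven a b c d) (jpEven a' b' c' d'))
      = jpTheta (jpEven a b c d) * jpTheta (jpEven a' b' c' d')
        + jpTheta (jpEven a' b' c' d') * jpTheta (jpEven a b c d) := by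
  have h := evenMat_mul_evenMat (C a) (C b) (C c) (C d) (C a') (C b') (C c') (C d')
  rw [jpEven_mul_jpEven, map_smul]
  simp only [jpTheta_jpEven, smul_mul_smul_comm, ← smul_add, h, map_add, map_mul,
    show C (2 : ℂ) = 2 from rfl]
  rw [smul_smul]

lemma jpTheta_even_mul_odd (a b c d x y z t : ℂ) :
    jpTheta ((JP (Fin 2)).mul (jpEven a b c d) (jpOdd x y z t))
      = jpTheta (jpEven a b c d) * jpTheta (jpOdd x y z t)
        + jpTheta (jpOdd x y z t) * jpTheta (jpEven a b c d) := by
  have h := evenMat_mul_oddMat X (C a) (C b) (C c) (C d) (C x) (C y) (C z) (C t)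
  rw [jpEven_mul_jpOdd, map_smul]
  simp only [jpTheta_jpEven, jpTheta_jpOdd, smul_mul_smul_comm, ← smul_add, h, map_add, map_mul,
    show C (2 : ℂ) = 2 from rfl]
  rw [smul_smul]

lemma jpTheta_odd_mul_odd (x y z t x' y' z' t' : ℂ) :
    jpTheta ((JP (Fin 2)).mul (jpOdd x y z t) (jpOdd x' y' z' t'))
      = jpTheta (jpOdd x y z t) * jpTheta (jpOdd x' y' z' t')
        - jpTheta (jpOdd x' y' z' t') * jpTheta (jpOdd x y z t) := by
  have h := oddMat_mul_oddMat X (C x) (C y) (C z) (C t) (C x') (C y') (C z') (C t')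
  rw [jpOdd_mul_jpOdd, map_smul]
  simp only [jpTheta_jpEven, jpTheta_jpOdd, smul_mul_smul_comm, ← smul_sub, h, map_sub, map_mul]
  rw [smul_smul]

lemma jpTheta_mul {i j : ZMod 2} {Y Z : (JP (Fin 2)).carrier} (hY : Y ∈ (JP (Fin 2)).grading i)
    (hZ : Z ∈ (JP (Fin 2)).grading j) :
    jpTheta ((JP (Fin 2)).mul Y Z)
      = jpTheta Y * jpTheta Z + ksgn i j • (jpTheta Z * jpTheta Y) := by
  rcases zmod2_cases i with rfl | rfl <;> rcases zmod2_cases j with rfl | rfl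
  · obtain ⟨a, b, c, d, rfl⟩ := exists_eq_jpEven hY
    obtain ⟨a', b', c', d', rfl⟩ := exists_eq_jpEven hZ
    rw [jpTheta_even_mul_even, ksgn_00, one_smul]
  · obtain ⟨a, b, c, d, rfl⟩ := exists_eq_jpEven hY
    obtain ⟨x, y, z, t, rfl⟩ := exists_eq_jpOdd hZ
    rw [jpTheta_even_mul_odd, ksgn_01, one_smul]
  · obtain ⟨a, b, c, d, rfl⟩ := exists_eq_jpEven hZ
    obtain ⟨x, y, z, t, rfl⟩ := exists_eq_jpOdd hY
    rw [(JP (Fin 2)).isJordan.comm 1 0 _ hY _ hZ, map_smul, jpTheta_even_mul_odd, ksgn_10,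
      one_smul, one_smul, add_comm]
  · obtain ⟨x, y, z, t, rfl⟩ := exists_eq_jpOdd hY
    obtain ⟨x', y', z', t', rfl⟩ := exists_eq_jpOdd hZ
    rw [jpTheta_odd_mul_odd, ksgn_11, neg_one_smul, ← sub_eq_add_neg]

lemma jpTheta_one : jpTheta (jpOne (Fin 2)) = (1 / 2 : ℂ) • 1 := by
  refine congrArg (fun M : Matrix (Fin 2 ⊕ Fin 2) (Fin 2 ⊕ Fin 2) ℂ[X] => (1 / 2 : ℂ) • M)
    ((wMat_apply 1).trans ?_)
  apply Matrix.ext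
  rintro (i | i) (j | j) <;> fin_cases i <;> fin_cases j <;> simp

section

variable {n : Type} [Fintype n] [DecidableEq n]

lemma polyMatAct_even_mem (N : PolyModGr) (A D : Matrix n n ℂ[X]) {j : ZMod 2}
    {v : n ⊕ n → N.obj.carrier} (hv : v ∈ columnGrading n N j) :
    polyMatAct n N (fromBlocks A 0 0 D) v ∈ columnGrading n N j := by
  refine ⟨fun k => ?_, fun k => ?_⟩ <;> rw [polyMatAct_apply, Fintype.sum_sum_type] <;>
    simp only [fromBlocks_apply₁₁, fromBlocks_apply₁₂, fromBlocks_apply₂₁, fromBlocks_apply₂₂,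
      Matrix.zero_apply, map_zero, LinearMap.zero_apply, Finset.sum_const_zero, add_zero, zero_add]
  · exact Submodule.sum_mem _ fun l _ => PolyModGr.act_mem N _ (hv.1 l)
  · exact Submodule.sum_mem _ fun l _ => PolyModGr.act_mem N _ (hv.2 l)

lemma polyMatAct_odd_mem (N : PolyModGr) (B C : Matrix n n ℂ[X]) {j : ZMod 2}
    {v : n ⊕ n → N.obj.carrier} (hv : v ∈ columnGrading n N j) :
    polyMatAct n N (fromBlocks 0 B C 0) v ∈ columnGrading n N (1 + j) := by
  refine ⟨fun k => ?_, fun k => ?_⟩ <;> rw [polyMatAct_apply, Fintype.sum_sum_type] <;>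
    simp only [fromBlocks_apply₁₁, fromBlocks_apply₁₂, fromBlocks_apply₂₁, fromBlocks_apply₂₂,
      Matrix.zero_apply, map_zero, LinearMap.zero_apply, Finset.sum_const_zero, add_zero, zero_add]
  · exact add_comm j 1 ▸ Submodule.sum_mem _ fun l _ => PolyModGr.act_mem N _ (hv.2 l)
  · have h : ∀ j : ZMod 2, 1 + j + 1 = j := by decide
    rw [h j]
    exact Submodule.sum_mem _ fun l _ => PolyModGr.act_mem N _ (hv.1 l)

end

lemma jpTheta_mem (N : PolyModGr) {i j : ZMod 2} {Y : (JP (Fin 2)).carrier}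
    (hY : Y ∈ (JP (Fin 2)).grading i) {v : Fin 2 ⊕ Fin 2 → N.obj.carrier}
    (hv : v ∈ columnGrading (Fin 2) N j) :
    polyMatAct (Fin 2) N (jpTheta Y) v ∈ columnGrading (Fin 2) N (i + j) := by
  rcases zmod2_cases i with rfl | rfl
  · obtain ⟨a, b, c, d, rfl⟩ := exists_eq_jpEven hY
    rw [jpTheta_jpEven, map_smul, zero_add]
    exact Submodule.smul_mem _ _ (polyMatAct_even_mem N _ _ hv)
  · obtain ⟨x, y, z, t, rfl⟩ := exists_eq_jpOdd hY
    rw [jpTheta_jpOdd, map_smul]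
    exact Submodule.smul_mem _ _ (polyMatAct_odd_mem N _ _ hv)

lemma isSpecialJP2_matRep (N : PolyModGr) : IsSpecialJP2 (matRep jpTheta N) := by
  rw [isSpecialJP2_iff]
  refine ⟨⟨fun i j Y hY v hv => jpTheta_mem N hY hv, fun i j Y hY Z hZ v => ?_⟩, ?_⟩
  · have key : ∀ v, polyMatAct (Fin 2) N (jpTheta ((JP (Fin 2)).mul Y Z)) v
        = polyMatAct (Fin 2) N (jpTheta Y) (polyMatAct (Fin 2) N (jpTheta Z) v)
          + ksgn i j • polyMatAct (Fin 2) N (jpTheta Z) (polyMatAct (Fin 2) N (jpTheta Y) v) := by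
      intro v
      rw [jpTheta_mul hY hZ, map_add, map_smul, LinearMap.add_apply, LinearMap.smul_apply,
        polyMatAct_mul, polyMatAct_mul]
    exact key v
  · change polyMatAct (Fin 2) N (jpTheta (jpOne (Fin 2))) = _
    rw [jpTheta_one, map_smul, polyMatAct_one]
    rfl

/-- The functor `N ↦ ℂ^{2|2} ⊗ N` from graded `ℂ[x]`-modules to special `JP(2)`-modules. -/
def jpFunctor : PolyModGr ⥤ JP2ModHalf where
  obj N := ⟨matRep jpTheta N, isSpecialJP2_matRep N⟩
  map f := ObjectProperty.homMk (matRepMap jpTheta f)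

instance : jpFunctor.Additive where

instance : jpFunctor.Linear ℂ where

instance : jpFunctor.Faithful where
  map_injective {N N'} f g h := by
    refine ObjectProperty.hom_ext _ (SuperRep.hom_ext (LinearMap.ext fun m => ?_))
    exact congrFun (LinearMap.congr_fun (congrArg (fun k => SuperRep.Hom.toLin k.hom) h)
      (fun _ => m)) (Sum.inl 0)

lemma adjoin_range_jpTheta : Algebra.adjoin ℂ (Set.range jpTheta) = ⊤ := by
  set S := Algebra.adjoin ℂ (Set.range jpTheta)
  have hE : ∀ a b c d : ℂ, evenMat (C a) (C b) (C c) (C d) ∈ S := by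
    intro a b c d
    have := S.smul_mem (Algebra.subset_adjoin ⟨jpEven a b c d, rfl⟩ : jpTheta _ ∈ S) 2
    rwa [jpTheta_jpEven, smul_smul, show (2 : ℂ) * (1 / 2) = 1 by norm_num, one_smul] at this
  have hO : ∀ x y z t : ℂ, oddMat X (C x) (C y) (C z) (C t) ∈ S := by
    intro x y z t
    have := S.smul_mem (Algebra.subset_adjoin ⟨jpOdd x y z t, rfl⟩ : jpTheta _ ∈ S) 2
    rwa [jpTheta_jpOdd, smul_smul, show (2 : ℂ) * (1 / 2) = 1 by norm_num, one_smul] at this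
  have e1 := hE 1 0 0 0
  have u := hE 0 1 0 0
  have w := hE 0 0 1 0
  have b1 := hO 1 0 0 0
  have b2 := hO 0 0 1 0
  have c := hO 0 0 0 1
  simp only [map_one, map_zero] at e1 u w b1 b2 c
  let v1 : Fin 2 ⊕ Fin 2 := Sum.inl 0
  have hp : Matrix.single v1 v1 (1 : ℂ[X]) ∈ S := by
    convert S.mul_mem (S.mul_mem e1 u) w using 1
    apply Matrix.ext
    rintro (i | i) (j | j) <;> fin_cases i <;> fin_cases j <;>
      simp [evenMat, Matrix.mul_apply, v1]
  have hcol : ∀ k, Matrix.single k v1 (1 : ℂ[X]) ∈ S := by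
    have h2 : Matrix.single (Sum.inl 1) v1 (1 : ℂ[X]) ∈ S := by
      convert S.mul_mem w hp using 1
      apply Matrix.ext
      rintro (i | i) (j | j) <;> fin_cases i <;> fin_cases j <;>
        simp [evenMat, Matrix.mul_apply, Matrix.single_apply, v1]
    rintro (k | k) <;> fin_cases k
    · exact hp
    · exact h2
    · convert S.mul_mem c h2 using 1
      apply Matrix.ext
      rintro (i | i) (j | j) <;> fin_cases i <;> fin_cases j <;>
        simp [oddMat, Matrix.mul_apply, Matrix.single_apply, v1]
    · convert S.neg_mem (S.mul_mem c hp) using 1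
      apply Matrix.ext
      rintro (i | i) (j | j) <;> fin_cases i <;> fin_cases j <;>
        simp [oddMat, Matrix.mul_apply, Matrix.single_apply, v1]
  have hrow : ∀ k, Matrix.single v1 k (1 : ℂ[X]) ∈ S := by
    have h2 : Matrix.single v1 (Sum.inl 1) (1 : ℂ[X]) ∈ S := by
      convert S.mul_mem hp u using 1
      apply Matrix.ext
      rintro (i | i) (j | j) <;> fin_cases i <;> fin_cases j <;>
        simp [evenMat, Matrix.mul_apply, Matrix.single_apply, v1]
    rintro (k | k) <;> fin_cases k
    · exact hp
    · exact h2
    · convert S.mul_mem hp b1 using 1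
      apply Matrix.ext
      rintro (i | i) (j | j) <;> fin_cases i <;> fin_cases j <;>
        simp [oddMat, Matrix.mul_apply, Matrix.single_apply, v1]
    · convert S.mul_mem h2 b2 using 1
      apply Matrix.ext
      rintro (i | i) (j | j) <;> fin_cases i <;> fin_cases j <;>
        simp [oddMat, Matrix.mul_apply, Matrix.single_apply, v1]
  have hx : Matrix.scalar (Fin 2 ⊕ Fin 2) (X : ℂ[X]) ∈ S := by
    convert S.neg_mem (S.mul_mem c c) using 1
    apply Matrix.ext
    rintro (i | i) (j | j) <;> fin_cases i <;> fin_cases j <;>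
      simp [oddMat, Matrix.mul_apply]
  have hscalar : ∀ p : ℂ[X], Matrix.scalar (Fin 2 ⊕ Fin 2) p ∈ S := by
    intro p
    induction p using Polynomial.induction_on' with
    | add p q hp hq => rw [map_add]; exact S.add_mem hp hq
    | monomial n a =>
      rw [← C_mul_X_pow_eq_monomial, map_mul, map_pow]
      refine S.mul_mem ?_ (S.pow_mem hx n)
      exact S.algebraMap_mem a
  rw [eq_top_iff]
  intro M _
  rw [Matrix.matrix_eq_sum_single M]
  refine S.sum_mem fun k _ => S.sum_mem fun l _ => ?_
  have := S.mul_mem (hscalar (M k l)) (S.mul_mem (hcol k) (hrow l))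
  rw [Matrix.single_mul_single_same, one_mul] at this
  convert this using 1
  apply Matrix.ext
  intro i j
  simp [Matrix.single_apply]

instance : jpFunctor.Full where
  map_surjective {N N'} g := by
    obtain ⟨f, hf⟩ := exists_matRepMap_eq adjoin_range_jpTheta g.hom
    exact ⟨f, ObjectProperty.hom_ext _ hf⟩

/-! ### Every special `JP(2)`-module is of the form `ℂ^{2|2} ⊗ N` -/

lemma jpEven_eq (a b c d : ℂ) : jpEven a b c d = a • jpEven 1 0 0 0 + b • jpEven 0 1 0 0
    + c • jpEven 0 0 1 0 + d • (jpOne (Fin 2) - jpEven 1 0 0 0) := by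
  refine Subtype.ext (Matrix.ext ?_)
  change ∀ i j, evenMat a b c d i j = (a • evenMat 1 0 0 0 + b • evenMat 0 1 0 0
    + c • evenMat 0 0 1 0 + d • (1 - evenMat 1 0 0 0) : SMat (Fin 2)) i j
  rintro (i | i) (j | j) <;> fin_cases i <;> fin_cases j <;> simp [evenMat]

lemma jpOdd_eq (x y z t : ℂ) : jpOdd x y z t = x • jpOdd 1 0 0 0 + y • jpOdd 0 1 0 0
    + z • jpOdd 0 0 1 0 + t • jpOdd 0 0 0 1 := by
  refine Subtype.ext (Matrix.ext ?_)
  change ∀ i j, oddMat 0 x y z t i j = (x • oddMat 0 1 0 0 0 + y • oddMat 0 0 1 0 0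
    + z • oddMat 0 0 0 1 0 + t • oddMat 0 0 0 0 1 : SMat (Fin 2)) i j
  rintro (i | i) (j | j) <;> fin_cases i <;> fin_cases j <;> simp [oddMat]

/-- Relations between the operators `e = E₁₁`, `u = E₁₂`, `w = E₂₁` (even) and `p = (E₁₁, 0)`,
`q = (E₂₂, 0)`, `m = (E₁₂ + E₂₁, 0)`, `c = (0, E₁₂ - E₂₁)` (odd) of a special module. -/
structure JPRelations {R : Type*} [Ring R] (e u w p q m c : R) : Prop where
  ee : e * e = e
  eu : e * u = u - u * e
  ew : e * w = w - w * e
  uu : u * u = 0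
  ww : w * w = 0
  uw : u * w = 1 - w * u
  ep : e * p = p
  pe : p * e = p
  eq : e * q = 0
  qe : q * e = 0
  up : u * p = 0
  pu : p * u = 0
  wq : w * q = 0
  qw : q * w = 0
  wp : m = w * p + p * w
  uq : m = u * q + q * u
  ec : e * c = c - c * e
  uc : u * c = -(c * u)
  wc : w * c = -(c * w)
  pc : p * c = u + c * p
  qc : q * c = c * q - w
  mc : m * c = 1 - 2 * e + c * m

lemma JPRelations.of_super {R : Type*} [Ring R] [Algebra ℂ R] {e u w p q m c : R}
    (hee : e * e + e * e = (2 : ℂ) • e) (heu : e * u + u * e = u) (hew : e * w + w * e = w)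
    (huu : u * u + u * u = 0) (hww : w * w + w * w = 0) (huw : u * w + w * u = 1)
    (hep : e * p + p * e = (2 : ℂ) • p) (heq : e * q + q * e = 0) (hec : e * c + c * e = c)
    (hup : u * p + p * u = 0) (huq : u * q + q * u = m) (huc : u * c + c * u = 0)
    (hwp : w * p + p * w = m) (hwq : w * q + q * w = 0) (hwc : w * c + c * w = 0)
    (hpc : p * c - c * p = u) (hqc : q * c - c * q = -w) (hmc : m * c - c * m = 1 - (2 : ℂ) • e) :
    JPRelations e u w p q m c := by
  have half : ∀ x y : R, x + x = y + y → x = y := by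
    intro x y h
    have := congrArg (fun z => (1 / 2 : ℂ) • z) h
    simpa [← two_smul ℂ, smul_smul] using this
  have ee : e * e = e := half _ _ (by rw [hee, two_smul])
  have ep : e * p = p := by
    have h1 := congrArg (e * ·) hep
    simp only [mul_add, ← mul_assoc, ee, mul_smul_comm] at h1
    have h2 : e * p * e = e * p := by
      rw [two_smul] at h1
      exact add_left_cancel h1
    have h3 := congrArg (· * e) hep
    simp only [add_mul, mul_assoc, ee, smul_mul_assoc] at h3
    rw [← mul_assoc, h2, two_smul] at h3
    have h4 : e * p = p * e := add_right_cancel h3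
    rw [← h4, two_smul] at hep
    exact half _ _ hep
  have pe : p * e = p := by
    rw [ep, two_smul] at hep
    exact add_left_cancel hep
  have eq' : e * q = 0 := by
    have h1 := congrArg (e * ·) heq
    simp only [mul_add, ← mul_assoc, ee, mul_zero] at h1
    have h2 := congrArg (· * e) heq
    simp only [add_mul, mul_assoc, ee, zero_mul] at h2
    have h3 : e * q = q * e := by
      rw [← mul_assoc] at h2
      exact add_right_cancel ((h1.trans h2.symm).trans (add_comm _ _))
    rw [← h3] at heq
    exact half _ _ (by rw [heq, add_zero])
  have qe : q * e = 0 := by rw [eq', zero_add] at heq; exact heq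
  have eu : e * u = u - u * e := eq_sub_of_add_eq heu
  have ew : e * w = w - w * e := eq_sub_of_add_eq hew
  have up : u * p = 0 := by
    have h : p * u = -(u * p) := eq_neg_of_add_eq_zero_right hup
    have h2 : e * (p * u) = p * u := by rw [← mul_assoc, ep]
    rw [h, mul_neg, neg_inj, ← mul_assoc, eu, sub_mul, mul_assoc, ep, sub_self] at h2
    exact h2.symm
  have wq : w * q = 0 := by
    have h : w * q = -(q * w) := eq_neg_of_add_eq_zero_left hwq
    have h2 : e * (w * q) = w * q := by rw [← mul_assoc, ew, sub_mul, mul_assoc, eq', mul_zero, sub_zero]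
    rw [← h2, h, mul_neg, ← mul_assoc, eq', zero_mul, neg_zero]
  exact
    { ee := ee
      eu := eu
      ew := ew
      uu := half _ _ (by rw [huu, add_zero])
      ww := half _ _ (by rw [hww, add_zero])
      uw := eq_sub_of_add_eq huw
      ep := ep
      pe := pe
      eq := eq'
      qe := qe
      up := up
      pu := by rw [up, zero_add] at hup; exact hup
      wq := wq
      qw := by rw [wq, zero_add] at hwq; exact hwq
      wp := hwp.symm
      uq := huq.symm
      ec := eq_sub_of_add_eq hec
      uc := eq_neg_of_add_eq_zero_left huc
      wc := eq_neg_of_add_eq_zero_left hwc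
      pc := by rw [← hpc]; abel
      qc := by rw [sub_eq_iff_eq_add.1 hqc]; abel
      mc := by rw [sub_eq_iff_eq_add.1 hmc, two_smul, two_mul] }

section

variable (V : SuperRep (JP (Fin 2)).carrier)

/-- The operator of `a` in the homomorphism of Jordan superalgebras of a special module. -/
def specialOp : (JP (Fin 2)).carrier →ₗ[ℂ] Module.End ℂ V.carrier := (2 : ℂ) • V.act

lemma specialOp_apply (a : (JP (Fin 2)).carrier) : specialOp V a = (2 : ℂ) • V.act a := rfl

lemma act_eq_specialOp (a : (JP (Fin 2)).carrier) : V.act a = (1 / 2 : ℂ) • specialOp V a := by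
  rw [specialOp_apply, smul_smul]
  norm_num

variable {V}

lemma specialOp_mul (h : IsSpecialAction V) {i j : ZMod 2} {a b : (JP (Fin 2)).carrier}
    (ha : a ∈ (JP (Fin 2)).grading i) (hb : b ∈ (JP (Fin 2)).grading j) :
    specialOp V a * specialOp V b + ksgn i j • (specialOp V b * specialOp V a)
      = (2 : ℂ) • specialOp V ((JP (Fin 2)).mul a b) := by
  refine LinearMap.ext fun v => ?_
  simp only [specialOp_apply, LinearMap.add_apply, LinearMap.smul_apply, Module.End.mul_apply,
    map_smul, h.2 i j a ha b hb]
  module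

lemma jpRelations (h : IsSpecialJP2 V) :
    JPRelations (specialOp V (jpEven 1 0 0 0)) (specialOp V (jpEven 0 1 0 0))
      (specialOp V (jpEven 0 0 1 0)) (specialOp V (jpOdd 1 0 0 0)) (specialOp V (jpOdd 0 0 1 0))
      (specialOp V (jpOdd 0 1 0 0)) (specialOp V (jpOdd 0 0 0 1)) := by
  obtain ⟨hs, h1⟩ := (isSpecialJP2_iff V).1 h
  have hone : specialOp V (jpOne (Fin 2)) = 1 := by
    rw [specialOp_apply, h1, smul_smul]
    norm_num
    rfl
  have hEE : ∀ a b c d a' b' c' d', _ := fun a b c d a' b' c' d' =>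
    specialOp_mul hs (jpEven_mem a b c d) (jpEven_mem a' b' c' d')
  have hEO : ∀ a b c d a' b' c' d', _ := fun a b c d a' b' c' d' =>
    specialOp_mul hs (jpEven_mem a b c d) (jpOdd_mem a' b' c' d')
  have hOO : ∀ a b c d a' b' c' d', _ := fun a b c d a' b' c' d' =>
    specialOp_mul hs (jpOdd_mem a b c d) (jpOdd_mem a' b' c' d')
  simp only [jpEven_mul_jpEven, jpEven_mul_jpOdd, jpOdd_mul_jpOdd, ksgn_00, ksgn_01, ksgn_11,
    one_smul, neg_one_smul, ← sub_eq_add_neg, map_smul, smul_smul] at hEE hEO hOO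
  have h2 : (2 : ℂ) * (1 / 2) = 1 := by norm_num
  simp only [h2, one_smul] at hEE hEO hOO
  apply JPRelations.of_super
  · rw [hEE, jpEven_eq]; simp
  · rw [hEE, jpEven_eq]; simp
  · rw [hEE, jpEven_eq]; simp
  · rw [hEE, jpEven_eq]; simp
  · rw [hEE, jpEven_eq]; simp
  · rw [hEE, jpEven_eq]; simp [hone]
  · rw [hEO, jpOdd_eq]; simp
  · rw [hEO, jpOdd_eq]; simp
  · rw [hEO, jpOdd_eq]; simp
  · rw [hEO, jpOdd_eq]; simp
  · rw [hEO, jpOdd_eq]; simp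
  · rw [hEO, jpOdd_eq]; simp
  · rw [hEO, jpOdd_eq]; simp
  · rw [hEO, jpOdd_eq]; simp
  · rw [hEO, jpOdd_eq]; simp
  · rw [hOO, jpEven_eq]; simp
  · rw [hOO, jpEven_eq]; simp
  · rw [hOO, jpEven_eq]; simp [hone]; module

end

section Primitive

variable {V : Type} [AddCommGroup V] [Module ℂ V] {e u w p q m c : Module.End ℂ V}

/-- The vectors corresponding to the first even basis vector of `ℂ^{2|2}`. -/
def primitivePart (e u : Module.End ℂ V) : Submodule ℂ V :=
  LinearMap.eqLocus e LinearMap.id ⊓ LinearMap.ker u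

lemma mem_primitivePart {v : V} : v ∈ primitivePart e u ↔ e v = v ∧ u v = 0 := Iff.rfl

/-- The vector with the given coordinates with respect to the basis of `ℂ^{2|2}`. -/
def fromColumn (e u w c : Module.End ℂ V) :
    (Fin 2 ⊕ Fin 2 → primitivePart e u) →ₗ[ℂ] V :=
  (primitivePart e u).subtype ∘ₗ LinearMap.proj (Sum.inl 0)
  + w ∘ₗ (primitivePart e u).subtype ∘ₗ LinearMap.proj (Sum.inl 1)
  + c ∘ₗ w ∘ₗ (primitivePart e u).subtype ∘ₗ LinearMap.proj (Sum.inr 0)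
  - c ∘ₗ (primitivePart e u).subtype ∘ₗ LinearMap.proj (Sum.inr 1)

lemma fromColumn_apply (n : Fin 2 ⊕ Fin 2 → primitivePart e u) :
    fromColumn e u w c n = (n (Sum.inl 0) : V) + w (n (Sum.inl 1)) + c (w (n (Sum.inr 0)))
      - c (n (Sum.inr 1)) := rfl

namespace JPRelations

variable (h : JPRelations e u w p q m c)
include h

lemma sq_mem {v : V} (hv : v ∈ primitivePart e u) : (-(c * c)) v ∈ primitivePart e u := by
  have h1 : e * (c * c) = c * c * e := by
    rw [← mul_assoc, h.ec, sub_mul, mul_assoc c e c, h.ec, mul_sub]; noncomm_ring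
  have h2 : u * (c * c) = c * c * u := by
    rw [← mul_assoc, h.uc, neg_mul, mul_assoc c u c, h.uc]; noncomm_ring
  have h1' : e (c (c v)) = c (c (e v)) := LinearMap.congr_fun h1 v
  have h2' : u (c (c v)) = c (c (u v)) := LinearMap.congr_fun h2 v
  rw [mem_primitivePart] at hv ⊢
  simp [h1', h2', hv.1, hv.2]

lemma apply_column {v : V} (hv : v ∈ primitivePart e u) :
    (e v = v ∧ e (w v) = 0 ∧ e (c (w v)) = c (w v) ∧ e (c v) = 0) ∧
    (u v = 0 ∧ u (w v) = v ∧ u (c (w v)) = -c v ∧ u (c v) = 0) ∧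
    (w (w v) = 0 ∧ w (c (w v)) = 0 ∧ w (c v) = -c (w v)) ∧
    (p v = 0 ∧ p (w v) = 0 ∧ p (c (w v)) = v ∧ p (c v) = 0) ∧
    (q v = 0 ∧ q (w v) = 0 ∧ q (c (w v)) = 0 ∧ q (c v) = -w v) ∧
    (m v = 0 ∧ m (w v) = 0 ∧ m (c (w v)) = w v ∧ m (c v) = -v) ∧
    (c (c (w v)) = w (c (c v))) := by
  obtain ⟨he, hu⟩ := mem_primitivePart.1 hv
  have ew : ∀ v, e (w v) = w v - w (e v) := LinearMap.congr_fun h.ew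
  have ww : ∀ v, w (w v) = 0 := LinearMap.congr_fun h.ww
  have uw : ∀ v, u (w v) = v - w (u v) := LinearMap.congr_fun h.uw
  have pe : ∀ v, p (e v) = p v := LinearMap.congr_fun h.pe
  have qe : ∀ v, q (e v) = 0 := LinearMap.congr_fun h.qe
  have pu : ∀ v, p (u v) = 0 := LinearMap.congr_fun h.pu
  have qw : ∀ v, q (w v) = 0 := LinearMap.congr_fun h.qw
  have wp : ∀ v, m v = w (p v) + p (w v) := LinearMap.congr_fun h.wp
  have ec : ∀ v, e (c v) = c v - c (e v) := LinearMap.congr_fun h.ec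
  have uc : ∀ v, u (c v) = -c (u v) := LinearMap.congr_fun h.uc
  have wc : ∀ v, w (c v) = -c (w v) := LinearMap.congr_fun h.wc
  have pc : ∀ v, p (c v) = u v + c (p v) := LinearMap.congr_fun h.pc
  have qc : ∀ v, q (c v) = c (q v) - w v := LinearMap.congr_fun h.qc
  have mc : ∀ v, m (c v) = v - (2 : ℂ) • e v + c (m v) := by
    intro v
    have := LinearMap.congr_fun h.mc v
    rw [two_mul] at this
    rw [two_smul]
    exact this
  have e2 : e (w v) = 0 := by rw [ew, he, sub_self]
  have u2 : u (w v) = v := by rw [uw, hu, map_zero, sub_zero]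
  have p1 : p v = 0 := by rw [← u2, pu]
  have p2 : p (w v) = 0 := by rw [← pe, e2, map_zero]
  have q1 : q v = 0 := by rw [← he, qe]
  have m1 : m v = 0 := by rw [wp, p1, p2, map_zero, add_zero]
  have m2 : m (w v) = 0 := by rw [wp, p2, ww, map_zero, map_zero, add_zero]
  refine ⟨⟨he, e2, ?_, ?_⟩, ⟨hu, u2, ?_, ?_⟩, ⟨ww v, ?_, wc v⟩, ⟨p1, p2, ?_, ?_⟩,
    ⟨q1, qw v, ?_, ?_⟩, ⟨m1, m2, ?_, ?_⟩, ?_⟩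
  · rw [ec, e2, map_zero, sub_zero]
  · rw [ec, he, sub_self]
  · rw [uc, u2]
  · rw [uc, hu, map_zero, neg_zero]
  · rw [wc, ww, map_zero, neg_zero]
  · rw [pc, p2, u2, map_zero, add_zero]
  · rw [pc, p1, hu, map_zero, add_zero]
  · rw [qc, qw, ww, map_zero, sub_zero]
  · rw [qc, q1, map_zero, zero_sub]
  · rw [mc, e2, m2, map_zero, smul_zero, sub_zero, add_zero]
  · rw [mc, he, m1, map_zero, add_zero, two_smul]; abel
  · rw [wc, wc, map_neg, neg_neg]

lemma fromColumn_injective : Function.Injective (fromColumn e u w c) := by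
  rw [injective_iff_map_eq_zero]
  intro n hn
  rw [fromColumn_apply] at hn
  obtain ⟨⟨-, -, -, -⟩, ⟨u1, -, -, -⟩, -, ⟨p1, -, -, -⟩, ⟨q1, -, -, -⟩, ⟨m1, -, -, -⟩, -⟩ :=
    h.apply_column (n (Sum.inl 0)).2
  obtain ⟨⟨-, -, -, -⟩, ⟨-, u2, -, -⟩, -, ⟨-, p2, -, -⟩, ⟨-, q2, -, -⟩, ⟨-, m2, -, -⟩, -⟩ :=
    h.apply_column (n (Sum.inl 1)).2
  obtain ⟨⟨-, -, -, -⟩, ⟨-, -, u3, -⟩, -, ⟨-, -, p3, -⟩, ⟨-, -, q3, -⟩, ⟨-, -, m3, -⟩, -⟩ :=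
    h.apply_column (n (Sum.inr 0)).2
  obtain ⟨⟨-, -, -, -⟩, ⟨-, -, -, u4⟩, -, ⟨-, -, -, p4⟩, ⟨-, -, -, q4⟩, ⟨-, -, -, m4⟩, -⟩ :=
    h.apply_column (n (Sum.inr 1)).2
  have z3 : (n (Sum.inr 0) : V) = 0 := by
    have := congrArg p hn
    simpa [p1, p2, p3, p4] using this
  have z4 : (n (Sum.inr 1) : V) = 0 := by
    have := congrArg m hn
    simpa [m1, m2, m3, m4, z3] using this
  have z2 : (n (Sum.inl 1) : V) = 0 := by
    have := congrArg u hn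
    simpa [u1, u2, u3, u4, z3] using this
  have z1 : (n (Sum.inl 0) : V) = 0 := by
    simpa [z2, z3, z4] using hn
  ext (k | k) <;> fin_cases k
  exacts [z1, z2, z3, z4]

lemma fromColumn_surjective : Function.Surjective (fromColumn e u w c) := by
  intro v
  have hm : ∀ a : Module.End ℂ V, e * a = a → u * a = 0 → a v ∈ primitivePart e u :=
    fun a h1 h2 => ⟨LinearMap.congr_fun h1 v, LinearMap.congr_fun h2 v⟩
  have h1 : e * (u * w * e) = u * w * e := by
    rw [← mul_assoc, ← mul_assoc, h.eu, sub_mul, sub_mul, mul_assoc u e w, h.ew, mul_sub, sub_mul,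
      mul_assoc u (w * e) e, mul_assoc w e e, h.ee, mul_assoc u w e, sub_self, sub_zero]
  have h2 : e * (e * u) = e * u := by rw [← mul_assoc, h.ee]
  have h2' : u * (e * u) = 0 := by
    rw [h.eu, mul_sub, ← mul_assoc, h.uu, zero_mul, sub_zero]
  have h4 : e * (u * q) = u * q := by
    rw [← mul_assoc, h.eu, sub_mul, mul_assoc u e q, h.eq, mul_zero, sub_zero]
  have key : u * w * e + w * (e * u) + c * (w * p) - c * (u * q) = 1 := by
    have k1 : c * (w * p) = w * u * e := by
      have : w * u = w * p * c + c * (w * p) := by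
        rw [← mul_assoc c w p, ← neg_eq_iff_eq_neg.2 h.wc, neg_mul, mul_assoc w c p,
          ← sub_eq_add_neg, mul_assoc w p c, ← mul_sub, h.pc, add_sub_cancel_right]
      rw [this, add_mul, mul_assoc c, mul_assoc w p e, h.pe, mul_assoc (w * p),
        ← sub_eq_iff_eq_add'.2 (eq_sub_iff_add_eq.1 h.ec).symm]
      simp only [mul_sub, mul_assoc]
      rw [← mul_assoc p e c, h.pe, sub_self, zero_add]
    have k2 : c * (u * q) = -(u * w * (1 - e)) := by
      have : u * w = u * c * q - u * q * c := by
        rw [mul_assoc u c q, mul_assoc u q c, ← mul_sub, h.qc]; noncomm_ring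
      have hce : c * (1 - e) = e * c := by rw [h.ec]; noncomm_ring
      rw [this, sub_mul, mul_assoc (u * q) c, hce, mul_assoc u q, ← mul_assoc q e c, h.qe,
        zero_mul, mul_zero, sub_zero, h.uc, mul_assoc, mul_sub, h.qe, mul_one, sub_zero]
      noncomm_ring
    rw [k1, k2, h.eu, mul_sub, ← mul_assoc w u e, h.uw]
    noncomm_ring
  refine ⟨Sum.elim ![⟨(u * w * e) v, hm _ h1 (by rw [← mul_assoc, ← mul_assoc, h.uu]; simp)⟩,
      ⟨(e * u) v, hm _ h2 h2'⟩]
    ![⟨p v, hm _ h.ep h.up⟩, ⟨(u * q) v, hm _ h4 (by rw [← mul_assoc, h.uu, zero_mul])⟩], ?_⟩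
  rw [fromColumn_apply]
  exact LinearMap.congr_fun key v

end JPRelations

end Primitive

lemma PolyModGr.act_C (N : PolyModGr) (a : ℂ) (v : N.obj.carrier) : N.obj.act (C a) v = a • v := by
  rw [← mul_one (C a), ← smul_eq_C_mul, map_smul, N.property.1]
  rfl

lemma polyMatAct_evenMat (N : PolyModGr) (a b c d : ℂ) (n : Fin 2 ⊕ Fin 2 → N.obj.carrier) :
    polyMatAct (Fin 2) N (evenMat (C a) (C b) (C c) (C d)) n
      = Sum.elim ![a • n (Sum.inl 0) + b • n (Sum.inl 1), c • n (Sum.inl 0) + d • n (Sum.inl 1)]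
        ![a • n (Sum.inr 0) + c • n (Sum.inr 1), b • n (Sum.inr 0) + d • n (Sum.inr 1)] := by
  ext (k | k) : 1 <;> rw [polyMatAct_apply, Fintype.sum_sum_type, Fin.sum_univ_two,
    Fin.sum_univ_two] <;> fin_cases k <;> simp [evenMat, PolyModGr.act_C]

lemma polyMatAct_oddMat (N : PolyModGr) (x y z t : ℂ) (n : Fin 2 ⊕ Fin 2 → N.obj.carrier) :
    polyMatAct (Fin 2) N (oddMat X (C x) (C y) (C z) (C t)) n
      = Sum.elim ![x • n (Sum.inr 0) + (y • n (Sum.inr 1) + t • N.obj.act X (n (Sum.inr 1))),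
          (y • n (Sum.inr 0) - t • N.obj.act X (n (Sum.inr 0))) + z • n (Sum.inr 1)]
        ![t • n (Sum.inl 1), -(t • n (Sum.inl 0))] := by
  ext (k | k) : 1 <;> rw [polyMatAct_apply, Fintype.sum_sum_type, Fin.sum_univ_two,
    Fin.sum_univ_two] <;> fin_cases k <;>
    simp [oddMat, PolyModGr.act_C, mul_comm X (C t), PolyModGr.act_mul]

section

variable {V : SuperRep (JP (Fin 2)).carrier}

lemma specialOp_mem (h : IsSpecialAction V) {i j : ZMod 2} {a : (JP (Fin 2)).carrier}
    (ha : a ∈ (JP (Fin 2)).grading i) {v : V.carrier} (hv : v ∈ V.grading j) :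
    specialOp V a v ∈ V.grading (i + j) :=
  Submodule.smul_mem _ _ (h.1 i j a ha v hv)

variable (V) in
/-- The space of primitive vectors of a special module. -/
def primitive : Submodule ℂ V.carrier :=
  primitivePart (specialOp V (jpEven 1 0 0 0)) (specialOp V (jpEven 0 1 0 0))

lemma parityProj_mem_primitive (h : IsSpecialAction V) (i : ZMod 2) {v : V.carrier}
    (hv : v ∈ primitive V) : parityProj V.isInternal i v ∈ primitive V := by
  have key : ∀ a b c d : ℂ, parityProj V.isInternal i (specialOp V (jpEven a b c d) v)
      = specialOp V (jpEven a b c d) (parityProj V.isInternal i v) := by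
    intro a b c d
    simpa using parityProj_map V.isInternal V.isInternal (d := 0)
      (fun i v hv => specialOp_mem h (jpEven_mem a b c d) hv) i v
  obtain ⟨h1, h2⟩ := mem_primitivePart.1 hv
  exact mem_primitivePart.2 ⟨(key _ _ _ _).symm.trans (congrArg _ h1),
    (key _ _ _ _).symm.trans ((congrArg _ h2).trans (map_zero _))⟩

/-- The graded `ℂ[x]`-module of primitive vectors: `x` acts as `-c²` for the odd element
`c = E₁₂ - E₂₁` of the lower left block. -/
def primitiveModule (h : IsSpecialJP2 V) : PolyModGr :=
  PolyModGr.ofEnd (N := primitive V) (fun i => (V.grading i).comap (primitive V).subtype)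
    (isInternal_comap_of_stable V.isInternal _
      fun i _ hv => parityProj_mem_primitive ((isSpecialJP2_iff V).1 h).1 i hv)
    ((-(specialOp V (jpOdd 0 0 0 1) * specialOp V (jpOdd 0 0 0 1))).restrict
      fun _ hv => (jpRelations h).sq_mem hv)
    (by
      intro i v hv
      have hs := ((isSpecialJP2_iff V).1 h).1
      have h1 := specialOp_mem hs (jpOdd_mem 0 0 0 1) (specialOp_mem hs (jpOdd_mem 0 0 0 1) hv)
      rw [← add_assoc, show (1 : ZMod 2) + 1 = 0 from rfl, zero_add] at h1
      exact Submodule.neg_mem _ h1)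

/-- The action of `x` on primitive vectors. -/
def primitiveX (h : IsSpecialJP2 V) : primitive V →ₗ[ℂ] primitive V := (primitiveModule h).obj.act X

lemma primitiveX_apply (h : IsSpecialJP2 V) (v : primitive V) :
    (primitiveX h v : V.carrier)
      = -specialOp V (jpOdd 0 0 0 1) (specialOp V (jpOdd 0 0 0 1) v) :=
  congrArg Subtype.val (LinearMap.congr_fun (PolyModGr.ofEnd_act_X _ _ _ _) v)

/-- Coordinates on a special module. -/
def columnMap (V : SuperRep (JP (Fin 2)).carrier) : (Fin 2 ⊕ Fin 2 → primitive V) →ₗ[ℂ] V.carrier :=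
  fromColumn (specialOp V (jpEven 1 0 0 0)) (specialOp V (jpEven 0 1 0 0))
    (specialOp V (jpEven 0 0 1 0)) (specialOp V (jpOdd 0 0 0 1))

lemma columnMap_apply (n : Fin 2 ⊕ Fin 2 → primitive V) : columnMap V n
    = (n (Sum.inl 0) : V.carrier) + specialOp V (jpEven 0 0 1 0) (n (Sum.inl 1))
      + specialOp V (jpOdd 0 0 0 1) (specialOp V (jpEven 0 0 1 0) (n (Sum.inr 0)))
      - specialOp V (jpOdd 0 0 0 1) (n (Sum.inr 1)) := rfl

lemma columnMap_bijective (h : IsSpecialJP2 V) : Function.Bijective (columnMap V) :=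
  ⟨(jpRelations h).fromColumn_injective, (jpRelations h).fromColumn_surjective⟩

lemma columnMap_mem (h : IsSpecialJP2 V) (i : ZMod 2)
    {n : Fin 2 ⊕ Fin 2 → primitive V} (hn : n ∈ columnGrading (Fin 2) (primitiveModule h) i) :
    columnMap V n ∈ V.grading i := by
  have hs := ((isSpecialJP2_iff V).1 h).1
  have h1 : ∀ k, (n (Sum.inl k) : V.carrier) ∈ V.grading i := fun k => hn.1 k
  have h2 : ∀ k, (n (Sum.inr k) : V.carrier) ∈ V.grading (i + 1) := fun k => hn.2 k
  have h3 : ∀ v ∈ V.grading (i + 1), specialOp V (jpOdd 0 0 0 1) v ∈ V.grading i := by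
    intro v hv
    have := specialOp_mem hs (jpOdd_mem 0 0 0 1) hv
    rwa [show ∀ i : ZMod 2, 1 + (i + 1) = i by decide] at this
  have h4 : ∀ j, ∀ v ∈ V.grading j, specialOp V (jpEven 0 0 1 0) v ∈ V.grading j := by
    intro j v hv
    have := specialOp_mem hs (jpEven_mem 0 0 1 0) hv
    rwa [zero_add] at this
  exact Submodule.sub_mem _ (Submodule.add_mem _ (Submodule.add_mem _ (h1 0) (h4 _ _ (h1 1)))
    (h3 _ (h4 _ _ (h2 0)))) (h3 _ (h2 1))

lemma columnMap_specialOp_even (h : IsSpecialJP2 V) (a b c d : ℂ)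
    (n : Fin 2 ⊕ Fin 2 → primitive V) :
    columnMap V (polyMatAct (Fin 2) (primitiveModule h) (evenMat (C a) (C b) (C c) (C d)) n)
      = specialOp V (jpEven a b c d) (columnMap V n) := by
  have hone : specialOp V (jpOne (Fin 2)) = 1 := by
    rw [specialOp_apply, h.2, smul_smul]
    norm_num
    rfl
  obtain ⟨⟨e1, -, -, -⟩, ⟨u1, -, -, -⟩, -, -⟩ :=
    (jpRelations h).apply_column (n (Sum.inl 0)).2
  obtain ⟨⟨-, e2, -, -⟩, ⟨-, u2, -, -⟩, ⟨w2, -, -⟩, -⟩ :=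
    (jpRelations h).apply_column (n (Sum.inl 1)).2
  obtain ⟨⟨-, -, e3, -⟩, ⟨-, -, u3, -⟩, ⟨-, w3, -⟩, -⟩ :=
    (jpRelations h).apply_column (n (Sum.inr 0)).2
  obtain ⟨⟨-, -, -, e4⟩, ⟨-, -, -, u4⟩, ⟨-, -, w4⟩, -⟩ :=
    (jpRelations h).apply_column (n (Sum.inr 1)).2
  refine (congrArg (columnMap V) (polyMatAct_evenMat (primitiveModule h) a b c d n)).trans ?_
  refine (columnMap_apply (Sum.elim ![a • n (Sum.inl 0) + b • n (Sum.inl 1),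
    c • n (Sum.inl 0) + d • n (Sum.inl 1)]
    ![a • n (Sum.inr 0) + c • n (Sum.inr 1), b • n (Sum.inr 0) + d • n (Sum.inr 1)])).trans ?_
  rw [columnMap_apply, jpEven_eq a b c d]
  simp only [Sum.elim_inl, Sum.elim_inr, Matrix.cons_val_zero,
    Matrix.cons_val_one, map_add, map_sub, map_smul, LinearMap.add_apply, LinearMap.sub_apply,
    LinearMap.smul_apply, Submodule.coe_add, Submodule.coe_smul, hone, Module.End.one_apply,
    e1, e2, e3, e4, u1, u2, u3, u4, w2, w3, w4]
  module

lemma columnMap_specialOp_odd (h : IsSpecialJP2 V) (x y z t : ℂ)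
    (n : Fin 2 ⊕ Fin 2 → primitive V) :
    columnMap V (polyMatAct (Fin 2) (primitiveModule h) (oddMat X (C x) (C y) (C z) (C t)) n)
      = specialOp V (jpOdd x y z t) (columnMap V n) := by
  obtain ⟨-, -, -, ⟨p1, -, -, -⟩, ⟨q1, -, -, -⟩, ⟨m1, -, -, -⟩, -⟩ :=
    (jpRelations h).apply_column (n (Sum.inl 0)).2
  obtain ⟨-, -, -, ⟨-, p2, -, -⟩, ⟨-, q2, -, -⟩, ⟨-, m2, -, -⟩, -⟩ :=
    (jpRelations h).apply_column (n (Sum.inl 1)).2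
  obtain ⟨-, -, -, ⟨-, -, p3, -⟩, ⟨-, -, q3, -⟩, ⟨-, -, m3, -⟩, s3⟩ :=
    (jpRelations h).apply_column (n (Sum.inr 0)).2
  obtain ⟨-, -, -, ⟨-, -, -, p4⟩, ⟨-, -, -, q4⟩, ⟨-, -, -, m4⟩, -⟩ :=
    (jpRelations h).apply_column (n (Sum.inr 1)).2
  refine (congrArg (columnMap V) (polyMatAct_oddMat (primitiveModule h) x y z t n)).trans ?_
  refine (columnMap_apply (Sum.elim ![x • n (Sum.inr 0) + (y • n (Sum.inr 1)
    + t • primitiveX h (n (Sum.inr 1))),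
      (y • n (Sum.inr 0) - t • primitiveX h (n (Sum.inr 0))) + z • n (Sum.inr 1)]
    ![t • n (Sum.inl 1), -(t • n (Sum.inl 0))])).trans ?_
  rw [columnMap_apply, jpOdd_eq x y z t]
  simp only [Sum.elim_inl, Sum.elim_inr, Matrix.cons_val_zero,
    Matrix.cons_val_one, map_add, map_sub, map_neg, map_smul, LinearMap.add_apply,
    LinearMap.smul_apply, Submodule.coe_add, Submodule.coe_sub, Submodule.coe_neg,
    Submodule.coe_smul, primitiveX_apply, p1, p2, p3, p4, q1, q2, q3, q4, m1, m2, m3, m4, s3]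
  module

lemma columnMap_polyMatAct (h : IsSpecialJP2 V) (a : (JP (Fin 2)).carrier)
    (n : Fin 2 ⊕ Fin 2 → primitive V) :
    columnMap V (polyMatAct (Fin 2) (primitiveModule h) (jpTheta a) n)
      = V.act a (columnMap V n) := by
  let L : (JP (Fin 2)).carrier →ₗ[ℂ] V.carrier :=
    columnMap V ∘ₗ LinearMap.applyₗ (R := ℂ) n ∘ₗ
      polyMatAct (Fin 2) (primitiveModule h) ∘ₗ jpTheta
  suffices hL : L = LinearMap.applyₗ (R := ℂ) (columnMap V n) ∘ₗ V.act from
    LinearMap.congr_fun hL a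
  refine linearMap_ext_of_homogeneous (JP (Fin 2)).isInternal fun i a ha => ?_
  change columnMap V (polyMatAct (Fin 2) (primitiveModule h) (jpTheta a) n)
    = V.act a (columnMap V n)
  rw [act_eq_specialOp]
  rcases zmod2_cases i with rfl | rfl
  · obtain ⟨a, b, c, d, rfl⟩ := exists_eq_jpEven ha
    rw [jpTheta_jpEven, map_smul, LinearMap.smul_apply, ← columnMap_specialOp_even h]
    exact map_smul (columnMap V) _ _
  · obtain ⟨x, y, z, t, rfl⟩ := exists_eq_jpOdd ha
    rw [jpTheta_jpOdd, map_smul, LinearMap.smul_apply, ← columnMap_specialOp_odd h]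
    exact map_smul (columnMap V) _ _

/-- A special module is `ℂ^{2|2} ⊗ N` for the module `N` of its primitive vectors. -/
def matRepIso (h : IsSpecialJP2 V) : matRep jpTheta (primitiveModule h) ≅ V :=
  SuperRep.isoOfEquiv (V := matRep jpTheta (primitiveModule h))
    (LinearEquiv.ofBijective (columnMap V) (columnMap_bijective h))
    (fun _ _ hv => columnMap_mem h _ hv) (fun a n => columnMap_polyMatAct h a n)

end

instance : jpFunctor.EssSurj where
  mem_essImage V :=
    ⟨primitiveModule V.property, ⟨ObjectProperty.isoMk _ (matRepIso V.property)⟩⟩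

instance : jpFunctor.IsEquivalence where

/-! ### Homogeneous elements of `P(3)` and its short grading -/

/-- The odd element `[0, B; C, 0]` of `P(3)`, for `Bᵀ = B` and `Cᵀ = -C`. -/
def p3Odd (B C : Matrix (Fin 2 ⊕ Fin 2) (Fin 2 ⊕ Fin 2) ℂ) (hB : Bᵀ = B) (hC : Cᵀ = -C) : P3.carrier :=
  (⟨fromBlocks 0 B C 0, by simp, by simp, by simpa using hB, by simpa using hC⟩ : pSpace (Fin 2 ⊕ Fin 2))

lemma p3Diag_mem (A : Matrix (Fin 2 ⊕ Fin 2) (Fin 2 ⊕ Fin 2) ℂ) (hA : A.trace = 0) : p3Diag A hA ∈ P3.grading 0 := by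
  change matPart (Fin 2 ⊕ Fin 2) 0 (fromBlocks A 0 0 (-Aᵀ)) = fromBlocks A 0 0 (-Aᵀ)
  rw [matPart_zero_apply]
  simp

lemma p3Odd_mem (B C : Matrix (Fin 2 ⊕ Fin 2) (Fin 2 ⊕ Fin 2) ℂ) (hB : Bᵀ = B) (hC : Cᵀ = -C) :
    p3Odd B C hB hC ∈ P3.grading 1 := by
  change matPart (Fin 2 ⊕ Fin 2) 1 (fromBlocks 0 B C 0) = fromBlocks 0 B C 0
  rw [matPart_one_apply]
  simp

lemma exists_eq_p3Diag {x : P3.carrier} (hx : x ∈ P3.grading 0) : ∃ A hA, x = p3Diag A hA := by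
  obtain ⟨Y, h1, h0, h2, h3⟩ := x
  have hY : matPart (Fin 2 ⊕ Fin 2) 0 Y = Y := hx
  refine ⟨Y.toBlocks₁₁, h0, Subtype.ext ?_⟩
  rw [matPart_zero_apply, h1] at hY
  exact hY.symm

lemma exists_eq_p3Odd {x : P3.carrier} (hx : x ∈ P3.grading 1) :
    ∃ B C hB hC, x = p3Odd B C hB hC := by
  obtain ⟨Y, h1, h0, h2, h3⟩ := x
  have hY : matPart (Fin 2 ⊕ Fin 2) 1 Y = Y := hx
  refine ⟨Y.toBlocks₁₂, Y.toBlocks₂₁, h2, h3, Subtype.ext ?_⟩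
  rw [matPart_one_apply] at hY
  exact hY.symm

lemma p3Diag_bracket_p3Diag {A A' A'' : Matrix (Fin 2 ⊕ Fin 2) (Fin 2 ⊕ Fin 2) ℂ} (hA : A.trace = 0) (hA' : A'.trace = 0)
    (hA'' : A''.trace = 0) (h : A * A' - A' * A = A'') :
    P3.bracket (p3Diag A hA) (p3Diag A' hA') = p3Diag A'' hA'' := by
  refine Subtype.ext ((superComm_of_mem (p3Diag_mem A hA) (p3Diag_mem A' hA')).trans ?_)
  rw [ksgn_00, one_smul]
  change fromBlocks A 0 0 (-Aᵀ) * fromBlocks A' 0 0 (-A'ᵀ)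
    - fromBlocks A' 0 0 (-A'ᵀ) * fromBlocks A 0 0 (-Aᵀ) = fromBlocks A'' 0 0 (-A''ᵀ)
  rw [← h]
  simp [fromBlocks_multiply, sub_eq_add_neg, fromBlocks_neg, fromBlocks_add, add_comm]

lemma p3Diag_bracket_p3Odd {A B C B' C' : Matrix (Fin 2 ⊕ Fin 2) (Fin 2 ⊕ Fin 2) ℂ} (hA : A.trace = 0) (hB : Bᵀ = B)
    (hC : Cᵀ = -C) (hB' : B'ᵀ = B') (hC' : C'ᵀ = -C') (h : A * B + B * Aᵀ = B')
    (h' : Aᵀ * C + C * A = -C') :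
    P3.bracket (p3Diag A hA) (p3Odd B C hB hC) = p3Odd B' C' hB' hC' := by
  refine Subtype.ext ((superComm_of_mem (p3Diag_mem A hA) (p3Odd_mem B C hB hC)).trans ?_)
  rw [ksgn_01, one_smul]
  change fromBlocks A 0 0 (-Aᵀ) * fromBlocks 0 B C 0
    - fromBlocks 0 B C 0 * fromBlocks A 0 0 (-Aᵀ) = fromBlocks 0 B' C' 0
  rw [← h, ← neg_neg C', ← h']
  simp [fromBlocks_multiply, sub_eq_add_neg, fromBlocks_neg, fromBlocks_add]
  abel

lemma p3Odd_bracket_p3Diag {A B C B' C' : Matrix (Fin 2 ⊕ Fin 2) (Fin 2 ⊕ Fin 2) ℂ}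
    (hB : Bᵀ = B) (hC : Cᵀ = -C) (hA : A.trace = 0) (hB' : B'ᵀ = B') (hC' : C'ᵀ = -C')
    (h : A * B + B * Aᵀ = -B') (h' : Aᵀ * C + C * A = C') :
    P3.bracket (p3Odd B C hB hC) (p3Diag A hA) = p3Odd B' C' hB' hC' := by
  refine Subtype.ext ((superComm_of_mem (p3Odd_mem B C hB hC) (p3Diag_mem A hA)).trans ?_)
  rw [ksgn_10, one_smul]
  change fromBlocks 0 B C 0 * fromBlocks A 0 0 (-Aᵀ)
    - fromBlocks A 0 0 (-Aᵀ) * fromBlocks 0 B C 0 = fromBlocks 0 B' C' 0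
  rw [← neg_neg B', ← h, ← h']
  simp [fromBlocks_multiply, sub_eq_add_neg, fromBlocks_neg, fromBlocks_add]
  abel

lemma p3Odd_bracket_p3Odd {B C B' C' A : Matrix (Fin 2 ⊕ Fin 2) (Fin 2 ⊕ Fin 2) ℂ} (hB : Bᵀ = B) (hC : Cᵀ = -C)
    (hB' : B'ᵀ = B') (hC' : C'ᵀ = -C') (hA : A.trace = 0) (h : B * C' + B' * C = A) :
    P3.bracket (p3Odd B C hB hC) (p3Odd B' C' hB' hC') = p3Diag A hA := by
  refine Subtype.ext ((superComm_of_mem (p3Odd_mem B C hB hC) (p3Odd_mem B' C' hB' hC')).trans ?_)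
  rw [ksgn_11, neg_one_smul, sub_neg_eq_add]
  change fromBlocks 0 B C 0 * fromBlocks 0 B' C' 0 + fromBlocks 0 B' C' 0 * fromBlocks 0 B C 0
    = fromBlocks A 0 0 (-Aᵀ)
  rw [← h]
  simp [fromBlocks_multiply, fromBlocks_add, transpose_mul, hB, hB', hC, hC', add_comm]

lemma p3Diag_add {A A' A'' : Matrix (Fin 2 ⊕ Fin 2) (Fin 2 ⊕ Fin 2) ℂ} (hA : A.trace = 0) (hA' : A'.trace = 0)
    (hA'' : A''.trace = 0) (h : A + A' = A'') : p3Diag A'' hA'' = p3Diag A hA + p3Diag A' hA' := by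
  refine Subtype.ext ?_
  change fromBlocks A'' 0 0 (-A''ᵀ) = fromBlocks A 0 0 (-Aᵀ) + fromBlocks A' 0 0 (-A'ᵀ)
  rw [← h]
  simp [fromBlocks_add, add_comm]

lemma p3Diag_smul {A A' : Matrix (Fin 2 ⊕ Fin 2) (Fin 2 ⊕ Fin 2) ℂ} (c : ℂ) (hA : A.trace = 0) (hA' : A'.trace = 0)
    (h : c • A = A') : p3Diag A' hA' = c • p3Diag A hA := by
  refine Subtype.ext ?_
  change fromBlocks A' 0 0 (-A'ᵀ) = c • fromBlocks A 0 0 (-Aᵀ)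
  rw [← h]
  simp [fromBlocks_smul]

lemma p3Odd_add {B C B' C' B'' C'' : Matrix (Fin 2 ⊕ Fin 2) (Fin 2 ⊕ Fin 2) ℂ} (hB : Bᵀ = B) (hC : Cᵀ = -C)
    (hB' : B'ᵀ = B') (hC' : C'ᵀ = -C') (hB'' : B''ᵀ = B'') (hC'' : C''ᵀ = -C'')
    (h : B + B' = B'') (h' : C + C' = C'') :
    p3Odd B'' C'' hB'' hC'' = p3Odd B C hB hC + p3Odd B' C' hB' hC' := by
  refine Subtype.ext ?_
  change fromBlocks 0 B'' C'' 0 = fromBlocks 0 B C 0 + fromBlocks 0 B' C' 0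
  rw [← h, ← h']
  simp [fromBlocks_add]

/-- The identification of `JP(2)` with the component of degree `1` of the short grading. -/
def jpRaise : (JP (Fin 2)).carrier →ₗ[ℂ] P3.carrier :=
  LinearMap.codRestrict (pSpace (Fin 2 ⊕ Fin 2))
    ({ toFun := fun M => fromBlocks (fromBlocks 0 M.toBlocks₁₁ 0 0) (fromBlocks (-M.toBlocks₁₂) 0 0 0)
        (fromBlocks 0 0 0 M.toBlocks₂₁) (fromBlocks 0 0 (-M.toBlocks₁₁ᵀ) 0)
       map_add' := fun M M' => by
        apply Matrix.ext
        rintro ((i | i) | (i | i)) ((j | j) | (j | j)) <;>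
          simp [toBlocks₁₁, toBlocks₁₂, toBlocks₂₁, add_comm]
       map_smul' := fun c M => by
        apply Matrix.ext
        rintro ((i | i) | (i | i)) ((j | j) | (j | j)) <;>
          simp [toBlocks₁₁, toBlocks₁₂, toBlocks₂₁] } ∘ₗ (jpSpace (Fin 2)).subtype)
    (fun M => by
      obtain ⟨h1, h2, h3⟩ := M.2
      change fromBlocks _ _ _ _ ∈ pSpace (Fin 2 ⊕ Fin 2)
      refine ⟨?_, ?_, ?_, ?_⟩
      · simp [fromBlocks_transpose, fromBlocks_neg]
      · simp [trace]
      · simp only [toBlocks_fromBlocks₁₂, fromBlocks_transpose, transpose_neg, transpose_zero]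
        exact congrArg (fun B => fromBlocks (-B) 0 0 0) h2
      · simp only [toBlocks_fromBlocks₂₁, fromBlocks_transpose, fromBlocks_neg, transpose_zero,
          neg_zero]
        exact congrArg (fromBlocks 0 0 0) h3)

/-- The even element `[A, 0; 0, Aᵀ]` of `JP(2)`. -/
def jpDiag (A : Matrix (Fin 2) (Fin 2) ℂ) : (JP (Fin 2)).carrier :=
  (⟨fromBlocks A 0 0 Aᵀ, by simp, by simp, by simp⟩ : jpSpace (Fin 2))

/-- The odd element `[0, B; C, 0]` of `JP(2)`. -/
def jpOff (B C : Matrix (Fin 2) (Fin 2) ℂ) (hB : Bᵀ = B) (hC : Cᵀ = -C) : (JP (Fin 2)).carrier :=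
  (⟨fromBlocks 0 B C 0, by simp, by simpa using hB, by simpa using hC⟩ : jpSpace (Fin 2))

lemma jpDiag_mem (A : Matrix (Fin 2) (Fin 2) ℂ) : jpDiag A ∈ (JP (Fin 2)).grading 0 := by
  change matPart (Fin 2) 0 (fromBlocks A 0 0 Aᵀ) = fromBlocks A 0 0 Aᵀ
  rw [matPart_zero_apply]
  simp

lemma jpOff_mem (B C : Matrix (Fin 2) (Fin 2) ℂ) (hB : Bᵀ = B) (hC : Cᵀ = -C) :
    jpOff B C hB hC ∈ (JP (Fin 2)).grading 1 := by
  change matPart (Fin 2) 1 (fromBlocks 0 B C 0) = fromBlocks 0 B C 0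
  rw [matPart_one_apply]
  simp

lemma exists_eq_jpDiag {Y : (JP (Fin 2)).carrier} (hY : Y ∈ (JP (Fin 2)).grading 0) :
    ∃ A, Y = jpDiag A := by
  obtain ⟨Y, h1, h2, h3⟩ := Y
  have hY' : matPart (Fin 2) 0 Y = Y := hY
  refine ⟨Y.toBlocks₁₁, Subtype.ext ?_⟩
  rw [matPart_zero_apply, h1] at hY'
  exact hY'.symm

lemma exists_eq_jpOff {Y : (JP (Fin 2)).carrier} (hY : Y ∈ (JP (Fin 2)).grading 1) :
    ∃ B C hB hC, Y = jpOff B C hB hC := by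
  obtain ⟨Y, h1, h2, h3⟩ := Y
  have hY' : matPart (Fin 2) 1 Y = Y := hY
  refine ⟨Y.toBlocks₁₂, Y.toBlocks₂₁, h2, h3, Subtype.ext ?_⟩
  rw [matPart_one_apply] at hY'
  exact hY'.symm

lemma jpDiag_mul_jpDiag (A A' : Matrix (Fin 2) (Fin 2) ℂ) :
    (JP (Fin 2)).mul (jpDiag A) (jpDiag A') = jpDiag ((1 / 2 : ℂ) • (A * A' + A' * A)) := by
  refine Subtype.ext ((superJord_of_mem (jpDiag_mem A) (jpDiag_mem A')).trans ?_)
  rw [ksgn_00, one_smul]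
  change (1 / 2 : ℂ) • (fromBlocks A 0 0 Aᵀ * fromBlocks A' 0 0 A'ᵀ
    + fromBlocks A' 0 0 A'ᵀ * fromBlocks A 0 0 Aᵀ) = fromBlocks _ 0 0 _
  simp [fromBlocks_multiply, fromBlocks_add, fromBlocks_smul, transpose_mul, add_comm]

lemma jpDiag_mul_jpOff {A B C B' C' : Matrix (Fin 2) (Fin 2) ℂ} (hB : Bᵀ = B) (hC : Cᵀ = -C)
    (hB' : B'ᵀ = B') (hC' : C'ᵀ = -C') (h : (1 / 2 : ℂ) • (A * B + B * Aᵀ) = B')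
    (h' : (1 / 2 : ℂ) • (Aᵀ * C + C * A) = C') :
    (JP (Fin 2)).mul (jpDiag A) (jpOff B C hB hC) = jpOff B' C' hB' hC' := by
  refine Subtype.ext ((superJord_of_mem (jpDiag_mem A) (jpOff_mem B C hB hC)).trans ?_)
  rw [ksgn_01, one_smul]
  change (1 / 2 : ℂ) • (fromBlocks A 0 0 Aᵀ * fromBlocks 0 B C 0
    + fromBlocks 0 B C 0 * fromBlocks A 0 0 Aᵀ) = fromBlocks 0 B' C' 0
  rw [← h, ← h']
  simp [fromBlocks_multiply, fromBlocks_add, fromBlocks_smul]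

lemma jpOff_mul_jpOff {B C B' C' : Matrix (Fin 2) (Fin 2) ℂ} (hB : Bᵀ = B) (hC : Cᵀ = -C)
    (hB' : B'ᵀ = B') (hC' : C'ᵀ = -C') :
    (JP (Fin 2)).mul (jpOff B C hB hC) (jpOff B' C' hB' hC')
      = jpDiag ((1 / 2 : ℂ) • (B * C' - B' * C)) := by
  refine Subtype.ext ((superJord_of_mem (jpOff_mem B C hB hC) (jpOff_mem B' C' hB' hC')).trans ?_)
  rw [ksgn_11, neg_one_smul]
  change (1 / 2 : ℂ) • (fromBlocks 0 B C 0 * fromBlocks 0 B' C' 0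
    + -(fromBlocks 0 B' C' 0 * fromBlocks 0 B C 0)) = fromBlocks _ 0 0 _
  simp [fromBlocks_multiply, fromBlocks_neg, fromBlocks_add, fromBlocks_smul, transpose_mul, hB,
    hB', hC, hC', sub_eq_add_neg, add_comm]

lemma jpRaise_jpDiag (A : Matrix (Fin 2) (Fin 2) ℂ) :
    jpRaise (jpDiag A) = p3Diag (fromBlocks 0 A 0 0) (by simp [trace]) := by
  refine Subtype.ext ?_
  change fromBlocks (fromBlocks 0 A 0 0) (fromBlocks (-0) 0 0 0) (fromBlocks 0 0 0 0)
    (fromBlocks 0 0 (-Aᵀ) 0) = fromBlocks (fromBlocks 0 A 0 0) 0 0 (-(fromBlocks 0 A 0 0)ᵀ)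
  simp [fromBlocks_transpose, fromBlocks_neg]

lemma jpRaise_jpOff (B C : Matrix (Fin 2) (Fin 2) ℂ) (hB : Bᵀ = B) (hC : Cᵀ = -C) :
    jpRaise (jpOff B C hB hC) = p3Odd (fromBlocks (-B) 0 0 0) (fromBlocks 0 0 0 C)
      (by simp [fromBlocks_transpose, hB]) (by simp [fromBlocks_transpose, fromBlocks_neg, hC]) := by
  refine Subtype.ext ?_
  change fromBlocks (fromBlocks 0 0 0 0) (fromBlocks (-B) 0 0 0) (fromBlocks 0 0 0 C)
    (fromBlocks 0 0 (-0ᵀ) 0) = fromBlocks 0 (fromBlocks (-B) 0 0 0) (fromBlocks 0 0 0 C) 0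
  simp

lemma jpRaise_mem {i : ZMod 2} {Y : (JP (Fin 2)).carrier} (hY : Y ∈ (JP (Fin 2)).grading i) :
    jpRaise Y ∈ P3.grading i := by
  rcases zmod2_cases i with rfl | rfl
  · obtain ⟨A, rfl⟩ := exists_eq_jpDiag hY
    rw [jpRaise_jpDiag]
    exact p3Diag_mem _ _
  · obtain ⟨B, C, hB, hC, rfl⟩ := exists_eq_jpOff hY
    rw [jpRaise_jpOff]
    exact p3Odd_mem _ _ _ _

/-- The lowering element `f` of the short `𝔰𝔩₂`. -/
def p3F : P3.carrier := (1 / 2 : ℂ) • p3F2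

/-- The element `h = [e, f]` of `P(3)`. -/
def p3H : P3.carrier := P3.bracket p3E p3F

lemma jpRaise_one : jpRaise (jpOne (Fin 2)) = p3E := by
  have : jpOne (Fin 2) = jpDiag 1 := Subtype.ext (by
    change (1 : SMat (Fin 2)) = fromBlocks 1 0 0 1ᵀ
    rw [transpose_one, fromBlocks_one])
  rw [this, jpRaise_jpDiag]
  rfl

lemma p3F_eq : p3F = p3Diag (fromBlocks 0 0 ((1 / 2 : ℂ) • 1) 0) (by simp [trace]) :=
  (p3Diag_smul _ _ _ (by simp [fromBlocks_smul])).symm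

lemma p3H_eq : p3H = p3Diag (fromBlocks ((1 / 2 : ℂ) • 1) 0 0 (-(1 / 2 : ℂ) • 1))
    (by simp [trace]) := by
  rw [p3H, p3F_eq]
  refine p3Diag_bracket_p3Diag _ _ _ ?_
  simp [fromBlocks_multiply, sub_eq_add_neg, fromBlocks_neg, fromBlocks_add]

lemma p3F_mem : p3F ∈ P3.grading 0 := by rw [p3F_eq]; exact p3Diag_mem _ _

lemma p3H_mem : p3H ∈ P3.grading 0 := by rw [p3H_eq]; exact p3Diag_mem _ _

lemma p3H_bracket_p3F : P3.bracket p3H p3F = -p3F := by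
  rw [p3H_eq, p3F_eq, ← neg_one_smul ℂ (p3Diag _ _)]
  rw [← p3Diag_smul (-1) (A' := fromBlocks 0 0 (-(1 / 2 : ℂ) • 1) 0) _ (by simp [trace])
    (by simp [fromBlocks_neg])]
  refine p3Diag_bracket_p3Diag _ _ _ ?_
  simp [fromBlocks_multiply, sub_eq_add_neg, fromBlocks_neg, fromBlocks_add]
  module

lemma p3H_bracket_jpRaise (Y : (JP (Fin 2)).carrier) :
    P3.bracket p3H (jpRaise Y) = jpRaise Y := by
  refine LinearMap.congr_fun (f := P3.bracket p3H ∘ₗ jpRaise) (g := jpRaise)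
    (linearMap_ext_of_homogeneous (JP (Fin 2)).isInternal fun i Y hY => ?_) Y
  rw [LinearMap.comp_apply, p3H_eq]
  rcases zmod2_cases i with rfl | rfl
  · obtain ⟨A, rfl⟩ := exists_eq_jpDiag hY
    rw [jpRaise_jpDiag]
    refine p3Diag_bracket_p3Diag _ _ _ ?_
    simp [fromBlocks_multiply, sub_eq_add_neg, fromBlocks_neg, fromBlocks_add]
    module
  · obtain ⟨B, C, hB, hC, rfl⟩ := exists_eq_jpOff hY
    rw [jpRaise_jpOff]
    refine p3Diag_bracket_p3Odd _ _ _ _ _ ?_ ?_ <;>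
    simp [fromBlocks_multiply, fromBlocks_transpose, fromBlocks_neg, fromBlocks_add] <;>
    module

lemma jpRaise_jpDiag_bracket_p3F (A : Matrix (Fin 2) (Fin 2) ℂ) :
    P3.bracket (jpRaise (jpDiag A)) p3F
      = p3Diag (fromBlocks ((1 / 2 : ℂ) • A) 0 0 (-(1 / 2 : ℂ) • A)) (by simp [trace]) := by
  rw [jpRaise_jpDiag, p3F_eq]
  refine p3Diag_bracket_p3Diag _ _ _ ?_
  simp [fromBlocks_multiply, sub_eq_add_neg, fromBlocks_neg, fromBlocks_add]

lemma jpRaise_jpOff_bracket_p3F (B C : Matrix (Fin 2) (Fin 2) ℂ) (hB : Bᵀ = B) (hC : Cᵀ = -C) :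
    P3.bracket (jpRaise (jpOff B C hB hC)) p3F
      = p3Odd (fromBlocks 0 ((1 / 2 : ℂ) • B) ((1 / 2 : ℂ) • B) 0)
        (fromBlocks 0 ((1 / 2 : ℂ) • C) ((1 / 2 : ℂ) • C) 0)
        (by simp [fromBlocks_transpose, hB])
        (by simp [fromBlocks_transpose, fromBlocks_neg, hC]) := by
  rw [jpRaise_jpOff, p3F_eq]
  refine p3Odd_bracket_p3Diag _ _ _ _ _ ?_ ?_ <;>
    simp [fromBlocks_multiply, fromBlocks_neg, fromBlocks_add, fromBlocks_transpose]

/-- The double bracket expresses the Jordan product. -/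
lemma jpRaise_mul {i j : ZMod 2} {Y Z : (JP (Fin 2)).carrier} (hY : Y ∈ (JP (Fin 2)).grading i)
    (hZ : Z ∈ (JP (Fin 2)).grading j) :
    P3.bracket (P3.bracket (jpRaise Y) p3F) (jpRaise Z) = jpRaise ((JP (Fin 2)).mul Y Z) := by
  rcases zmod2_cases i with rfl | rfl <;> rcases zmod2_cases j with rfl | rfl
  · obtain ⟨A, rfl⟩ := exists_eq_jpDiag hY
    obtain ⟨A', rfl⟩ := exists_eq_jpDiag hZ
    rw [jpRaise_jpDiag_bracket_p3F, jpDiag_mul_jpDiag, jpRaise_jpDiag, jpRaise_jpDiag]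
    refine p3Diag_bracket_p3Diag _ _ _ ?_
    simp [fromBlocks_multiply, sub_eq_add_neg, fromBlocks_neg, fromBlocks_add]
  · obtain ⟨A, rfl⟩ := exists_eq_jpDiag hY
    obtain ⟨B, C, hB, hC, rfl⟩ := exists_eq_jpOff hZ
    rw [jpRaise_jpDiag_bracket_p3F, jpDiag_mul_jpOff hB hC (by simp [transpose_mul, hB, add_comm])
      (by simp [transpose_mul, hC, add_comm]) rfl rfl, jpRaise_jpOff, jpRaise_jpOff]
    refine p3Diag_bracket_p3Odd _ _ _ _ _ ?_ ?_ <;>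
      simp [fromBlocks_multiply, fromBlocks_neg, fromBlocks_add, fromBlocks_transpose, add_comm]
  · obtain ⟨B, C, hB, hC, rfl⟩ := exists_eq_jpOff hY
    obtain ⟨A, rfl⟩ := exists_eq_jpDiag hZ
    rw [jpRaise_jpOff_bracket_p3F, (JP (Fin 2)).isJordan.comm 1 0 _ hY _ hZ, ksgn_10, one_smul,
      jpDiag_mul_jpOff hB hC (by simp [transpose_mul, hB, add_comm])
      (by simp [transpose_mul, hC, add_comm]) rfl rfl, jpRaise_jpOff, jpRaise_jpDiag]
    refine p3Odd_bracket_p3Diag _ _ _ _ _ ?_ ?_ <;>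
      simp [fromBlocks_multiply, fromBlocks_neg, fromBlocks_add, fromBlocks_transpose, add_comm]
  · obtain ⟨B, C, hB, hC, rfl⟩ := exists_eq_jpOff hY
    obtain ⟨B', C', hB', hC', rfl⟩ := exists_eq_jpOff hZ
    rw [jpRaise_jpOff_bracket_p3F, jpOff_mul_jpOff, jpRaise_jpDiag, jpRaise_jpOff]
    refine p3Odd_bracket_p3Odd _ _ _ _ _ ?_
    simp [fromBlocks_multiply, fromBlocks_add, sub_eq_add_neg]

/-! ### `P(3)` is generated by `f` and the component of degree `1` -/

section Generation

variable {M : ZMod 2 → Submodule ℂ P3.carrier}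

/-- The even part of a graded subalgebra of `P(3)` that contains `f` and the degree `1`. -/
lemma p3Diag_mem_of_generators
    (hb : ∀ i j, ∀ x ∈ M i, ∀ y ∈ M j, P3.bracket x y ∈ M (i + j))
    (hJ : ∀ i, ∀ Y ∈ (JP (Fin 2)).grading i, jpRaise Y ∈ M i) (hf : p3F ∈ M 0)
    (A : Matrix (Fin 2 ⊕ Fin 2) (Fin 2 ⊕ Fin 2) ℂ) (hA : A.trace = 0) : p3Diag A hA ∈ M 0 := by
  have hE : ∀ A, p3Diag (fromBlocks 0 A 0 0) (by simp [trace]) ∈ M 0 := fun A => by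
    rw [← jpRaise_jpDiag]
    exact hJ 0 _ (jpDiag_mem A)
  have hf2 : p3Diag (fromBlocks 0 0 1 0) (by simp [trace]) ∈ M 0 := by
    rw [p3Diag_smul (2 : ℂ) (A := fromBlocks 0 0 ((1 / 2 : ℂ) • 1) 0) (by simp [trace])
      (by simp [trace]) (by simp [fromBlocks_smul]), ← p3F_eq]
    exact Submodule.smul_mem _ _ hf
  have hS : ∀ A, p3Diag (fromBlocks A 0 0 (-A)) (by simp [trace]) ∈ M 0 := fun A => by
    rw [← p3Diag_bracket_p3Diag (A := fromBlocks 0 A 0 0) (A' := fromBlocks 0 0 1 0)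
      (by simp [trace]) (by simp [trace]) _
      (by simp [fromBlocks_multiply, sub_eq_add_neg, fromBlocks_neg, fromBlocks_add])]
    exact hb 0 0 _ (hE A) _ hf2
  have hF : ∀ A, p3Diag (fromBlocks 0 0 A 0) (by simp [trace]) ∈ M 0 := fun A => by
    rw [← p3Diag_bracket_p3Diag (A := fromBlocks 0 0 1 0)
      (A' := fromBlocks ((1 / 2 : ℂ) • A) 0 0 (-((1 / 2 : ℂ) • A)))
      (by simp [trace]) (by simp [trace]) _ (by
        simp [fromBlocks_multiply, sub_eq_add_neg, fromBlocks_neg, fromBlocks_add]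
        module)]
    exact hb 0 0 _ hf2 _ (hS _)
  have hC : ∀ A B, p3Diag (fromBlocks (A * B - B * A) 0 0 0)
      (by simp [trace, Matrix.mul_apply]; ring) ∈ M 0 := fun A B => by
    rw [p3Diag_add (A := fromBlocks (A * B) 0 0 (-(B * A))) (A' := fromBlocks (-(B * A)) 0 0 (B * A))
      (by simp [trace, Matrix.mul_apply]; ring) (by simp [trace]) _
      (by simp [fromBlocks_add, sub_eq_add_neg])]
    refine Submodule.add_mem _ ?_ ?_
    · rw [← p3Diag_bracket_p3Diag (A := fromBlocks 0 A 0 0) (A' := fromBlocks 0 0 B 0)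
        (by simp [trace]) (by simp [trace]) _
        (by simp [fromBlocks_multiply, sub_eq_add_neg, fromBlocks_neg, fromBlocks_add])]
      exact hb 0 0 _ (hE A) _ (hF B)
    · simpa using hS (-(B * A))
  have hN : ∀ p q r : ℂ, p3Diag (fromBlocks !![p, q; r, -p] 0 0 0) (by simp [trace]) ∈ M 0 := by
    intro p q r
    rw [p3Diag_add (A := fromBlocks (!![0, p; 0, 0] * !![0, 0; 1, 0] - !![0, 0; 1, 0] * !![0, p; 0, 0])
        0 0 0) (A' := fromBlocks (!![1, 0; 0, 0] * !![0, q; -r, 0] - !![0, q; -r, 0] * !![1, 0; 0, 0])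
        0 0 0) (by simp [trace]) (by simp [trace]) _
        (by simp [fromBlocks_add])]
    exact Submodule.add_mem _ (hC _ _) (hC _ _)
  have htr : A (Sum.inl 0) (Sum.inl 0) + A (Sum.inl 1) (Sum.inl 1)
      + (A (Sum.inr 0) (Sum.inr 0) + A (Sum.inr 1) (Sum.inr 1)) = 0 := by
    simpa [trace] using hA
  rw [p3Diag_add (A := fromBlocks 0 A.toBlocks₁₂ A.toBlocks₂₁ 0)
    (A' := fromBlocks A.toBlocks₁₁ 0 0 A.toBlocks₂₂) (by simp [trace])
    (by simpa [trace, toBlocks₁₁, toBlocks₂₂] using hA) hA (by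
      rw [fromBlocks_add]
      simp [fromBlocks_toBlocks])]
  refine Submodule.add_mem _ ?_ ?_
  · rw [p3Diag_add (A := fromBlocks 0 A.toBlocks₁₂ 0 0) (A' := fromBlocks 0 0 A.toBlocks₂₁ 0)
      (by simp [trace]) (by simp [trace]) _ (by simp [fromBlocks_add])]
    exact Submodule.add_mem _ (hE _) (hF _)
  · rw [p3Diag_add (A := fromBlocks (-A.toBlocks₂₂) 0 0 (-(-A.toBlocks₂₂)))
      (A' := fromBlocks !![A (Sum.inl 0) (Sum.inl 0) + A (Sum.inr 0) (Sum.inr 0),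
        A (Sum.inl 0) (Sum.inl 1) + A (Sum.inr 0) (Sum.inr 1);
        A (Sum.inl 1) (Sum.inl 0) + A (Sum.inr 1) (Sum.inr 0),
        -(A (Sum.inl 0) (Sum.inl 0) + A (Sum.inr 0) (Sum.inr 0))] 0 0 0)
      (by simp [trace]) (by simp [trace]) _ (by
        rw [fromBlocks_add]
        congr 1
        · ext i j
          fin_cases i <;> fin_cases j <;> simp [toBlocks₁₁, toBlocks₂₂]
          linear_combination -htr
        all_goals simp)]
    exact Submodule.add_mem _ (hS _) (hN _ _ _)

/-- The odd part of a graded subalgebra of `P(3)` that contains `f` and the degree `1`. -/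
lemma p3Odd_mem_of_generators
    (hb : ∀ i j, ∀ x ∈ M i, ∀ y ∈ M j, P3.bracket x y ∈ M (i + j))
    (hJ : ∀ i, ∀ Y ∈ (JP (Fin 2)).grading i, jpRaise Y ∈ M i) (hf : p3F ∈ M 0)
    (B C : Matrix (Fin 2 ⊕ Fin 2) (Fin 2 ⊕ Fin 2) ℂ) (hB : Bᵀ = B) (hC : Cᵀ = -C) :
    p3Odd B C hB hC ∈ M 1 := by
  have hD := p3Diag_mem_of_generators hb hJ hf
  have hDO : ∀ (A : Matrix (Fin 2 ⊕ Fin 2) (Fin 2 ⊕ Fin 2) ℂ) (_ : A.trace = 0) B C hB hC B' C' hB' hC',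
      p3Odd B C hB hC ∈ M 1 → A * B + B * Aᵀ = B' →
      Aᵀ * C + C * A = -C' → p3Odd B' C' hB' hC' ∈ M 1 := by
    intro A hA B C hB hC B' C' hB' hC' h h1 h2
    rw [← p3Diag_bracket_p3Odd hA hB hC hB' hC' h1 h2]
    exact hb 0 1 _ (hD A hA) _ h
  have hf2 : (fromBlocks 0 0 1 0 : Matrix (Fin 2 ⊕ Fin 2) (Fin 2 ⊕ Fin 2) ℂ).trace = 0 := by
    simp [trace]
  have hB1 : ∀ B (hB : Bᵀ = B), p3Odd (fromBlocks B 0 0 0) 0 (by simpa [fromBlocks_transpose] using hB)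
      (by simp) ∈ M 1 := fun B hB => by
    have := Eq.mp (congrArg (· ∈ M 1) (jpRaise_jpOff (-B) 0 (by simp [hB]) (by simp)))
      (hJ 1 _ (jpOff_mem _ _ _ _))
    simpa using this
  have hC4 : ∀ C (hC : Cᵀ = -C), p3Odd 0 (fromBlocks 0 0 0 C) (by simp)
      (by simpa [fromBlocks_transpose, fromBlocks_neg] using hC) ∈ M 1 :=
    fun C hC => by
    have := Eq.mp (congrArg (· ∈ M 1) (jpRaise_jpOff 0 C (by simp) hC))
      (hJ 1 _ (jpOff_mem _ _ _ _))
    simpa using this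
  have hBs : ∀ B (hB : Bᵀ = B), p3Odd (fromBlocks 0 B B 0) 0 (by simpa [fromBlocks_transpose] using hB)
      (by simp) ∈ M 1 := fun B hB =>
    hDO (fromBlocks 0 0 1 0) hf2 _ _ _ _ _ _ _ _ (hB1 B hB)
      (by simp [fromBlocks_multiply, fromBlocks_transpose, fromBlocks_add]) (by simp)
  have hCs : ∀ C (hC : Cᵀ = -C), p3Odd 0 (fromBlocks 0 C C 0) (by simp)
      (by simpa [fromBlocks_transpose, fromBlocks_neg] using hC) ∈ M 1 :=
    fun C hC =>
    hDO (fromBlocks 0 0 1 0) hf2 _ _ _ _ _ _ _ _ (hC4 (-C) (by simp [hC])) (by simp)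
      (by simp [fromBlocks_multiply, fromBlocks_transpose, fromBlocks_add, fromBlocks_neg])
  have hB4 : ∀ B (hB : Bᵀ = B), p3Odd (fromBlocks 0 0 0 B) 0 (by simpa [fromBlocks_transpose] using hB)
      (by simp) ∈ M 1 := fun B hB =>
    hDO (fromBlocks 0 0 1 0) hf2 _ _ _ _ _ _ _ _ (hBs ((1 / 2 : ℂ) • B) (by simp [hB]))
      (by simp [fromBlocks_multiply, fromBlocks_transpose, fromBlocks_add]; module) (by simp)
  have hC1 : ∀ C (hC : Cᵀ = -C), p3Odd 0 (fromBlocks C 0 0 0) (by simp)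
      (by simpa [fromBlocks_transpose, fromBlocks_neg] using hC) ∈ M 1 :=
    fun C hC =>
    hDO (fromBlocks 0 0 1 0) hf2 _ _ _ _ _ _ _ _ (hCs (-(1 / 2 : ℂ) • C) (by simp [hC])) (by simp)
      (by
        simp [fromBlocks_multiply, fromBlocks_transpose, fromBlocks_add, fromBlocks_neg]
        module)
  have hadd : ∀ B C hB hC B' C' hB' hC' B'' C'' hB'' hC'', p3Odd B C hB hC ∈ M 1 →
      p3Odd B' C' hB' hC' ∈ M 1 → B + B' = B'' → C + C' = C'' → p3Odd B'' C'' hB'' hC'' ∈ M 1 := by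
    intro B C hB hC B' C' hB' hC' B'' C'' hB'' hC'' h h' h1 h2
    rw [p3Odd_add hB hC hB' hC' hB'' hC'' h1 h2]
    exact Submodule.add_mem _ h h'
  have hB2 : ∀ B, p3Odd (fromBlocks 0 B Bᵀ 0) 0 (by simp [fromBlocks_transpose])
      (by simp) ∈ M 1 := fun B => by
    refine hadd _ _ _ _ _ _ _ _ _ _ _ _ (hBs ((1 / 2 : ℂ) • (B + Bᵀ)) (by simp [add_comm]))
      (hDO (fromBlocks ((1 / 2 : ℂ) • (B - Bᵀ)) 0 0 0) (by simp [trace]) _ _ _ _ 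
        (fromBlocks 0 ((1 / 2 : ℂ) • (B - Bᵀ)) ((1 / 2 : ℂ) • (Bᵀ - B)) 0) 0
        (by simp [fromBlocks_transpose]) (by simp) (hBs 1 (by simp)) ?_ (by simp)) ?_ (by simp)
    · simp [fromBlocks_multiply, fromBlocks_transpose, fromBlocks_add]
    · rw [fromBlocks_add]
      congr 1
      · simp
      · module
      · module
      · simp
  let J : Matrix (Fin 2) (Fin 2) ℂ := !![0, 1; -1, 0]
  have hJt : Jᵀ = -J := by ext i j; fin_cases i <;> fin_cases j <;> simp [J]
  have hC2 : ∀ C, p3Odd 0 (fromBlocks 0 C (-Cᵀ) 0) (by simp)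
      (by simp [fromBlocks_transpose, fromBlocks_neg]) ∈ M 1 := fun C => by
    have hJtr : (J * (C + Cᵀ)).trace = 0 := by
      simp only [Matrix.trace_fin_two, Matrix.mul_apply, Fin.sum_univ_two]
      simp [J]
      ring
    refine hadd _ _ _ _ _ _ _ _ _ _ _ _ (hCs ((1 / 2 : ℂ) • (C - Cᵀ)) (by simp [← smul_neg]))
      (hDO (fromBlocks (-(1 / 2 : ℂ) • (J * (C + Cᵀ))) 0 0 0)
        (by
          rw [Matrix.trace, Fintype.sum_sum_type]
          refine Eq.trans ?_ ((congrArg₂ (· + ·) ((trace_smul (-(1 / 2) : ℂ) _).trans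
            (congrArg _ hJtr)) (trace_zero (Fin 2) ℂ)).trans (by simp))
          rfl) _ _ _ _ 0
        (fromBlocks 0 ((1 / 2 : ℂ) • (C + Cᵀ)) (-((1 / 2 : ℂ) • (C + Cᵀ))) 0)
        (by simp) (by simp [fromBlocks_transpose, fromBlocks_neg, add_comm])
        (hCs J hJt) (by simp) ?_) (by simp) ?_
    · have hJJ : J * J = -1 := by
        ext i j; fin_cases i <;> fin_cases j <;> simp [J, Matrix.mul_apply]
      have h1 : (J * (C + Cᵀ))ᵀ * J = (C + Cᵀ) := by
        rw [transpose_mul, mul_assoc, hJt, neg_mul, hJJ, neg_neg, mul_one]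
        simp [add_comm]
      have h2 : J * (J * (C + Cᵀ)) = -(C + Cᵀ) := by rw [← mul_assoc, hJJ, neg_one_mul]
      simp only [fromBlocks_multiply, fromBlocks_transpose, fromBlocks_add, transpose_smul,
        smul_mul_assoc, mul_smul_comm, h1, h2, fromBlocks_neg]
      congr 1 <;> simp [add_comm]
    · rw [fromBlocks_add]
      congr 1
      · simp
      · module
      · module
      · simp
  have hBt : ∀ i j, B i j = B j i := fun i j => congrFun (congrFun hB j) i
  have hCt : ∀ i j, C j i = -C i j := fun i j => congrFun (congrFun hC i) j
  have hB1' : B.toBlocks₁₁ᵀ = B.toBlocks₁₁ := by ext i j; exact hBt _ _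
  have hB4' : B.toBlocks₂₂ᵀ = B.toBlocks₂₂ := by ext i j; exact hBt _ _
  have hC1' : C.toBlocks₁₁ᵀ = -C.toBlocks₁₁ := by ext i j; exact hCt _ _
  have hC4' : C.toBlocks₂₂ᵀ = -C.toBlocks₂₂ := by ext i j; exact hCt _ _
  have hB2' : B.toBlocks₁₂ᵀ = B.toBlocks₂₁ := by ext i j; exact hBt _ _
  have hC2' : -C.toBlocks₁₂ᵀ = C.toBlocks₂₁ := by ext i j; exact (hCt _ _).symm
  have key : p3Odd B C hB hC = p3Odd (fromBlocks B.toBlocks₁₁ 0 0 0) 0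
        (by simpa [fromBlocks_transpose] using hB1') (by simp)
      + p3Odd (fromBlocks 0 0 0 B.toBlocks₂₂) 0 (by simpa [fromBlocks_transpose] using hB4') (by simp)
      + p3Odd (fromBlocks 0 B.toBlocks₁₂ B.toBlocks₁₂ᵀ 0) 0 (by simp [fromBlocks_transpose]) (by simp)
      + (p3Odd 0 (fromBlocks C.toBlocks₁₁ 0 0 0) (by simp)
        (by simpa [fromBlocks_transpose, fromBlocks_neg] using hC1')
      + p3Odd 0 (fromBlocks 0 0 0 C.toBlocks₂₂) (by simp)
        (by simpa [fromBlocks_transpose, fromBlocks_neg] using hC4')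
      + p3Odd 0 (fromBlocks 0 C.toBlocks₁₂ (-C.toBlocks₁₂ᵀ) 0) (by simp)
        (by simp [fromBlocks_transpose, fromBlocks_neg])) := by
    refine Subtype.ext ?_
    change fromBlocks 0 B C 0 = fromBlocks 0 _ _ 0 + fromBlocks 0 _ _ 0 + fromBlocks 0 _ _ 0
      + (fromBlocks 0 _ _ 0 + fromBlocks 0 _ _ 0 + fromBlocks 0 _ _ 0)
    simp [fromBlocks_add, hB2', hC2', fromBlocks_toBlocks]
  rw [key]
  exact Submodule.add_mem _
    (Submodule.add_mem _ (Submodule.add_mem _ (hB1 _ hB1') (hB4 _ hB4')) (hB2 _))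
    (Submodule.add_mem _ (Submodule.add_mem _ (hC1 _ hC1') (hC4 _ hC4')) (hC2 _))

lemma mem_of_generators
    (hb : ∀ i j, ∀ x ∈ M i, ∀ y ∈ M j, P3.bracket x y ∈ M (i + j))
    (hJ : ∀ i, ∀ Y ∈ (JP (Fin 2)).grading i, jpRaise Y ∈ M i) (hf : p3F ∈ M 0)
    {i : ZMod 2} {x : P3.carrier} (hx : x ∈ P3.grading i) : x ∈ M i := by
  rcases zmod2_cases i with rfl | rfl
  · obtain ⟨A, hA, rfl⟩ := exists_eq_p3Diag hx
    exact p3Diag_mem_of_generators hb hJ hf A hA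
  · obtain ⟨B, C, hB, hC, rfl⟩ := exists_eq_p3Odd hx
    exact p3Odd_mem_of_generators hb hJ hf B C hB hC

end Generation

/-! ### Operators on a very short graded module -/

lemma eigenspace_half_sup_eq_top_iff {V : Type} [AddCommGroup V] [Module ℂ V]
    (H : Module.End ℂ V) :
    Module.End.eigenspace H (1 / 2 : ℂ) ⊔ Module.End.eigenspace H (-1 / 2 : ℂ) = ⊤ ↔
      H * H = (1 / 4 : ℂ) • 1 := by
  constructor
  · intro h
    refine LinearMap.ext fun v => ?_
    have hv : v ∈ Module.End.eigenspace H (1 / 2 : ℂ) ⊔ Module.End.eigenspace H (-1 / 2 : ℂ) := by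
      rw [h]; trivial
    obtain ⟨a, ha, b, hb, rfl⟩ := Submodule.mem_sup.1 hv
    rw [Module.End.mem_eigenspace_iff] at ha hb
    simp only [Module.End.mul_apply, map_add, ha, hb, map_smul, LinearMap.smul_apply,
      Module.End.one_apply, smul_smul]
    module
  · intro h
    have hH : ∀ v, H (H v) = (1 / 4 : ℂ) • v := LinearMap.congr_fun h
    rw [Submodule.eq_top_iff']
    intro v
    refine Submodule.mem_sup.2 ⟨(1 / 2 : ℂ) • v + H v, ?_, (1 / 2 : ℂ) • v - H v, ?_, by module⟩ <;>
      rw [Module.End.mem_eigenspace_iff] <;>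
      simp only [map_add, map_sub, map_smul, hH] <;> module

section Ring

variable {R : Type*} [Ring R] [Algebra ℂ R] {H a b F : R}

lemma mul_eq_half_of_raise (hH : H * H = (1 / 4 : ℂ) • 1) (ha : H * a - a * H = a) :
    H * a = (1 / 2 : ℂ) • a ∧ a * H = -(1 / 2 : ℂ) • a := by
  have h1 : H * a = a * H + a := (sub_eq_iff_eq_add.1 ha).trans (add_comm _ _)
  have h2 : H * H * a = a * (H * H) + (2 : ℂ) • (a * H) + a := by
    rw [mul_assoc, h1, mul_add, ← mul_assoc, h1]
    simp only [add_mul, mul_assoc]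
    module
  rw [hH] at h2
  simp only [smul_mul_assoc, mul_smul_comm, one_mul, mul_one] at h2
  have h3 : a * H = -(1 / 2 : ℂ) • a := by
    linear_combination (norm := module) (-(1 / 2 : ℂ)) • h2
  refine ⟨?_, h3⟩
  rw [h1, h3]
  module

lemma mul_eq_half_of_lower (hH : H * H = (1 / 4 : ℂ) • 1) (hF : H * F - F * H = -F) :
    H * F = -(1 / 2 : ℂ) • F ∧ F * H = (1 / 2 : ℂ) • F := by
  obtain ⟨h1, h2⟩ := mul_eq_half_of_raise (H := -H) (a := F) (by rw [neg_mul_neg, hH])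
    (by rw [neg_mul, mul_neg, ← neg_inj, ← hF]; abel)
  rw [neg_mul] at h1
  rw [mul_neg] at h2
  refine ⟨?_, ?_⟩
  · rw [← neg_inj, h1]; module
  · rw [← neg_inj, h2]; module

lemma mul_eq_zero_of_half (ha : a * H = -(1 / 2 : ℂ) • a) (hb : H * b = (1 / 2 : ℂ) • b) :
    a * b = 0 := by
  have h : a * H * b = a * (H * b) := mul_assoc a H b
  rw [ha, hb, smul_mul_assoc, mul_smul_comm] at h
  linear_combination (norm := module) -h

end Ring

/-- The lift of `jpRaise` to the universal central extension. -/
def raiseHat : (JP (Fin 2)).carrier →ₗ[ℂ] P3hat.carrier where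
  toFun Y := ucePair P3 p3H (jpRaise Y)
  map_add' := ((uceRel P3).mkQ ∘ₗ TensorProduct.mk ℂ P3.carrier P3.carrier p3H ∘ₗ jpRaise).map_add
  map_smul' := ((uceRel P3).mkQ ∘ₗ TensorProduct.mk ℂ P3.carrier P3.carrier p3H ∘ₗ jpRaise).map_smul

lemma raiseHat_apply (Y : (JP (Fin 2)).carrier) : raiseHat Y = ucePair P3 p3H (jpRaise Y) := rfl

/-- The lift of `f` to the universal central extension. -/
def lowerHat : P3hat.carrier := ucePair P3 p3F p3H

lemma ucePair_mem {i j : ZMod 2} {x y : P3.carrier} (hx : x ∈ P3.grading i)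
    (hy : y ∈ P3.grading j) : ucePair P3 x y ∈ P3hat.grading (i + j) :=
  show ucePair P3 x y ∈ uceGrading P3 (i + j) from
    Submodule.subset_span ⟨i, j, rfl, x, hx, y, hy, rfl⟩

lemma raiseHat_mem {i : ZMod 2} {Y : (JP (Fin 2)).carrier} (hY : Y ∈ (JP (Fin 2)).grading i) :
    raiseHat Y ∈ P3hat.grading i := by
  have := ucePair_mem p3H_mem (jpRaise_mem hY)
  rwa [zero_add] at this

lemma lowerHat_mem : lowerHat ∈ P3hat.grading 0 := by
  have := ucePair_mem p3F_mem p3H_mem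
  rwa [zero_add] at this

lemma uceProj_raiseHat (Y : (JP (Fin 2)).carrier) : uceProj P3 (raiseHat Y) = jpRaise Y :=
  (uceProj_pair P3 _ _).trans (p3H_bracket_jpRaise Y)

lemma p3F_bracket_p3H : P3.bracket p3F p3H = p3F := by
  rw [P3.skew 0 0 _ p3F_mem _ p3H_mem, ksgn_00, one_smul, p3H_bracket_p3F, neg_neg]

lemma uceProj_lowerHat : uceProj P3 lowerHat = p3F :=
  (uceProj_pair P3 _ _).trans p3F_bracket_p3H

lemma hHat_eq : hHat = ucePair P3 p3E p3F := by
  rw [hHat, p3F, ucePair, ucePair, TensorProduct.tmul_smul, map_smul]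

lemma uceProj_hHat : uceProj P3 hHat = p3H := by
  rw [hHat_eq, uceProj_pair]; rfl

lemma P3hat_bracket (u v : P3hat.carrier) :
    P3hat.bracket u v = ucePair P3 (uceProj P3 u) (uceProj P3 v) := rfl

lemma hHat_mem : hHat ∈ P3hat.grading 0 := by
  have := ucePair_mem (jpRaise_mem jpOne_mem) p3F_mem
  rwa [zero_add, jpRaise_one, ← hHat_eq] at this

lemma raiseHat_one_bracket_lowerHat : P3hat.bracket (raiseHat (jpOne (Fin 2))) lowerHat = hHat := by
  rw [P3hat_bracket, uceProj_raiseHat, uceProj_lowerHat, hHat_eq, jpRaise_one]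

lemma hHat_bracket_raiseHat (Y : (JP (Fin 2)).carrier) :
    P3hat.bracket hHat (raiseHat Y) = raiseHat Y := by
  rw [P3hat_bracket, uceProj_raiseHat, uceProj_hHat, raiseHat_apply]

lemma hHat_bracket_lowerHat : P3hat.bracket hHat lowerHat = -lowerHat := by
  rw [P3hat_bracket, uceProj_lowerHat, uceProj_hHat, lowerHat, ucePair_skew P3 p3H_mem p3F_mem,
    ksgn_00, one_smul]
  rfl

lemma raiseHat_mul {i j : ZMod 2} {Y Z : (JP (Fin 2)).carrier} (hY : Y ∈ (JP (Fin 2)).grading i)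
    (hZ : Z ∈ (JP (Fin 2)).grading j) :
    P3hat.bracket (P3hat.bracket (raiseHat Y) lowerHat) (raiseHat Z)
      = raiseHat ((JP (Fin 2)).mul Y Z) := by
  have hu : P3.bracket (jpRaise Y) p3F ∈ P3.grading i := by
    simpa using P3.bracket_mem i 0 _ (jpRaise_mem hY) _ p3F_mem
  have h0 : P3.bracket p3H (P3.bracket (jpRaise Y) p3F) = 0 := by
    rw [P3.jacobi 0 i 0 _ p3H_mem _ (jpRaise_mem hY) _ p3F_mem, p3H_bracket_jpRaise,
      p3H_bracket_p3F, map_neg, show ksgn 0 i = 1 by simp [ksgn], one_smul, add_neg_cancel]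
  rw [P3hat_bracket, uceProj_raiseHat, P3hat_bracket, uceProj_pair, uceProj_raiseHat,
    uceProj_lowerHat, raiseHat_apply, ← jpRaise_mul hY hZ,
    ucePair_jacobi P3 p3H_mem hu (jpRaise_mem hZ), h0, p3H_bracket_jpRaise,
    show ksgn 0 i = 1 by simp [ksgn], one_smul]
  simp [ucePair]
  rfl

section

variable {V : SuperRep P3hat.carrier}

lemma act_bracket (h : IsLieModule P3hat V) {i j : ZMod 2} {x y : P3hat.carrier}
    (hx : x ∈ P3hat.grading i) (hy : y ∈ P3hat.grading j) :
    V.act (P3hat.bracket x y) = V.act x * V.act y - ksgn i j • (V.act y * V.act x) :=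
  LinearMap.ext fun v => h.2 i j x hx y hy v

lemma act_hHat_mul_self (h : IsVeryShortP3hat V) :
    V.act hHat * V.act hHat = (1 / 4 : ℂ) • 1 :=
  (eigenspace_half_sup_eq_top_iff _).1 h.2

lemma act_raiseHat (h : IsVeryShortP3hat V) (Y : (JP (Fin 2)).carrier) :
    V.act hHat * V.act (raiseHat Y) = (1 / 2 : ℂ) • V.act (raiseHat Y) ∧
      V.act (raiseHat Y) * V.act hHat = -(1 / 2 : ℂ) • V.act (raiseHat Y) := by
  refine mul_eq_half_of_raise (act_hHat_mul_self h) ?_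
  let L : (JP (Fin 2)).carrier →ₗ[ℂ] Module.End ℂ V.carrier :=
    (LinearMap.mulLeft ℂ (V.act hHat) - LinearMap.mulRight ℂ (V.act hHat)) ∘ₗ V.act ∘ₗ raiseHat
  refine LinearMap.congr_fun (f := L) (g := V.act ∘ₗ raiseHat)
    (linearMap_ext_of_homogeneous (JP (Fin 2)).isInternal fun i Y hY => ?_) Y
  have := act_bracket h.1 hHat_mem (raiseHat_mem hY)
  rw [hHat_bracket_raiseHat, show ksgn 0 i = 1 by simp [ksgn], one_smul] at this
  exact this.symm

lemma act_lowerHat (h : IsVeryShortP3hat V) :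
    V.act hHat * V.act lowerHat = -(1 / 2 : ℂ) • V.act lowerHat ∧
      V.act lowerHat * V.act hHat = (1 / 2 : ℂ) • V.act lowerHat := by
  refine mul_eq_half_of_lower (act_hHat_mul_self h) ?_
  have := act_bracket h.1 hHat_mem lowerHat_mem
  rw [hHat_bracket_lowerHat, ksgn_00, one_smul, map_neg] at this
  exact this.symm

lemma act_raiseHat_mul_raiseHat (h : IsVeryShortP3hat V) (Y Z : (JP (Fin 2)).carrier) :
    V.act (raiseHat Y) * V.act (raiseHat Z) = 0 :=
  mul_eq_zero_of_half (act_raiseHat h Y).2 (act_raiseHat h Z).1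

lemma act_lowerHat_mul_self (h : IsVeryShortP3hat V) :
    V.act lowerHat * V.act lowerHat = 0 :=
  mul_eq_zero_of_half (H := -V.act hHat) (by rw [mul_neg, (act_lowerHat h).2, neg_smul])
    (by rw [neg_mul, (act_lowerHat h).1, neg_smul, neg_neg])

lemma act_hHat_eq (h : IsVeryShortP3hat V) :
    V.act hHat = V.act (raiseHat (jpOne (Fin 2))) * V.act lowerHat
      - V.act lowerHat * V.act (raiseHat (jpOne (Fin 2))) := by
  have := act_bracket h.1 (raiseHat_mem jpOne_mem) lowerHat_mem
  rwa [raiseHat_one_bracket_lowerHat, ksgn_00, one_smul] at this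

lemma act_one_add (h : IsVeryShortP3hat V) :
    V.act (raiseHat (jpOne (Fin 2))) * V.act lowerHat
      + V.act lowerHat * V.act (raiseHat (jpOne (Fin 2))) = (1 / 2 : ℂ) • 1 := by
  have h1 := act_hHat_mul_self h
  nth_rewrite 2 [act_hHat_eq h] at h1
  rw [mul_sub, ← mul_assoc, ← mul_assoc, (act_raiseHat h _).1, (act_lowerHat h).1] at h1
  simp only [smul_mul_assoc] at h1
  linear_combination (norm := module) (2 : ℂ) • h1

lemma act_raiseHat_mul (h : IsVeryShortP3hat V) {i j : ZMod 2} {Y Z : (JP (Fin 2)).carrier}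
    (hY : Y ∈ (JP (Fin 2)).grading i) (hZ : Z ∈ (JP (Fin 2)).grading j) :
    V.act (raiseHat ((JP (Fin 2)).mul Y Z))
      = V.act (raiseHat Y) * V.act lowerHat * V.act (raiseHat Z)
        + ksgn i j • (V.act (raiseHat Z) * V.act lowerHat * V.act (raiseHat Y)) := by
  have hu : P3hat.bracket (raiseHat Y) lowerHat ∈ P3hat.grading i := by
    simpa using P3hat.bracket_mem i 0 _ (raiseHat_mem hY) _ lowerHat_mem
  rw [← raiseHat_mul hY hZ, act_bracket h.1 hu (raiseHat_mem hZ),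
    act_bracket h.1 (raiseHat_mem hY) lowerHat_mem, show ksgn i 0 = 1 by simp [ksgn], one_smul,
    sub_mul, mul_sub, mul_assoc (V.act lowerHat), act_raiseHat_mul_raiseHat h Y Z, mul_zero,
    sub_zero, ← mul_assoc (V.act (raiseHat Z)) (V.act (raiseHat Y)),
    act_raiseHat_mul_raiseHat h Z Y, zero_mul, zero_sub, smul_neg, sub_neg_eq_add, mul_assoc (V.act (raiseHat Z))]

end

/-! ### The functor from very short graded modules to special modules -/

section

variable {V W : SuperRep P3hat.carrier}

variable (V) in
/-- The eigenspace `V[½]`. -/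
def plusPart : Submodule ℂ V.carrier := Module.End.eigenspace (V.act hHat) (1 / 2 : ℂ)

lemma mem_plusPart {v : V.carrier} : v ∈ plusPart V ↔ V.act hHat v = (1 / 2 : ℂ) • v :=
  Module.End.mem_eigenspace_iff

lemma parityProj_mem_plusPart (h : IsVeryShortP3hat V) (i : ZMod 2) {v : V.carrier}
    (hv : v ∈ plusPart V) : parityProj V.isInternal i v ∈ plusPart V := by
  have := parityProj_map V.isInternal V.isInternal (f := V.act hHat) (d := 0)
    (fun i v hv => h.1.1 0 i _ hHat_mem v hv) i v
  rw [zero_add, mem_plusPart.1 hv, map_smul] at this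
  exact mem_plusPart.2 this.symm

lemma raiseHat_apply_mem (h : IsVeryShortP3hat V) (Y : (JP (Fin 2)).carrier) (v : V.carrier) :
    V.act (raiseHat Y) v ∈ plusPart V :=
  mem_plusPart.2 (LinearMap.congr_fun (act_raiseHat h Y).1 v)

lemma raiseHat_apply_of_mem (h : IsVeryShortP3hat V) (Y : (JP (Fin 2)).carrier) {v : V.carrier}
    (hv : v ∈ plusPart V) : V.act (raiseHat Y) v = 0 := by
  have h1 : V.act (raiseHat Y) (V.act hHat v) = -(1 / 2 : ℂ) • V.act (raiseHat Y) v :=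
    LinearMap.congr_fun (act_raiseHat h Y).2 v
  rw [mem_plusPart.1 hv, map_smul] at h1
  linear_combination (norm := module) h1

lemma raiseHat_raiseHat_apply (h : IsVeryShortP3hat V) (Y Z : (JP (Fin 2)).carrier)
    (v : V.carrier) : V.act (raiseHat Y) (V.act (raiseHat Z) v) = 0 :=
  LinearMap.congr_fun (act_raiseHat_mul_raiseHat h Y Z) v

lemma lowerHat_lowerHat_apply (h : IsVeryShortP3hat V) (v : V.carrier) :
    V.act lowerHat (V.act lowerHat v) = 0 :=
  LinearMap.congr_fun (act_lowerHat_mul_self h) v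

lemma one_apply_add (h : IsVeryShortP3hat V) (v : V.carrier) :
    V.act (raiseHat (jpOne (Fin 2))) (V.act lowerHat v)
      + V.act lowerHat (V.act (raiseHat (jpOne (Fin 2))) v) = (1 / 2 : ℂ) • v :=
  LinearMap.congr_fun (act_one_add h) v

lemma one_lowerHat_apply_of_mem (h : IsVeryShortP3hat V) {v : V.carrier} (hv : v ∈ plusPart V) :
    V.act (raiseHat (jpOne (Fin 2))) (V.act lowerHat v) = (1 / 2 : ℂ) • v := by
  have := one_apply_add h v
  rwa [raiseHat_apply_of_mem h _ hv, map_zero, add_zero] at this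

variable (V) in
/-- The operators `2 a f`, up to the factor `2`, on the whole of `V`. -/
def raiseLower : SuperRep (JP (Fin 2)).carrier where
  carrier := V.carrier
  grading := V.grading
  isInternal := V.isInternal
  act := LinearMap.mulRight ℂ (V.act lowerHat) ∘ₗ V.act ∘ₗ raiseHat

/-- The special module `V[½]`. -/
def plusRep (h : IsVeryShortP3hat V) : SuperRep (JP (Fin 2)).carrier :=
  (raiseLower V).restrict (plusPart V) (fun i _ hv => parityProj_mem_plusPart h i hv)
    (fun Y v _ => raiseHat_apply_mem h Y (V.act lowerHat v))

lemma isSpecialJP2_plusRep (h : IsVeryShortP3hat V) : IsSpecialJP2 (plusRep h) := by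
  rw [isSpecialJP2_iff]
  refine ⟨⟨fun i j Y hY (v : plusPart V) hv => ?_,
    fun i j Y hY Z hZ (v : plusPart V) => Subtype.ext ?_⟩, ?_⟩
  · have h1 := h.1.1 0 j _ lowerHat_mem _ hv
    rw [zero_add] at h1
    exact h.1.1 i j _ (raiseHat_mem hY) _ h1
  · exact LinearMap.congr_fun (act_raiseHat_mul h hY hZ) (V.act lowerHat v.1)
  · exact LinearMap.ext fun (v : plusPart V) =>
      Subtype.ext (one_lowerHat_apply_of_mem h v.2)

/-- The restriction of a morphism to the eigenspaces. -/
def plusMap (h : IsVeryShortP3hat V) (k : IsVeryShortP3hat W) (f : V ⟶ W) :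
    plusRep h ⟶ plusRep k :=
  SuperRep.Hom.mk
    ((SuperRep.Hom.toLin f).restrict (p := plusPart V) (q := plusPart W) fun v hv => by
      rw [mem_plusPart, ← SuperRep.Hom.map_act, mem_plusPart.1 hv, map_smul])
    (fun i _ hv => SuperRep.Hom.map_grading f i _ hv)
    (fun Y (v : plusPart V) => Subtype.ext
      ((SuperRep.Hom.map_act f (raiseHat Y) (V.act lowerHat v.1)).trans
        (congrArg (W.act (raiseHat Y)) (SuperRep.Hom.map_act f lowerHat v.1))))

lemma plusMap_injective (h : IsVeryShortP3hat V) (k : IsVeryShortP3hat W) {f g : V ⟶ W}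
    (hfg : plusMap h k f = plusMap h k g) : f = g := by
  have key : ∀ v ∈ plusPart V, SuperRep.Hom.toLin f v = SuperRep.Hom.toLin g v := fun v hv =>
    congrArg Subtype.val (LinearMap.congr_fun (congrArg SuperRep.Hom.toLin hfg) (⟨v, hv⟩ : plusPart V))
  refine SuperRep.hom_ext (LinearMap.ext fun v => ?_)
  have hv : v = (2 : ℂ) • (V.act (raiseHat (jpOne (Fin 2))) (V.act lowerHat v)
      + V.act lowerHat (V.act (raiseHat (jpOne (Fin 2))) v)) := by
    rw [one_apply_add h]; module
  rw [hv, map_smul, map_smul, map_add, map_add, key _ (raiseHat_apply_mem h _ _),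
    SuperRep.Hom.map_act f, key _ (raiseHat_apply_mem h _ _), ← SuperRep.Hom.map_act g]

/-- A linear map that commutes with the lifts of `f` and of the component of degree `1` is a
morphism. -/
lemma map_act_of_generators (h : IsLieModule P3hat V) (k : IsLieModule P3hat W)
    (T : V.carrier →ₗ[ℂ] W.carrier) (hf : ∀ v, T (V.act lowerHat v) = W.act lowerHat (T v))
    (hJ : ∀ Y v, T (V.act (raiseHat Y) v) = W.act (raiseHat Y) (T v)) (u : P3hat.carrier)
    (v : V.carrier) : T (V.act u v) = W.act u (T v) := by
  let K : Submodule ℂ P3hat.carrier :=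
    LinearMap.eqLocus ((LinearMap.compRight ℂ T) ∘ₗ V.act) ((LinearMap.lcomp ℂ _ T) ∘ₗ W.act)
  have hK : ∀ {u}, u ∈ K ↔ ∀ v, T (V.act u v) = W.act u (T v) := fun {u} => LinearMap.ext_iff
  have hbr : ∀ i j, ∀ u ∈ P3hat.grading i, ∀ w ∈ P3hat.grading j, u ∈ K → w ∈ K →
      P3hat.bracket u w ∈ K := by
    intro i j u hu w hw hu' hw'
    rw [hK] at *
    intro v
    rw [h.2 i j u hu w hw, k.2 i j u hu w hw, map_sub, map_smul, hu', hw', hw', hu']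
  let M : ZMod 2 → Submodule ℂ P3.carrier := fun i => (P3hat.grading i ⊓ K).map (uceProj P3)
  have hM : ∀ i, ∀ x ∈ P3.grading i, x ∈ M i := by
    intro i x hx
    refine mem_of_generators (M := M) ?_ ?_ ?_ hx
    · rintro i j _ ⟨u, ⟨hu, hu'⟩, rfl⟩ _ ⟨w, ⟨hw, hw'⟩, rfl⟩
      exact ⟨P3hat.bracket u w, ⟨P3hat.bracket_mem i j u hu w hw, hbr i j u hu w hw hu' hw'⟩,
        uceProj_bracket P3 u w⟩
    · exact fun i Y hY => ⟨raiseHat Y, ⟨raiseHat_mem hY, hK.2 (hJ Y)⟩, uceProj_raiseHat Y⟩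
    · exact ⟨lowerHat, ⟨lowerHat_mem, hK.2 hf⟩, uceProj_lowerHat⟩
  suffices hu : LinearMap.compRight ℂ T ∘ₗ V.act = LinearMap.lcomp ℂ _ T ∘ₗ W.act from
    LinearMap.congr_fun (LinearMap.congr_fun hu u) v
  refine linearMap_ext_of_homogeneous P3hat.isInternal fun i u hu => ?_
  have hle : uceGrading P3 i ≤ K := by
    refine Submodule.span_le.2 ?_
    rintro _ ⟨i, j, rfl, x, hx, y, hy, rfl⟩
    obtain ⟨u, ⟨hu, hu'⟩, rfl⟩ := hM i x hx
    obtain ⟨w, ⟨hw, hw'⟩, rfl⟩ := hM j y hy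
    exact hbr i j u hu w hw hu' hw'
  exact hle hu

lemma plusMap_surjective (h : IsVeryShortP3hat V) (k : IsVeryShortP3hat W)
    (g : plusRep h ⟶ plusRep k) : ∃ f, plusMap h k f = g := by
  let S : plusPart V →ₗ[ℂ] plusPart W := SuperRep.Hom.toLin g
  have hS : ∀ Y (v : plusPart V), (S ⟨V.act (raiseHat Y) (V.act lowerHat v),
      raiseHat_apply_mem h Y _⟩ : W.carrier) = W.act (raiseHat Y) (W.act lowerHat (S v)) :=
    fun Y v => congrArg Subtype.val (SuperRep.Hom.map_act g Y v)
  let q : V.carrier →ₗ[ℂ] plusPart V :=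
    (V.act (raiseHat (jpOne (Fin 2)))).codRestrict (plusPart V) fun v => raiseHat_apply_mem h _ v
  let T : V.carrier →ₗ[ℂ] W.carrier := (2 : ℂ) • ((plusPart W).subtype ∘ₗ S ∘ₗ q ∘ₗ V.act lowerHat
    + W.act lowerHat ∘ₗ (plusPart W).subtype ∘ₗ S ∘ₗ q)
  have hT : ∀ v, T v = (2 : ℂ) • ((S (q (V.act lowerHat v)) : W.carrier)
    + W.act lowerHat (S (q v))) := fun v => rfl
  have hq0 : ∀ v ∈ plusPart V, q v = 0 := fun v hv =>
    Subtype.ext (raiseHat_apply_of_mem h _ hv)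
  have hq1 : ∀ v (hv : v ∈ plusPart V), q (V.act lowerHat v) = (1 / 2 : ℂ) • ⟨v, hv⟩ :=
    fun v hv => Subtype.ext (one_lowerHat_apply_of_mem h hv)
  have hTS : ∀ v (hv : v ∈ plusPart V), T v = S ⟨v, hv⟩ := by
    intro v hv
    rw [hT, hq0 v hv, hq1 v hv, map_zero, Submodule.coe_zero, map_zero, add_zero, map_smul,
      Submodule.coe_smul]
    module
  have hf : ∀ v, T (V.act lowerHat v) = W.act lowerHat (T v) := by
    intro v
    rw [hT, hT, lowerHat_lowerHat_apply h, map_zero, map_zero, Submodule.coe_zero, zero_add,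
      map_smul, map_add, lowerHat_lowerHat_apply k, add_zero]
  have hJ : ∀ Y v, T (V.act (raiseHat Y) v) = W.act (raiseHat Y) (T v) := by
    intro Y v
    rw [hTS _ (raiseHat_apply_mem h Y v), hT, map_smul, map_add,
      raiseHat_apply_of_mem k Y (S (q (V.act lowerHat v))).2, zero_add, ← hS Y (q v),
      ← Submodule.coe_smul, ← map_smul]
    congr 2
    refine Subtype.ext ?_
    change V.act (raiseHat Y) v = (2 : ℂ) • V.act (raiseHat Y)
      (V.act lowerHat (V.act (raiseHat (jpOne (Fin 2))) v))
    have := congrArg (V.act (raiseHat Y)) (one_apply_add h v)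
    rw [map_add, raiseHat_raiseHat_apply h, zero_add, map_smul] at this
    rw [this]
    module
  have hq : ∀ i, ∀ v ∈ V.grading i, (S (q v) : W.carrier) ∈ W.grading i := by
    intro i v hv
    have h1 := h.1.1 0 i _ (raiseHat_mem jpOne_mem) v hv
    rw [zero_add] at h1
    exact SuperRep.Hom.map_grading g i (q v) h1
  refine ⟨SuperRep.Hom.mk T (fun i v hv => ?_) (map_act_of_generators h.1 k.1 T hf hJ), ?_⟩
  · have h1 := h.1.1 0 i _ lowerHat_mem v hv
    have h2 := k.1.1 0 i _ lowerHat_mem _ (hq i v hv)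
    rw [zero_add] at h1 h2
    exact Submodule.smul_mem _ _ (Submodule.add_mem _ (hq i _ h1) h2)
  · exact SuperRep.hom_ext (LinearMap.ext fun v => Subtype.ext (hTS v.1 v.2))

end

/-- The functor `V ↦ V[½]` from very short graded modules to special modules. -/
def plusFunctor : P3hatModHalf ⥤ JP2ModHalf where
  obj V := ⟨plusRep V.property, isSpecialJP2_plusRep V.property⟩
  map {V W} f := ObjectProperty.homMk (plusMap V.property W.property f.hom)

instance : plusFunctor.Additive where

instance : plusFunctor.Linear ℂ where

instance : plusFunctor.Faithful where
  map_injective {V W} _ _ h := ObjectProperty.hom_ext _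
    (plusMap_injective V.property W.property (congrArg (fun k => k.hom) h))

instance : plusFunctor.Full where
  map_surjective {V W} g := by
    obtain ⟨f, hf⟩ := plusMap_surjective V.property W.property g.hom
    exact ⟨ObjectProperty.homMk f, ObjectProperty.hom_ext _ hf⟩

/-! ### Lifting projective representations to the universal central extension -/

section Lift

variable {L : LieSuperalgebra} {m : Type} [Fintype m] [DecidableEq m]

/-- The supercommutator of the operators `θ x` and `θ y`. -/
def superBilin (θ : L.carrier →ₗ[ℂ] Matrix m m ℂ[X]) :
    L.carrier →ₗ[ℂ] L.carrier →ₗ[ℂ] Matrix m m ℂ[X] :=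
  ∑ i : ZMod 2, ∑ j : ZMod 2,
    ((LinearMap.mul ℂ (Matrix m m ℂ[X])).compl₁₂ (θ ∘ₗ parityProj L.isInternal i)
        (θ ∘ₗ parityProj L.isInternal j)
      - ksgn i j • (LinearMap.mul ℂ (Matrix m m ℂ[X])).flip.compl₁₂
        (θ ∘ₗ parityProj L.isInternal i) (θ ∘ₗ parityProj L.isInternal j))

lemma superBilin_of_mem (θ : L.carrier →ₗ[ℂ] Matrix m m ℂ[X]) {i j : ZMod 2} {x y : L.carrier}
    (hx : x ∈ L.grading i) (hy : y ∈ L.grading j) :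
    superBilin θ x y = θ x * θ y - ksgn i j • (θ y * θ x) := by
  simp only [superBilin, LinearMap.sum_apply, LinearMap.sub_apply, LinearMap.smul_apply,
    LinearMap.compl₁₂_apply, LinearMap.flip_apply, LinearMap.mul_apply', LinearMap.comp_apply,
    parityProj_of_mem L.isInternal hx, parityProj_of_mem L.isInternal hy]
  rw [Finset.sum_eq_single i (by intro b _ hb; simp [hb]) (by simp),
    Finset.sum_eq_single j (by intro b _ hb; simp [hb]) (by simp)]
  simp

/-- `θ` preserves brackets up to scalars, which occur only for brackets of odd elements. -/
def IsProjectiveRep (θ : L.carrier →ₗ[ℂ] Matrix m m ℂ[X]) : Prop :=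
  ∀ i j : ZMod 2, ∀ x ∈ L.grading i, ∀ y ∈ L.grading j, ∃ p : ℂ[X],
    superBilin θ x y = θ (L.bracket x y) + p • 1 ∧ (i = 1 ∧ j = 1 ∨ p = 0)

variable {θ : L.carrier →ₗ[ℂ] Matrix m m ℂ[X]}

lemma superBilin_jacobi (hθ : IsProjectiveRep θ) {i j k : ZMod 2} {x y z : L.carrier}
    (hx : x ∈ L.grading i) (hy : y ∈ L.grading j) (hz : z ∈ L.grading k) :
    superBilin θ x (L.bracket y z)
      = superBilin θ (L.bracket x y) z + ksgn i j • superBilin θ y (L.bracket x z) := by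
  obtain ⟨p, h1, hp⟩ := hθ j k y hy z hz
  obtain ⟨q, h2, hq⟩ := hθ i j x hx y hy
  obtain ⟨r, h3, hr⟩ := hθ i k x hx z hz
  rw [superBilin_of_mem θ hx (L.bracket_mem j k y hy z hz),
    superBilin_of_mem θ (L.bracket_mem i j x hx y hy) hz,
    superBilin_of_mem θ hy (L.bracket_mem i k x hx z hz), eq_sub_of_add_eq h1.symm,
    eq_sub_of_add_eq h2.symm, eq_sub_of_add_eq h3.symm, superBilin_of_mem θ hx hy,
    superBilin_of_mem θ hx hz, superBilin_of_mem θ hy hz]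
  rcases zmod2_cases i with rfl | rfl <;> rcases zmod2_cases j with rfl | rfl <;>
    rcases zmod2_cases k with rfl | rfl <;>
    simp only [zero_ne_one, and_false, false_and, false_or, and_self, true_or] at hp hq hr <;>
    try subst hp
  all_goals try subst hq
  all_goals try subst hr
  all_goals
    simp only [ksgn_00, ksgn_01, ksgn_10, ksgn_11, add_zero, zero_add,
      show (1 : ZMod 2) + 1 = 0 from rfl, one_smul, neg_smul, zero_smul, sub_zero, mul_sub, sub_mul,
      mul_smul_comm, smul_mul_assoc, mul_one, one_mul, sub_neg_eq_add, mul_add, add_mul, mul_assoc]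
    abel

/-- The lift of a projective representation to the universal central extension. -/
def uceLift (hθ : IsProjectiveRep θ) : UceCarrier L →ₗ[ℂ] Matrix m m ℂ[X] :=
  (uceRel L).liftQ (TensorProduct.lift (superBilin θ)) (by
    rw [uceRel, Submodule.span_le]
    rintro w (⟨i, j, x, hx, y, hy, rfl⟩ | ⟨i, j, k, x, hx, y, hy, z, hz, rfl⟩)
    · rw [SetLike.mem_coe, LinearMap.mem_ker, map_add, map_smul, TensorProduct.lift.tmul,
        TensorProduct.lift.tmul, superBilin_of_mem θ hx hy, superBilin_of_mem θ hy hx,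
        ksgn_comm j i, smul_sub, smul_smul, ksgn_mul_self]
      module
    · rw [SetLike.mem_coe, LinearMap.mem_ker, map_sub, map_sub, map_smul, TensorProduct.lift.tmul,
        TensorProduct.lift.tmul, TensorProduct.lift.tmul, superBilin_jacobi hθ hx hy hz]
      abel)

lemma uceLift_pair (hθ : IsProjectiveRep θ) (x y : L.carrier) :
    uceLift hθ (ucePair L x y) = superBilin θ x y := by
  simp [uceLift, ucePair]

lemma uceLift_pair_of_even (hθ : IsProjectiveRep θ) {x y : L.carrier} (hx : x ∈ L.grading 0)
    {j : ZMod 2} (hy : y ∈ L.grading j) : uceLift hθ (ucePair L x y) = θ (L.bracket x y) := by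
  obtain ⟨p, h, hp⟩ := hθ 0 j x hx y hy
  rw [uceLift_pair, h, hp.resolve_left (by simp), zero_smul, add_zero]

lemma exists_uceLift_eq (hθ : IsProjectiveRep θ) {k : ZMod 2} {u : UceCarrier L}
    (hu : u ∈ uceGrading L k) :
    ∃ p : ℂ[X], uceLift hθ u = θ (uceProj L u) + p • 1 ∧ (k = 0 ∨ p = 0) := by
  rw [uceGrading] at hu
  induction hu using Submodule.span_induction with
  | mem u hu =>
    obtain ⟨i, j, rfl, x, hx, y, hy, rfl⟩ := hu
    obtain ⟨p, h, hp⟩ := hθ i j x hx y hy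
    refine ⟨p, by rw [uceLift_pair, h, uceProj_pair], hp.imp_left ?_⟩
    rintro ⟨rfl, rfl⟩
    rfl
  | zero => exact ⟨0, by simp, Or.inr rfl⟩
  | add u v _ _ h h' =>
    obtain ⟨p, h, hp⟩ := h
    obtain ⟨q, h', hq⟩ := h'
    refine ⟨p + q, by rw [map_add, map_add, map_add, h, h', add_smul]; abel, ?_⟩
    rcases hp with hp | rfl
    · exact Or.inl hp
    · exact hq.imp_right fun h => by rw [h, add_zero]
  | smul c u _ h =>
    obtain ⟨p, h, hp⟩ := h
    refine ⟨c • p, by rw [map_smul, map_smul, map_smul, h, smul_add, smul_assoc], ?_⟩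
    exact hp.imp_right fun h => by rw [h, smul_zero]

lemma uceLift_bracket (hθ : IsProjectiveRep θ) {i j : ZMod 2} {u v : UceCarrier L}
    (hu : u ∈ uceGrading L i) (hv : v ∈ uceGrading L j) :
    uceLift hθ (uceBracket L u v)
      = uceLift hθ u * uceLift hθ v - ksgn i j • (uceLift hθ v * uceLift hθ u) := by
  obtain ⟨p, h, hp⟩ := exists_uceLift_eq hθ hu
  obtain ⟨q, h', hq⟩ := exists_uceLift_eq hθ hv
  rw [uceBracket_apply, uceLift_pair, superBilin_of_mem θ (uceProj_mem L hu) (uceProj_mem L hv),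
    h, h']
  rcases zmod2_cases i with rfl | rfl <;> rcases zmod2_cases j with rfl | rfl <;>
    simp only [one_ne_zero, false_or] at hp hq
  all_goals try subst hp
  all_goals try subst hq
  all_goals
    simp only [ksgn_00, ksgn_01, ksgn_10, ksgn_11, one_smul, neg_smul, zero_smul, add_zero, mul_add,
      add_mul, mul_smul_comm, smul_mul_assoc, mul_one, one_mul]
    try module

end Lift

/-! ### The family of projective representations of `P(3)` by `(4|4)`-matrices -/

/-- The negative of the Pfaffian dual of a skew-symmetric matrix of size `4`. -/
def pfDual : Matrix (Fin 2 ⊕ Fin 2) (Fin 2 ⊕ Fin 2) ℂ →ₗ[ℂ] Matrix (Fin 2 ⊕ Fin 2) (Fin 2 ⊕ Fin 2) ℂ where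
  toFun M := fromBlocks (-M.toBlocks₂₂) (M.toBlocks₁₂.trace • 1 - M.toBlocks₁₂ᵀ)
    (M.toBlocks₁₂ - M.toBlocks₁₂.trace • 1) (-M.toBlocks₁₁)
  map_add' M M' := by
    apply Matrix.ext
    rintro (i | i) (j | j) <;>
      simp [toBlocks₁₁, toBlocks₁₂, toBlocks₂₂, trace, Matrix.one_apply] <;> (try split_ifs) <;> ring
  map_smul' c M := by
    apply Matrix.ext
    rintro (i | i) (j | j) <;>
      simp [toBlocks₁₁, toBlocks₁₂, toBlocks₂₂, trace, Matrix.one_apply] <;> split_ifs <;> ring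

lemma pfDual_apply (M : Matrix (Fin 2 ⊕ Fin 2) (Fin 2 ⊕ Fin 2) ℂ) : pfDual M
    = fromBlocks (-M.toBlocks₂₂) (M.toBlocks₁₂.trace • 1 - M.toBlocks₁₂ᵀ)
      (M.toBlocks₁₂ - M.toBlocks₁₂.trace • 1) (-M.toBlocks₁₁) := rfl

/-- A skew-symmetric matrix of size `4`. -/
def skewMat (a b p q r s : ℂ) : Matrix (Fin 2 ⊕ Fin 2) (Fin 2 ⊕ Fin 2) ℂ :=
  fromBlocks !![0, a; -a, 0] !![p, q; r, s] !![-p, -r; -q, -s] !![0, b; -b, 0]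

lemma exists_eq_skewMat {C : Matrix (Fin 2 ⊕ Fin 2) (Fin 2 ⊕ Fin 2) ℂ} (hC : Cᵀ = -C) :
    ∃ a b p q r s, C = skewMat a b p q r s := by
  have hCt : ∀ i j, C j i = -C i j := fun i j => congrFun (congrFun hC i) j
  refine ⟨C (Sum.inl 0) (Sum.inl 1), C (Sum.inr 0) (Sum.inr 1), C (Sum.inl 0) (Sum.inr 0),
    C (Sum.inl 0) (Sum.inr 1), C (Sum.inl 1) (Sum.inr 0), C (Sum.inl 1) (Sum.inr 1), ?_⟩
  have h0 : ∀ i, C i i = 0 := fun i => self_eq_neg.1 (hCt i i)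
  apply Matrix.ext
  rintro (i | i) (j | j) <;> fin_cases i <;> fin_cases j <;> simp [skewMat, h0]
  all_goals exact hCt _ _

lemma pfDual_skewMat (a b p q r s : ℂ) :
    pfDual (skewMat a b p q r s) = skewMat (-b) (-a) s (-r) (-q) p := by
  rw [pfDual_apply, skewMat, skewMat, toBlocks_fromBlocks₁₁, toBlocks_fromBlocks₁₂,
    toBlocks_fromBlocks₂₂]
  congr 1 <;> ext i j <;> fin_cases i <;> fin_cases j <;> simp

lemma skewMat_mul_dual (a b p q r s a' b' p' q' r' s' : ℂ) :
    skewMat a b p q r s * skewMat (-b') (-a') s' (-r') (-q') p'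
      + skewMat a' b' p' q' r' s' * skewMat (-b) (-a) s (-r) (-q) p
    = (a * b' + a' * b - p * s' - p' * s + q * r' + q' * r) • 1 := by
  apply Matrix.ext
  rintro (i | i) (j | j) <;> fin_cases i <;> fin_cases j <;>
    simp [skewMat, Matrix.mul_apply, Fin.sum_univ_two] <;> ring

lemma exists_mul_pfDual_add {C C' : Matrix (Fin 2 ⊕ Fin 2) (Fin 2 ⊕ Fin 2) ℂ} (hC : Cᵀ = -C)
    (hC' : C'ᵀ = -C') : ∃ s : ℂ, C * pfDual C' + C' * pfDual C = s • 1 ∧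
      pfDual C * C' + pfDual C' * C = s • 1 := by
  obtain ⟨a, b, p, q, r, s, rfl⟩ := exists_eq_skewMat hC
  obtain ⟨a', b', p', q', r', s', rfl⟩ := exists_eq_skewMat hC'
  rw [pfDual_skewMat, pfDual_skewMat]
  refine ⟨_, skewMat_mul_dual _ _ _ _ _ _ _ _ _ _ _ _, ?_⟩
  have h := skewMat_mul_dual (-b) (-a) s (-r) (-q) p (-b') (-a') s' (-r') (-q') p'
  simp only [neg_neg] at h
  rw [h]
  congr 1
  ring

lemma mul_pfDual_add_pfDual_mul {A C : Matrix (Fin 2 ⊕ Fin 2) (Fin 2 ⊕ Fin 2) ℂ}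
    (hA : A.trace = 0) (hC : Cᵀ = -C) :
    A * pfDual C + pfDual C * Aᵀ = -pfDual (Aᵀ * C + C * A) := by
  have hS : (Aᵀ * C + C * A)ᵀ = -(Aᵀ * C + C * A) := by
    simp [transpose_mul, hC, add_comm]
  obtain ⟨a, b, p, q, r, s, h⟩ := exists_eq_skewMat hS
  obtain ⟨a', b', p', q', r', s', rfl⟩ := exists_eq_skewMat hC
  have ht : A (Sum.inr 1) (Sum.inr 1) = -(A (Sum.inl 0) (Sum.inl 0) + A (Sum.inl 1) (Sum.inl 1)
      + A (Sum.inr 0) (Sum.inr 0)) := by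
    simp only [trace, diag_apply, Fintype.sum_sum_type, Fin.sum_univ_two] at hA
    linear_combination hA
  have e : ∀ i j, (Aᵀ * skewMat a' b' p' q' r' s' + skewMat a' b' p' q' r' s' * A) i j
      = skewMat a b p q r s i j := fun i j => congrFun (congrFun h i) j
  have ea := e (Sum.inl 0) (Sum.inl 1)
  have eb := e (Sum.inr 0) (Sum.inr 1)
  have ep := e (Sum.inl 0) (Sum.inr 0)
  have eq := e (Sum.inl 0) (Sum.inr 1)
  have er := e (Sum.inl 1) (Sum.inr 0)
  have es := e (Sum.inl 1) (Sum.inr 1)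
  simp [skewMat, Matrix.mul_apply, Fin.sum_univ_two, ht] at ea eb ep eq er es
  rw [h, pfDual_skewMat, pfDual_skewMat, ← ea, ← eb, ← ep, ← eq, ← er, ← es]
  apply Matrix.ext
  rintro (i | i) (j | j) <;> fin_cases i <;> fin_cases j <;>
    simp [skewMat, Matrix.mul_apply, Fin.sum_univ_two, ht] <;> ring

/-- The coefficient of `x` in the family of representations. -/
def pfShift : SMat (Fin 2 ⊕ Fin 2) →ₗ[ℂ] SMat (Fin 2 ⊕ Fin 2) where
  toFun M := fromBlocks 0 (pfDual M.toBlocks₂₁) 0 0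
  map_add' M M' := by
    have h : (M + M').toBlocks₂₁ = M.toBlocks₂₁ + M'.toBlocks₂₁ := rfl
    rw [h, map_add, fromBlocks_add]
    simp
  map_smul' c M := by
    have h : (c • M).toBlocks₂₁ = c • M.toBlocks₂₁ := rfl
    rw [h, map_smul, RingHom.id_apply, fromBlocks_smul]
    simp

lemma pfShift_fromBlocks (A B C D : Matrix (Fin 2 ⊕ Fin 2) (Fin 2 ⊕ Fin 2) ℂ) :
    pfShift (fromBlocks A B C D) = fromBlocks 0 (pfDual C) 0 0 := rfl

lemma pfShift_mul_pfShift (M M' : SMat (Fin 2 ⊕ Fin 2)) : pfShift M * pfShift M' = 0 := by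
  rw [← fromBlocks_toBlocks M, ← fromBlocks_toBlocks M', pfShift_fromBlocks, pfShift_fromBlocks,
    fromBlocks_multiply]
  simp

lemma exists_pfShift_bracket {i j : ZMod 2} {x y : P3.carrier} (hx : x ∈ P3.grading i)
    (hy : y ∈ P3.grading j) : ∃ s : ℂ,
      x.1 * pfShift y.1 + pfShift x.1 * y.1 - ksgn i j • (y.1 * pfShift x.1 + pfShift y.1 * x.1)
        = pfShift (x.1 * y.1 - ksgn i j • (y.1 * x.1)) + s • 1 ∧ (i = 1 ∧ j = 1 ∨ s = 0) := by
  have hd : ∀ A hA, (p3Diag A hA).1 = fromBlocks A 0 0 (-Aᵀ) := fun _ _ => rfl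
  have ho : ∀ B C hB hC, (p3Odd B C hB hC).1 = fromBlocks 0 B C 0 := fun _ _ _ _ => rfl
  rcases zmod2_cases i with rfl | rfl <;> rcases zmod2_cases j with rfl | rfl
  · obtain ⟨A, hA, rfl⟩ := exists_eq_p3Diag hx
    obtain ⟨A', hA', rfl⟩ := exists_eq_p3Diag hy
    refine ⟨0, ?_, Or.inr rfl⟩
    simp [hd, ksgn_00, pfShift_fromBlocks, fromBlocks_multiply, sub_eq_add_neg, fromBlocks_neg,
      fromBlocks_add]
  · obtain ⟨A, hA, rfl⟩ := exists_eq_p3Diag hx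
    obtain ⟨B, C, hB, hC, rfl⟩ := exists_eq_p3Odd hy
    refine ⟨0, ?_, Or.inr rfl⟩
    have := mul_pfDual_add_pfDual_mul hA hC
    rw [map_add, neg_add_rev] at this
    simp [hd, ho, ksgn_01, pfShift_fromBlocks, fromBlocks_multiply, sub_eq_add_neg, fromBlocks_neg,
      fromBlocks_add, this, add_comm]
  · obtain ⟨A, hA, rfl⟩ := exists_eq_p3Diag hy
    obtain ⟨B, C, hB, hC, rfl⟩ := exists_eq_p3Odd hx
    refine ⟨0, ?_, Or.inr rfl⟩
    have := mul_pfDual_add_pfDual_mul hA hC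
    rw [map_add, ← neg_inj, neg_neg, neg_add_rev] at this
    simp [hd, ho, ksgn_10, pfShift_fromBlocks, fromBlocks_multiply, sub_eq_add_neg, fromBlocks_neg,
      fromBlocks_add]
    exact this.trans (add_comm _ _)
  · obtain ⟨B, C, hB, hC, rfl⟩ := exists_eq_p3Odd hx
    obtain ⟨B', C', hB', hC', rfl⟩ := exists_eq_p3Odd hy
    obtain ⟨s, h1, h2⟩ := exists_mul_pfDual_add hC hC'
    refine ⟨s, ?_, Or.inl ⟨rfl, rfl⟩⟩
    rw [← fromBlocks_one, fromBlocks_smul, ← h1]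
    nth_rewrite 1 [h1]
    rw [← h2]
    simp [ho, ksgn_11, pfShift_fromBlocks, fromBlocks_multiply, fromBlocks_add]

/-- Constant matrices. -/
def constMat : SMat (Fin 2 ⊕ Fin 2) →ₐ[ℂ]
    Matrix ((Fin 2 ⊕ Fin 2) ⊕ (Fin 2 ⊕ Fin 2)) ((Fin 2 ⊕ Fin 2) ⊕ (Fin 2 ⊕ Fin 2)) ℂ[X] :=
  (Algebra.ofId ℂ ℂ[X]).mapMatrix

lemma constMat_apply (M : SMat (Fin 2 ⊕ Fin 2)) : constMat M = M.map C := rfl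

/-- The family `[A, B; C, -Aᵀ] ↦ [A, B + x C*; C, -Aᵀ]` of projective representations, where `C*`
is the negative of the Pfaffian dual of `C`. -/
def p3Theta : P3.carrier →ₗ[ℂ]
    Matrix ((Fin 2 ⊕ Fin 2) ⊕ (Fin 2 ⊕ Fin 2)) ((Fin 2 ⊕ Fin 2) ⊕ (Fin 2 ⊕ Fin 2)) ℂ[X] :=
  (constMat.toLinearMap + LinearMap.mulLeft ℂ (Matrix.scalar _ X) ∘ₗ constMat.toLinearMap ∘ₗ pfShift)
    ∘ₗ (pSpace (Fin 2 ⊕ Fin 2)).subtype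

lemma p3Theta_apply (x : P3.carrier) :
    p3Theta x = constMat x.1 + (X : ℂ[X]) • constMat (pfShift x.1) := by
  refine Eq.trans rfl (congrArg (constMat x.1 + ·) ?_)
  exact (Matrix.smul_eq_diagonal_mul _ _).symm

lemma isProjectiveRep_p3Theta : IsProjectiveRep p3Theta := by
  intro i j x hx y hy
  obtain ⟨s, hs, h⟩ := exists_pfShift_bracket hx hy
  refine ⟨C s * X, ?_, h.imp_right fun h => by rw [h, map_zero, zero_mul]⟩
  have hxy : (P3.bracket x y).1 = x.1 * y.1 - ksgn i j • (y.1 * x.1) := superComm_of_mem hx hy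
  rw [superBilin_of_mem _ hx hy, p3Theta_apply, p3Theta_apply, p3Theta_apply, hxy]
  have h1 : constMat (pfShift (x.1 * y.1 - ksgn i j • (y.1 * x.1)))
      = constMat (x.1 * pfShift y.1 + pfShift x.1 * y.1
        - ksgn i j • (y.1 * pfShift x.1 + pfShift y.1 * x.1)) - s • 1 := by
    rw [hs, map_add, map_smul, map_one, add_sub_cancel_right]
  have h2 : (C s * X : ℂ[X]) • (1 : Matrix ((Fin 2 ⊕ Fin 2) ⊕ (Fin 2 ⊕ Fin 2))
      ((Fin 2 ⊕ Fin 2) ⊕ (Fin 2 ⊕ Fin 2)) ℂ[X]) = (X : ℂ[X]) • s • 1 := by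
    rw [mul_comm, mul_smul, ← Polynomial.algebraMap_eq, algebraMap_smul]
  rw [h1, h2]
  simp only [mul_add, add_mul, smul_mul_assoc, mul_smul_comm, ← map_mul, pfShift_mul_pfShift,
    map_zero, smul_zero, add_zero, map_sub, map_add, map_smul, smul_sub, smul_add]
  simp only [smul_comm (X : ℂ[X]) (ksgn i j)]
  abel

/-- The action of the universal central extension by matrices over `ℂ[x]`. -/
def p3hatTheta : P3hat.carrier →ₗ[ℂ]
    Matrix ((Fin 2 ⊕ Fin 2) ⊕ (Fin 2 ⊕ Fin 2)) ((Fin 2 ⊕ Fin 2) ⊕ (Fin 2 ⊕ Fin 2)) ℂ[X] :=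
  uceLift isProjectiveRep_p3Theta

lemma p3hatTheta_pair {x y : P3.carrier} (hx : x ∈ P3.grading 0) {j : ZMod 2}
    (hy : y ∈ P3.grading j) : p3hatTheta (ucePair P3 x y) = p3Theta (P3.bracket x y) :=
  uceLift_pair_of_even isProjectiveRep_p3Theta hx hy

lemma p3hatTheta_hHat : p3hatTheta hHat = p3Theta p3H := by
  have hE : p3E ∈ P3.grading 0 := p3Diag_mem _ _
  rw [hHat_eq, p3hatTheta_pair hE p3F_mem]
  rfl

lemma p3hatTheta_lowerHat : p3hatTheta lowerHat = p3Theta p3F := by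
  rw [lowerHat, p3hatTheta_pair p3F_mem p3H_mem, p3F_bracket_p3H]

lemma p3hatTheta_raiseHat {i : ZMod 2} {Y : (JP (Fin 2)).carrier}
    (hY : Y ∈ (JP (Fin 2)).grading i) : p3hatTheta (raiseHat Y) = p3Theta (jpRaise Y) := by
  rw [raiseHat_apply, p3hatTheta_pair p3H_mem (jpRaise_mem hY), p3H_bracket_jpRaise]

lemma p3Theta_p3Diag (A : Matrix (Fin 2 ⊕ Fin 2) (Fin 2 ⊕ Fin 2) ℂ) (hA : A.trace = 0) :
    p3Theta (p3Diag A hA) = fromBlocks (A.map C) 0 0 ((-Aᵀ).map C) := by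
  rw [p3Theta_apply, show (p3Diag A hA).1 = fromBlocks A 0 0 (-Aᵀ) from rfl,
    pfShift_fromBlocks, constMat_apply, constMat_apply, fromBlocks_map, fromBlocks_map]
  simp

lemma p3Theta_p3Odd (B D : Matrix (Fin 2 ⊕ Fin 2) (Fin 2 ⊕ Fin 2) ℂ) (hB : Bᵀ = B)
    (hD : Dᵀ = -D) : p3Theta (p3Odd B D hB hD)
      = fromBlocks 0 (B.map C + (X : ℂ[X]) • (pfDual D).map C) (D.map C) 0 := by
  rw [p3Theta_apply, show (p3Odd B D hB hD).1 = fromBlocks 0 B D 0 from rfl,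
    pfShift_fromBlocks, constMat_apply, constMat_apply, fromBlocks_map, fromBlocks_map,
    fromBlocks_smul, fromBlocks_add]
  simp

section

variable (N : PolyModGr)

lemma p3Theta_mem {i j : ZMod 2} {x : P3.carrier} (hx : x ∈ P3.grading i)
    {v : (Fin 2 ⊕ Fin 2) ⊕ (Fin 2 ⊕ Fin 2) → N.obj.carrier}
    (hv : v ∈ columnGrading (Fin 2 ⊕ Fin 2) N j) :
    polyMatAct (Fin 2 ⊕ Fin 2) N (p3Theta x) v ∈ columnGrading (Fin 2 ⊕ Fin 2) N (i + j) := by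
  rcases zmod2_cases i with rfl | rfl
  · obtain ⟨A, hA, rfl⟩ := exists_eq_p3Diag hx
    rw [p3Theta_p3Diag, zero_add]
    exact polyMatAct_even_mem N _ _ hv
  · obtain ⟨B, D, hB, hD, rfl⟩ := exists_eq_p3Odd hx
    rw [p3Theta_p3Odd]
    exact polyMatAct_odd_mem N _ _ hv

lemma p3hatTheta_mem {i j : ZMod 2} {u : P3hat.carrier} (hu : u ∈ P3hat.grading i)
    {v : (Fin 2 ⊕ Fin 2) ⊕ (Fin 2 ⊕ Fin 2) → N.obj.carrier}
    (hv : v ∈ columnGrading (Fin 2 ⊕ Fin 2) N j) :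
    polyMatAct (Fin 2 ⊕ Fin 2) N (p3hatTheta u) v ∈ columnGrading (Fin 2 ⊕ Fin 2) N (i + j) := by
  obtain ⟨p, h, hp⟩ := exists_uceLift_eq isProjectiveRep_p3Theta hu
  have h' : p3hatTheta u = p3Theta (uceProj P3 u) + p • 1 := h
  rw [h', map_add]
  refine Submodule.add_mem _ (p3Theta_mem N (uceProj_mem P3 hu) hv) ?_
  rcases hp with rfl | rfl
  · rw [← fromBlocks_one, fromBlocks_smul, zero_add, smul_zero]
    exact polyMatAct_even_mem N _ _ hv
  · rw [zero_smul, map_zero]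
    exact Submodule.zero_mem _

lemma isLieModule_matRep : IsLieModule P3hat (matRep p3hatTheta N) := by
  refine ⟨fun i j u hu v hv => p3hatTheta_mem N hu hv, fun i j u hu w hw => ?_⟩
  have h : p3hatTheta (P3hat.bracket u w)
      = p3hatTheta u * p3hatTheta w - ksgn i j • (p3hatTheta w * p3hatTheta u) :=
    uceLift_bracket isProjectiveRep_p3Theta hu hw
  have key : ∀ v, polyMatAct (Fin 2 ⊕ Fin 2) N (p3hatTheta (P3hat.bracket u w)) v
      = polyMatAct (Fin 2 ⊕ Fin 2) N (p3hatTheta u) (polyMatAct (Fin 2 ⊕ Fin 2) N (p3hatTheta w) v)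
        - ksgn i j • polyMatAct (Fin 2 ⊕ Fin 2) N (p3hatTheta w)
          (polyMatAct (Fin 2 ⊕ Fin 2) N (p3hatTheta u) v) := by
    intro v
    rw [h, map_sub, map_smul, LinearMap.sub_apply, LinearMap.smul_apply, polyMatAct_mul,
      polyMatAct_mul]
  exact key

variable {N}

lemma polyMatAct_p3Diag (A : Matrix (Fin 2 ⊕ Fin 2) (Fin 2 ⊕ Fin 2) ℂ) (hA : A.trace = 0)
    (n : (Fin 2 ⊕ Fin 2) ⊕ (Fin 2 ⊕ Fin 2) → N.obj.carrier) :
    polyMatAct (Fin 2 ⊕ Fin 2) N (p3Theta (p3Diag A hA)) n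
      = Sum.elim (fun k => ∑ l, A k l • n (Sum.inl l)) (fun k => -∑ l, A l k • n (Sum.inr l)) := by
  rw [p3Theta_p3Diag]
  ext (k | k) : 1 <;> rw [polyMatAct_apply, Fintype.sum_sum_type (M := N.obj.carrier)] <;>
    simp [PolyModGr.act_C, -Fintype.sum_sum_type]

lemma polyMatAct_p3Odd (B D : Matrix (Fin 2 ⊕ Fin 2) (Fin 2 ⊕ Fin 2) ℂ) (hB : Bᵀ = B)
    (hD : Dᵀ = -D) (n : (Fin 2 ⊕ Fin 2) ⊕ (Fin 2 ⊕ Fin 2) → N.obj.carrier) :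
    polyMatAct (Fin 2 ⊕ Fin 2) N (p3Theta (p3Odd B D hB hD)) n
      = Sum.elim (fun k => ∑ l, (B k l • n (Sum.inr l) + pfDual D k l • N.obj.act X (n (Sum.inr l))))
        (fun k => ∑ l, D k l • n (Sum.inl l)) := by
  rw [p3Theta_p3Odd]
  ext (k | k) : 1 <;> rw [polyMatAct_apply, Fintype.sum_sum_type (M := N.obj.carrier)] <;>
    simp [PolyModGr.act_C, PolyModGr.act_mul, mul_comm X, -Fintype.sum_sum_type]

lemma polyMatAct_jpDiag (A : Matrix (Fin 2) (Fin 2) ℂ) (n : Fin 2 ⊕ Fin 2 → N.obj.carrier) :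
    polyMatAct (Fin 2) N (jpTheta (jpDiag A)) n
      = Sum.elim (fun k => (1 / 2 : ℂ) • ∑ l, A k l • n (Sum.inl l))
        (fun k => (1 / 2 : ℂ) • ∑ l, A l k • n (Sum.inr l)) := by
  have h : jpTheta (jpDiag A) = (1 / 2 : ℂ) • fromBlocks (A.map C) 0 0 (Aᵀ.map C) := by
    refine congrArg ((1 / 2 : ℂ) • ·) ((wMat_apply (fromBlocks A 0 0 Aᵀ)).trans ?_)
    apply Matrix.ext
    rintro (i | i) (j | j) <;> simp
  rw [h, map_smul]
  ext (k | k) : 1 <;> rw [LinearMap.smul_apply, Pi.smul_apply, polyMatAct_apply,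
    Fintype.sum_sum_type] <;> simp [PolyModGr.act_C]

lemma polyMatAct_jpOff (B D : Matrix (Fin 2) (Fin 2) ℂ) (hB : Bᵀ = B) (hD : Dᵀ = -D)
    (n : Fin 2 ⊕ Fin 2 → N.obj.carrier) :
    polyMatAct (Fin 2) N (jpTheta (jpOff B D hB hD)) n
      = Sum.elim (fun k => (1 / 2 : ℂ) •
          ∑ l, (B k l • n (Sum.inr l) + D k l • N.obj.act X (n (Sum.inr l))))
        (fun k => (1 / 2 : ℂ) • ∑ l, D k l • n (Sum.inl l)) := by
  have h : jpTheta (jpOff B D hB hD)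
      = (1 / 2 : ℂ) • fromBlocks 0 (B.map C + (X : ℂ[X]) • D.map C) (D.map C) 0 := by
    refine congrArg ((1 / 2 : ℂ) • ·) ((wMat_apply (fromBlocks 0 B D 0)).trans ?_)
    apply Matrix.ext
    rintro (i | i) (j | j) <;> simp
  rw [h, map_smul]
  ext (k | k) : 1 <;> rw [LinearMap.smul_apply, Pi.smul_apply, polyMatAct_apply,
    Fintype.sum_sum_type] <;> simp [PolyModGr.act_C, PolyModGr.act_mul, mul_comm X]

/-- Column vectors in the eigenspace of `h` for the eigenvalue `½`. -/
def plusColumn (N : PolyModGr) : (Fin 2 ⊕ Fin 2 → N.obj.carrier) →ₗ[ℂ]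
    ((Fin 2 ⊕ Fin 2) ⊕ (Fin 2 ⊕ Fin 2) → N.obj.carrier) where
  toFun n := Sum.elim (Sum.elim (fun k => n (Sum.inl k)) 0) (Sum.elim 0 (fun k => n (Sum.inr k)))
  map_add' n n' := by ext ((k | k) | (k | k)) <;> simp
  map_smul' c n := by ext ((k | k) | (k | k)) <;> simp

lemma plusColumn_apply (n : Fin 2 ⊕ Fin 2 → N.obj.carrier) : plusColumn N n
    = Sum.elim (Sum.elim (fun k => n (Sum.inl k)) 0) (Sum.elim 0 (fun k => n (Sum.inr k))) := rfl

lemma polyMatAct_p3H (n : (Fin 2 ⊕ Fin 2) ⊕ (Fin 2 ⊕ Fin 2) → N.obj.carrier) :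
    polyMatAct (Fin 2 ⊕ Fin 2) N (p3Theta p3H) n
      = Sum.elim (Sum.elim (fun k => (1 / 2 : ℂ) • n (Sum.inl (Sum.inl k)))
          (fun k => -(1 / 2 : ℂ) • n (Sum.inl (Sum.inr k))))
        (Sum.elim (fun k => -(1 / 2 : ℂ) • n (Sum.inr (Sum.inl k)))
          (fun k => (1 / 2 : ℂ) • n (Sum.inr (Sum.inr k)))) := by
  rw [p3H_eq, polyMatAct_p3Diag]
  ext ((k | k) | (k | k)) <;> fin_cases k <;> simp

lemma polyMatAct_p3F_plusColumn (n : Fin 2 ⊕ Fin 2 → N.obj.carrier) :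
    polyMatAct (Fin 2 ⊕ Fin 2) N (p3Theta p3F) (plusColumn N n)
      = Sum.elim (Sum.elim (fun _ => 0) (fun k => (1 / 2 : ℂ) • n (Sum.inl k)))
        (Sum.elim (fun k => -(1 / 2 : ℂ) • n (Sum.inr k)) (fun _ => 0)) := by
  rw [p3F_eq, polyMatAct_p3Diag, plusColumn_apply]
  ext ((k | k) | (k | k)) <;> fin_cases k <;> simp

lemma polyMatAct_raise_lower {i : ZMod 2} {Y : (JP (Fin 2)).carrier}
    (hY : Y ∈ (JP (Fin 2)).grading i) (n : Fin 2 ⊕ Fin 2 → N.obj.carrier) :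
    polyMatAct (Fin 2 ⊕ Fin 2) N (p3Theta (jpRaise Y))
        (polyMatAct (Fin 2 ⊕ Fin 2) N (p3Theta p3F) (plusColumn N n))
      = plusColumn N (polyMatAct (Fin 2) N (jpTheta Y) n) := by
  rw [polyMatAct_p3F_plusColumn]
  rcases zmod2_cases i with rfl | rfl
  · obtain ⟨A, rfl⟩ := exists_eq_jpDiag hY
    rw [jpRaise_jpDiag, polyMatAct_p3Diag, polyMatAct_jpDiag, plusColumn_apply]
    ext ((k | k) | (k | k)) <;> simp <;> module
  · obtain ⟨B, D, hB, hD, rfl⟩ := exists_eq_jpOff hY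
    have h : pfDual (fromBlocks 0 0 0 D) = fromBlocks (-D) 0 0 0 := by
      rw [pfDual_apply]
      simp
    rw [jpRaise_jpOff, polyMatAct_p3Odd, polyMatAct_jpOff, plusColumn_apply, h]
    ext ((k | k) | (k | k)) <;> simp <;> module

end

section

variable (N : PolyModGr)

lemma isVeryShortP3hat_matRep : IsVeryShortP3hat (matRep p3hatTheta N) := by
  refine ⟨isLieModule_matRep N, (eigenspace_half_sup_eq_top_iff _).2 ?_⟩
  have key : ∀ n, polyMatAct (Fin 2 ⊕ Fin 2) N (p3hatTheta hHat)
      (polyMatAct (Fin 2 ⊕ Fin 2) N (p3hatTheta hHat) n) = (1 / 4 : ℂ) • n := by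
    intro n
    rw [p3hatTheta_hHat, polyMatAct_p3H, polyMatAct_p3H]
    ext ((k | k) | (k | k)) <;> simp [smul_smul] <;> norm_num
  exact LinearMap.ext key

lemma plusColumn_mem_plusPart (n : Fin 2 ⊕ Fin 2 → N.obj.carrier) :
    plusColumn N n ∈ plusPart (matRep p3hatTheta N) := by
  have key : polyMatAct (Fin 2 ⊕ Fin 2) N (p3hatTheta hHat) (plusColumn N n)
      = (1 / 2 : ℂ) • plusColumn N n := by
    rw [p3hatTheta_hHat, polyMatAct_p3H, plusColumn_apply]
    ext ((k | k) | (k | k)) <;> simp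
  exact (mem_plusPart (V := matRep p3hatTheta N)).2 key

/-- `plusColumn` as an isomorphism onto the eigenspace. -/
def plusColumnEquiv : (Fin 2 ⊕ Fin 2 → N.obj.carrier) ≃ₗ[ℂ] plusPart (matRep p3hatTheta N) :=
  LinearEquiv.ofBijective
    (LinearMap.codRestrict (plusPart (matRep p3hatTheta N)) (plusColumn N)
      (plusColumn_mem_plusPart N)) (by
    constructor
    · intro n n' h
      have h' : plusColumn N n = plusColumn N n' := congrArg Subtype.val h
      ext (k | k)
      · exact congrFun h' (Sum.inl (Sum.inl k))
      · exact congrFun h' (Sum.inr (Sum.inr k))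
    · rintro ⟨v, hv⟩
      let w : (Fin 2 ⊕ Fin 2) ⊕ (Fin 2 ⊕ Fin 2) → N.obj.carrier := v
      have hv' := (polyMatAct_p3H (N := N) w).symm.trans
        ((congrArg (fun M => polyMatAct (Fin 2 ⊕ Fin 2) N M w) p3hatTheta_hHat).symm.trans
          (mem_plusPart.1 hv))
      have h1 : ∀ k, w (Sum.inl (Sum.inr k)) = 0 := fun k => by
        have h : -(1 / 2 : ℂ) • w (Sum.inl (Sum.inr k)) = (1 / 2 : ℂ) • w (Sum.inl (Sum.inr k)) :=
          congrFun hv' (Sum.inl (Sum.inr k))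
        linear_combination (norm := module) -h
      have h2 : ∀ k, w (Sum.inr (Sum.inl k)) = 0 := fun k => by
        have h : -(1 / 2 : ℂ) • w (Sum.inr (Sum.inl k)) = (1 / 2 : ℂ) • w (Sum.inr (Sum.inl k)) :=
          congrFun hv' (Sum.inr (Sum.inl k))
        linear_combination (norm := module) -h
      refine ⟨Sum.elim (fun k => w (Sum.inl (Sum.inl k))) (fun k => w (Sum.inr (Sum.inr k))),
        Subtype.ext ?_⟩
      change plusColumn N _ = w
      rw [plusColumn_apply]
      ext ((k | k) | (k | k))
      · rfl
      · exact (h1 k).symm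
      · exact (h2 k).symm
      · rfl)

lemma plusColumn_act (Y : (JP (Fin 2)).carrier) (n : Fin 2 ⊕ Fin 2 → N.obj.carrier) :
    plusColumn N (polyMatAct (Fin 2) N (jpTheta Y) n)
      = polyMatAct (Fin 2 ⊕ Fin 2) N (p3hatTheta (raiseHat Y))
        (polyMatAct (Fin 2 ⊕ Fin 2) N (p3hatTheta lowerHat) (plusColumn N n)) := by
  let L : (JP (Fin 2)).carrier →ₗ[ℂ] ((Fin 2 ⊕ Fin 2) ⊕ (Fin 2 ⊕ Fin 2) → N.obj.carrier) :=
    plusColumn N ∘ₗ LinearMap.applyₗ (R := ℂ) n ∘ₗ polyMatAct (Fin 2) N ∘ₗ jpTheta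
  let L' : (JP (Fin 2)).carrier →ₗ[ℂ] ((Fin 2 ⊕ Fin 2) ⊕ (Fin 2 ⊕ Fin 2) → N.obj.carrier) :=
    LinearMap.applyₗ (R := ℂ)
        (polyMatAct (Fin 2 ⊕ Fin 2) N (p3hatTheta lowerHat) (plusColumn N n)) ∘ₗ
      polyMatAct (Fin 2 ⊕ Fin 2) N ∘ₗ p3hatTheta ∘ₗ raiseHat
  refine LinearMap.congr_fun (f := L) (g := L')
    (linearMap_ext_of_homogeneous (JP (Fin 2)).isInternal fun i Y hY => ?_) Y
  change plusColumn N (polyMatAct (Fin 2) N (jpTheta Y) n)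
    = polyMatAct (Fin 2 ⊕ Fin 2) N (p3hatTheta (raiseHat Y))
      (polyMatAct (Fin 2 ⊕ Fin 2) N (p3hatTheta lowerHat) (plusColumn N n))
  rw [p3hatTheta_raiseHat hY, p3hatTheta_lowerHat, polyMatAct_raise_lower hY]

/-- The special module `ℂ^{2|2} ⊗ N` is the eigenspace of `ℂ^{4|4} ⊗ N`. -/
def plusRepIso : matRep jpTheta N ≅ plusRep (isVeryShortP3hat_matRep N) :=
  SuperRep.isoOfEquiv (V := matRep jpTheta N) (W := plusRep (isVeryShortP3hat_matRep N))
    (plusColumnEquiv N)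
    (fun i n hn => by
      constructor
      · rintro (k | k)
        · exact hn.1 k
        · exact Submodule.zero_mem _
      · rintro (k | k)
        · exact Submodule.zero_mem _
        · exact hn.2 k)
    (fun Y n => Subtype.ext (plusColumn_act N Y n))

end

instance : plusFunctor.EssSurj where
  mem_essImage S :=
    ⟨⟨matRep p3hatTheta (jpFunctor.objPreimage S), isVeryShortP3hat_matRep _⟩,
      ⟨(ObjectProperty.isoMk _ (plusRepIso (jpFunctor.objPreimage S))).symm ≪≫
        jpFunctor.objObjPreimageIso S⟩⟩

instance : plusFunctor.IsEquivalence where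

lemma PolyModGr.line_act (t : ℂ) (d : ZMod 2) (p : ℂ[X]) (z : ℂ) :
    (PolyModGr.line t d).obj.act p z = p.eval t * z := by
  have h : aeval (t • LinearMap.id : Module.End ℂ ℂ) p = p.eval t • LinearMap.id := by
    change aeval (algebraMap ℂ (Module.End ℂ ℂ) t) p = algebraMap ℂ (Module.End ℂ ℂ) (p.eval t)
    rw [aeval_algebraMap_apply, coe_aeval_eq_eval]
  exact LinearMap.congr_fun h z

lemma eval_jpTheta (t : ℂ) (Y : (JP (Fin 2)).carrier) (k l : Fin 2 ⊕ Fin 2) :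
    (jpTheta Y k l).eval t = (1 / 2 : ℂ) * wRho t Y k l := by
  change ((1 / 2 : ℂ) • wMat Y.1 k l).eval t = (1 / 2 : ℂ) * (Y.1 k l + t * fromBlocks 0 Y.1.toBlocks₂₁ 0 0 k l)
  rw [eval_smul, smul_eq_mul, wMat_apply]
  rcases k with k | k <;> rcases l with l | l <;> simp [toBlocks₂₁, mul_comm t]

lemma polyMatAct_line (t : ℂ) (d : ZMod 2) (Y : (JP (Fin 2)).carrier) (v : Fin 2 ⊕ Fin 2 → ℂ) :
    (W t).act Y v = polyMatAct (Fin 2) (PolyModGr.line t d) (jpTheta Y) v := by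
  funext k
  refine Eq.trans ?_ (polyMatAct_apply (PolyModGr.line t d) (jpTheta Y) v k).symm
  refine Eq.trans ?_ (Finset.sum_congr rfl fun l _ =>
    (PolyModGr.line_act t d (jpTheta Y k l) (v l)).symm)
  change (1 / 2 : ℂ) * ∑ l, wRho t Y k l * v l = _
  rw [Finset.mul_sum]
  exact Finset.sum_congr rfl fun l _ => by rw [eval_jpTheta, mul_assoc]

/-- `W(t)` as the module obtained from the even one-dimensional `ℂ[x]`-module. -/
def matRepLineIso (t : ℂ) : W t ≅ matRep jpTheta (PolyModGr.line t 0) :=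
  SuperRep.isoOfEquiv (V := W t) (W := matRep jpTheta (PolyModGr.line t 0))
    (LinearEquiv.refl ℂ (Fin 2 ⊕ Fin 2 → ℂ))
    (fun i v hv => by
      rcases zmod2_cases i with rfl | rfl
      · have hv' : ∀ k, v (Sum.inr k) = 0 := hv
        exact ⟨fun k => Submodule.mem_top (R := ℂ) (M := ℂ), fun k => hv' k⟩
      · have hv' : ∀ k, v (Sum.inl k) = 0 := hv
        exact ⟨fun k => hv' k, fun k => Submodule.mem_top (R := ℂ) (M := ℂ)⟩)
    (polyMatAct_line t 0)

/-- `W(t)^op` as the module obtained from the odd one-dimensional `ℂ[x]`-module. -/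
def matRepLineIsoOp (t : ℂ) : (W t).op ≅ matRep jpTheta (PolyModGr.line t 1) :=
  SuperRep.isoOfEquiv (V := (W t).op) (W := matRep jpTheta (PolyModGr.line t 1))
    (LinearEquiv.refl ℂ (Fin 2 ⊕ Fin 2 → ℂ))
    (fun i v hv => by
      rcases zmod2_cases i with rfl | rfl
      · have hv' : ∀ k, v (Sum.inl k) = 0 := hv
        exact ⟨fun k => hv' k, fun k => Submodule.mem_top (R := ℂ) (M := ℂ)⟩
      · have hv' : ∀ k, v (Sum.inr k) = 0 := hv
        exact ⟨fun k => Submodule.mem_top (R := ℂ) (M := ℂ), fun k => hv' k⟩)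
    (polyMatAct_line t 1)

lemma IsSpecialJP2.of_iso {V V' : SuperRep (JP (Fin 2)).carrier} (e : V ≅ V')
    (h : IsSpecialJP2 V') : IsSpecialJP2 V := by
  rw [isSpecialJP2_iff] at h ⊢
  have hinj := (SuperRep.bijective_of_isIso e.hom).1
  obtain ⟨⟨h1, h2⟩, h3⟩ := h
  refine ⟨⟨fun i j a ha v hv => ?_, fun i j a ha b hb v => hinj ?_⟩,
    LinearMap.ext fun v => hinj ?_⟩
  · have := e.inv.map_grading _ _ (h1 i j a ha _ (e.hom.map_grading j v hv))
    rwa [← e.hom.map_act, SuperRep.iso_apply] at this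
  · simp only [map_add, map_smul, SuperRep.Hom.map_act]
    exact h2 i j a ha b hb _
  · rw [SuperRep.Hom.map_act, h3]
    simp

instance simple_jpFunctor_line (t : ℂ) (d : ZMod 2) :
    Simple (jpFunctor.obj (PolyModGr.line t d)) := simple_obj jpFunctor _

/-- Special modules over `JP(2)` are graded modules over `ℂ[x]`. -/
def jpEquivalence : JP2ModHalf ≌ PolyModGr := jpFunctor.asEquivalence.symm

/-- Very short graded modules over the universal central extension of `P(3)` are graded modules
over `ℂ[x]`. -/
def p3hatEquivalence : P3hatModHalf ≌ PolyModGr := plusFunctor.asEquivalence.trans jpEquivalence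

instance : jpEquivalence.functor.Additive :=
  have : jpFunctor.asEquivalence.functor.Additive := inferInstanceAs jpFunctor.Additive
  jpFunctor.asEquivalence.inverse_additive

instance : jpEquivalence.functor.Linear ℂ :=
  have : jpFunctor.asEquivalence.functor.Additive := inferInstanceAs jpFunctor.Additive
  have : jpFunctor.asEquivalence.functor.Linear ℂ := inferInstanceAs (jpFunctor.Linear ℂ)
  inferInstanceAs (jpFunctor.asEquivalence.inverse.Linear ℂ)

instance : p3hatEquivalence.functor.Additive :=
  inferInstanceAs ((plusFunctor ⋙ jpEquivalence.functor).Additive)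

instance : p3hatEquivalence.functor.Linear ℂ :=
  inferInstanceAs ((plusFunctor ⋙ jpEquivalence.functor).Linear ℂ)

end SuperJP
end

theorem mainTheorem4 :
    -- every block has a unique simple object, up to isomorphism
    (SuperJP.BlocksHaveUniqueSimple SuperJP.P3hatModHalf ∧
      SuperJP.BlocksHaveUniqueSimple SuperJP.JP2ModHalf) ∧
    -- both categories are equivalent (by a linear functor) to graded modules over the polynomials
    ((∃ F : SuperJP.P3hatModHalf ≌ SuperJP.PolyModGr, F.functor.Additive ∧ F.functor.Linear ℂ) ∧
      (∃ F : SuperJP.JP2ModHalf ≌ SuperJP.PolyModGr, F.functor.Additive ∧ F.functor.Linear ℂ)) ∧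
    -- the modules `W(t)` and their opposites are simple special modules ...
    (∀ t : ℂ, ∃ (h : SuperJP.IsSpecialJP2 (SuperJP.W t))
        (h' : SuperJP.IsSpecialJP2 (SuperJP.W t).op),
        Simple (⟨SuperJP.W t, h⟩ : SuperJP.JP2ModHalf) ∧
        Simple (⟨(SuperJP.W t).op, h'⟩ : SuperJP.JP2ModHalf)) ∧
    -- ... and every simple special module is isomorphic to one of them
    (∀ S : SuperJP.JP2ModHalf, Simple S →
      ∃ t : ℂ, Nonempty (S.obj ≅ SuperJP.W t) ∨ Nonempty (S.obj ≅ (SuperJP.W t).op)) := by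
  open SuperJP in
  refine ⟨⟨blocksHaveUniqueSimple_of_equivalence p3hatEquivalence.functor,
      blocksHaveUniqueSimple_of_equivalence jpEquivalence.functor⟩,
    ⟨⟨p3hatEquivalence, inferInstance, inferInstance⟩,
      ⟨jpEquivalence, inferInstance, inferInstance⟩⟩, fun t => ?_, fun S hS => ?_⟩
  · refine ⟨.of_iso (matRepLineIso t) (isSpecialJP2_matRep _),
      .of_iso (matRepLineIsoOp t) (isSpecialJP2_matRep _), ?_, ?_⟩
    · exact Simple.of_iso (Y := jpFunctor.obj (PolyModGr.line t 0))
        (ObjectProperty.isoMk _ (matRepLineIso t))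
    · exact Simple.of_iso (Y := jpFunctor.obj (PolyModGr.line t 1))
        (ObjectProperty.isoMk _ (matRepLineIsoOp t))
  · have : Simple (jpEquivalence.functor.obj S) := simple_obj jpEquivalence.functor S
    obtain ⟨t, d, ⟨e⟩⟩ := PolyModGr.exists_iso_line (jpEquivalence.functor.obj S)
    let e' : S ≅ jpFunctor.obj (PolyModGr.line t d) :=
      jpEquivalence.unitIso.app S ≪≫ jpFunctor.mapIso e.symm
    let e'' : S.obj ≅ matRep jpTheta (PolyModGr.line t d) :=
      (ObjectProperty.ι _).mapIso e'
    rcases zmod2_cases d with rfl | rfl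
    · exact ⟨t, Or.inl ⟨e'' ≪≫ (matRepLineIso t).symm⟩⟩
    · exact ⟨t, Or.inr ⟨e'' ≪≫ (matRepLineIsoOp t).symm⟩⟩
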